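/- Let $n\ge 1$ and let $A_0(n)$ be the crystallization of $C(SU_q(n+1))$, i.e. the universal unital $C^*$-algebra with generators $z_{i,j}$, $1\le i,j\le n+1$, and relations \[ \begin{aligned} &z_{i,j}z_{i,l}=0\ (j<l),\qquad z_{i,j}z_{k,j}=0\ (i<k),\qquad z_{1,1}z_{2,2}\cdots z_{n+1,n+1}=1,\\ &\text{and, for } i<k,\ j<l:\quad z_{i,l}z_{k,j}=z_{k,j}z_{i,l},\\ &\qquad z_{i,l}z_{k,j}=0\ \text{ if }\max(i,j)\ge\min(k,l),\\ &\qquad z_{i,j}z_{k,l}-z_{k,l}z_{i,j}=z_{i,l}z_{k,j}\ \text{ if }\max(i,j)+1=\min(k,l),\\ &\qquad z_{i,j}z_{k,l}=z_{k,l}z_{i,j}\ \text{ if }\max(i,j)+1<\min(k,l),\\ &z_{r,s}^*=(z_{1,1}\cdots z_{s-1,s-1})(z_{s,s+1}z_{s+1,s+2}\cdots z_{r-1,r})(z_{r+1,r+1}\cdots z_{n+1,n+1})\quad (s\le r),\\ &z_{r,s}^*=(z_{1,1}\cdots z_{r-1,r-1})(z_{r+1,r}z_{r+2,r+1}\cdots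 z_{s,s-1})(z_{s+1,s+1}\cdots z_{n+1,n+1})\quad (r<s). \end{aligned} \] The convolution $\pi*\rho$ of two representations, on the Hilbert space tensor product, is given by $(\pi*\rho)(z_{i,j})=\sum_{k=\min(i,j)}^{\max(i,j)}\pi(z_{i,k})\otimes\rho(z_{k,j})$. Let $S$ be the backward shift on $\ell^2(\mathbb N)$, $Se_0=0$, $Se_{k+1}=e_k$, and $P_0=1-S^*S$. For $1\le r\le n$ let $s_r=(r,r+1)\in S_{n+1}$ and let $\pi_{s_r}$ be the representation on $\ell^2(\mathbb N)$ with $z_{r,r}\mapsto S$, $z_{r+1,r+1}\mapsto S^*$, $z_{r,r+1}\mapsto P_0$, $z_{r+1,r}\mapsto P_0$ and $z_{i,j}\mapsto\delta_{i,j}1$ otherwise. For a word $a=s_{i_1}\cdots s_{i_m}$ put $\pi_a=\pi_{s_{i_1}}*\cdots*\pi_{s_{i_m}}$ (for the empty word, the one-dimensional representation $z_{i,j}\mapsto\delta_{i,j}$). For $t=(t_1,\dots,t_n)\in\mathbb T=\{\lambda\in\mathbb C:|\lambda|=1\}^n$ let $\chi_t$ be the one-dimensional representation $z_{i,j}\mapsto\delta_{i,j}\,\overline{t_{i-1}}\,t_i$,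 where $t_0=t_{n+1}=1$, and put $\pi_{t,a}=\chi_t*\pi_a$. Then: 1. If $a$ and $b$ are two reduced expressions of the same permutation $w\in S_{n+1}$, then $\pi_a$ and $\pi_b$ (exist and) are unitarily equivalent. 2. The irreducible representations of $A_0(n)$ are indexed by $\mathbb T\times S_{n+1}$: for every $t\in\mathbb T$ and every reduced expression $a$ of $w\in S_{n+1}$, $\pi_{t,a}$ is an irreducible representation of $A_0(n)$; for reduced expressions $a$ of $w$ and $a'$ of $w'$, $\pi_{t,a}$ and $\pi_{t',a'}$ are unitarily equivalent if and only if $t=t'$ and $w=w'$; and for every irreducible representation $\sigma$ of $A_0(n)$ on a Hilbert space there is exactly one pair $(t,w)\in\mathbb T\times S_{n+1}$ such that $\sigma$ is unitarily equivalent to $\pi_{t,a}$ for some reduced expression $a$ of $w$. -/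

import Mathlib

namespace CrystalSU

open scoped ENNReal

/-- The defining relations of the crystallization `C(SU_0(n+1))` for a family `z i j` of elements of
a star ring: the `q → 0+` limits of the relations of `C(SU_q(n+1))` for the rescaled generators
`(-q) ^ min (i - j) 0 * z i j (q)`. Indices run over `0, ..., n` instead of `1, ..., n + 1`.

In `star_eq`, row `r` and column `s` are deleted and the remaining rows and columns are matched
in increasing order, i.e. `star (z r s)` is
`z 0 0 ⋯ z (s-1) (s-1) * z s (s+1) ⋯ z (r-1) r * z (r+1) (r+1) ⋯ z n n` for `s ≤ r`, and
`z 0 0 ⋯ z (r-1) (r-1) * z (r+1) r ⋯ z s (s-1) * z (s+1) (s+1) ⋯ z n n` for `r < s`. -/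
structure IsCrystalFamily {n : ℕ} {B : Type*} [Ring B] [StarRing B]
    (z : Fin (n + 1) → Fin (n + 1) → B) : Prop where
  row : ∀ i j l, j < l → z i j * z i l = 0
  col : ∀ i k j, i < k → z i j * z k j = 0
  anti_comm : ∀ i k j l, i < k → j < l → z i l * z k j = z k j * z i l
  anti_zero : ∀ i k j l, i < k → j < l → (min k l).val ≤ (max i j).val → z i l * z k j = 0
  diag_adjacent : ∀ i k j l, i < k → j < l → (max i j).val + 1 = (min k l).val →
    z i j * z k l - z k l * z i j = z i l * z k j
  diag_far : ∀ i k j l, i < k → j < l → (max i j).val + 1 < (min k l).val →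
    z i j * z k l = z k l * z i j
  det_one : (List.ofFn fun i => z i i).prod = 1
  star_eq : ∀ r s, star (z r s) =
    (List.ofFn fun k : Fin n => z (r.succAbove k) (s.succAbove k)).prod

namespace IsCrystalFamily

variable {n : ℕ} {B : Type*}

theorem transpose [Ring B] [StarRing B] {z : Fin (n + 1) → Fin (n + 1) → B}
    (h : IsCrystalFamily z) : IsCrystalFamily fun i j => z j i where
  row i j l hjl := h.col j l i hjl
  col i k j hik := h.row j i k hik
  anti_comm i k j l hik hjl := (h.anti_comm j l i k hjl hik).symm
  anti_zero i k j l hik hjl hm := by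
    rw [← h.anti_comm j l i k hjl hik]
    exact h.anti_zero j l i k hjl hik (by rwa [max_comm j i, min_comm l k])
  diag_adjacent i k j l hik hjl hm := by
    rw [← h.anti_comm j l i k hjl hik]
    exact h.diag_adjacent j l i k hjl hik (by rwa [max_comm j i, min_comm l k])
  diag_far i k j l hik hjl hm :=
    h.diag_far j l i k hjl hik (by rwa [max_comm j i, min_comm l k])
  det_one := h.det_one
  star_eq r s := h.star_eq s r

/-- Rows of the lower triangle are co-isometric. -/
theorem sum_mul_star [Ring B] [StarRing B] {z : Fin (n + 1) → Fin (n + 1) → B}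
    (h : IsCrystalFamily z) (r : Fin (n + 1)) :
    ∑ s ∈ Finset.Iic r, z r s * star (z r s) = 1 := by
  let Z : ℕ → ℕ → B := fun i j =>
    if h : i < n + 1 ∧ j < n + 1 then z ⟨i, h.1⟩ ⟨j, h.2⟩ else 0
  have hZ : ∀ i j : Fin (n + 1), Z i j = z i j := fun i j => dif_pos ⟨i.2, j.2⟩
  have hZ' : ∀ (i j : ℕ) (hi : i < n + 1) (hj : j < n + 1), Z i j = z ⟨i, hi⟩ ⟨j, hj⟩ :=
    fun i j hi hj => dif_pos ⟨hi, hj⟩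
  have hr := r.2
  let A : ℕ → B := fun s => ((List.range s).map fun i => Z i i).prod
  let D : B := ((List.range' r (n - r)).map fun i => Z (i + 1) (i + 1)).prod
  let C : ℕ → B := fun s => ((List.range' s (r - s)).map fun i => Z i (i + 1)).prod * D
  have hstar : ∀ s : Fin (n + 1), s ≤ r → star (z r s) = A s * C s := by
    intro s hs
    have hs' : (s : ℕ) ≤ r := hs
    rw [h.star_eq r s]
    let g : ℕ → B := fun k => if k < s then Z k k else if k < r then Z k (k + 1)
      else Z (k + 1) (k + 1)
    have h1 : (List.ofFn fun k : Fin n => z (r.succAbove k) (s.succAbove k))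
        = (List.range n).map g := by
      refine List.ext_getElem (by simp) fun k hk _ => ?_
      simp only [List.length_ofFn] at hk
      simp only [List.getElem_ofFn, List.getElem_map, List.getElem_range, g]
      rw [← hZ]
      simp only [Fin.succAbove, Fin.lt_def, Fin.val_castSucc]
      split_ifs <;> first | rfl | (exfalso; omega)
    have h2 : List.range n = List.range s ++ (List.range' s (r - s) ++ List.range' r (n - r)) := by
      have a1 : List.range' s (r - s) ++ List.range' r (n - r) = List.range' s (n - s) := by
        have b1 : (r : ℕ) = s + (r - s) := by omega
        have b2 : n - (s : ℕ) = (r - s) + (n - r) := by omega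
        conv_lhs => arg 2; rw [b1]
        rw [List.range'_append_1, b2, ← b1]
      have b3 : n = s + (n - s) := by omega
      have a2 := List.range'_append_1 (s := 0) (m := s) (n := n - s)
      rw [zero_add, ← b3] at a2
      rw [a1, List.range_eq_range', List.range_eq_range', a2]
    rw [h1, h2, List.map_append, List.map_append, List.prod_append, List.prod_append]
    congr 1
    · congr 1
      refine List.map_congr_left fun k hk => ?_
      simp only [List.mem_range] at hk
      simp [g, hk]
    · congr 2
      · refine List.map_congr_left fun k hk => ?_
        simp only [List.mem_range'_1] at hk
        have a1 : ¬ k < (s : ℕ) := by omega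
        have a2 : k < (r : ℕ) := by omega
        simp [g, a1, a2]
      · refine List.map_congr_left fun k hk => ?_
        simp only [List.mem_range'_1] at hk
        have a1 : ¬ k < (s : ℕ) := by omega
        have a2 : ¬ k < (r : ℕ) := by omega
        simp [g, a1, a2]
  have hdet : A r * z r r * D = 1 := by
    have h1 : (List.ofFn fun i => z i i) = (List.range (n + 1)).map fun i => Z i i := by
      refine List.ext_getElem (by simp) fun k hk _ => ?_
      simp only [List.length_ofFn] at hk
      simp only [List.getElem_ofFn, List.getElem_map, List.getElem_range]
      exact (hZ _ _).symm
    have h2 : List.range (n + 1) = List.range r ++ (r : ℕ) :: List.range' (r + 1) (n - r) := by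
      have b3 : n + 1 = r + (n - r + 1) := by omega
      have a2 := List.range'_append_1 (s := 0) (m := r) (n := n - r + 1)
      rw [zero_add, ← b3, List.range'_succ] at a2
      rw [List.range_eq_range', List.range_eq_range', a2]
    have h3 : List.range' ((r : ℕ) + 1) (n - r) = (List.range' r (n - r)).map (· + 1) := by
      refine List.ext_getElem (by simp) fun k _ _ => ?_
      simp; omega
    rw [← h.det_one, h1, h2, h3, ← hZ]
    simp [A, D, mul_assoc, Function.comp_def]
  have key : ∀ m : ℕ, m ≤ r → ∑ s ∈ Finset.range (m + 1), Z r s * star (Z r s)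
      = A m * Z r m * C m := by
    intro m
    induction m with
    | zero =>
      intro _
      have := hstar 0 (Fin.zero_le _)
      have h0 : Z r 0 = z r 0 := hZ r 0
      simp only [zero_add, Finset.sum_range_one, h0, this]
      simp [A]
    | succ m ih =>
      intro hm
      have hm1 : m + 1 < n + 1 := by omega
      have e1 : star (Z r (m + 1)) = A (m + 1) * C (m + 1) := by
        have := hstar ⟨m + 1, hm1⟩ hm
        rwa [← hZ] at this
      have e2 : A (m + 1) = A m * Z m m := by
        simp [A, List.range_succ]
      have e3 : C m = Z m (m + 1) * C (m + 1) := by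
        have : (r : ℕ) - m = (r - (m + 1)) + 1 := by omega
        simp only [C]
        rw [this, List.range'_succ]
        simp [mul_assoc]
      have e4 : Commute (Z r (m + 1)) (A m) := by
        refine Commute.list_prod_right _ _ fun x hx => ?_
        simp only [List.mem_map, List.mem_range] at hx
        obtain ⟨i, hi, rfl⟩ := hx
        have hi1 : i < n + 1 := by omega
        have := h.diag_far ⟨i, hi1⟩ r ⟨i, hi1⟩ ⟨m + 1, hm1⟩
          (by rw [Fin.lt_def]; simp only; omega) (by rw [Fin.lt_def]; simp only; omega)
          (by rw [max_self]
              rcases min_choice r ⟨m + 1, hm1⟩ with hh | hh <;> rw [hh] <;> simp only <;> omega)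
        rw [hZ' i i hi1 hi1, hZ' r (m + 1) r.2 hm1]
        exact this.symm
      have hm0 : m < n + 1 := by omega
      have lt1 : (⟨m, hm0⟩ : Fin (n + 1)) < r := by rw [Fin.lt_def]; simp only; omega
      have lt2 : (⟨m, hm0⟩ : Fin (n + 1)) < ⟨m + 1, hm1⟩ := by rw [Fin.lt_def]; simp
      have e5 : Z m m * Z r (m + 1) - Z r (m + 1) * Z m m = Z r m * Z m (m + 1) := by
        have a1 := h.diag_adjacent ⟨m, hm0⟩ r ⟨m, hm0⟩ ⟨m + 1, hm1⟩ lt1 lt2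
          (by rw [max_self, min_eq_right (show (⟨m + 1, hm1⟩ : Fin (n + 1)) ≤ r from hm)])
        rw [h.anti_comm ⟨m, hm0⟩ r ⟨m, hm0⟩ ⟨m + 1, hm1⟩ lt1 lt2] at a1
        rw [hZ' m m hm0 hm0, hZ' r (m + 1) r.2 hm1, hZ' r m r.2 hm0, hZ' m (m + 1) hm0 hm1]
        exact a1
      rw [Finset.sum_range_succ, ih (by omega), e1, e2, e3]
      have e6 : Z r m * (Z m (m + 1) * C (m + 1))
          = (Z m m * Z r (m + 1) - Z r (m + 1) * Z m m) * C (m + 1) := by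
        rw [e5, mul_assoc]
      rw [mul_assoc (A m) (Z r m), e6]
      have e7 : Z r (m + 1) * (A m * Z m m * C (m + 1))
          = A m * (Z r (m + 1) * Z m m * C (m + 1)) := by
        rw [mul_assoc (A m), ← mul_assoc, e4.eq]
        simp only [mul_assoc]
      rw [e7]
      noncomm_ring
  have hfin := key r le_rfl
  have hC : C r = D := by simp [C]
  rw [hZ, hC, hdet] at hfin
  rw [← hfin]
  refine Finset.sum_bij (fun s _ => (s : ℕ)) ?_ ?_ ?_ ?_
  · intro s hs
    simp only [Finset.mem_Iic, Fin.le_def] at hs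
    simp only [Finset.mem_range]; omega
  · intro a _ b _ hab
    exact Fin.ext hab
  · intro b hb
    simp only [Finset.mem_range] at hb
    exact ⟨⟨b, by omega⟩, by simp only [Finset.mem_Iic, Fin.le_def]; omega, rfl⟩
  · intro s _
    rw [hZ]

/-- The relations force every generator to be a contraction. -/
theorem norm_le_one [CStarAlgebra B] [Nontrivial B] {z : Fin (n + 1) → Fin (n + 1) → B}
    (h : IsCrystalFamily z) (i j : Fin (n + 1)) : ‖z i j‖ ≤ 1 := by
  have main : ∀ {w : Fin (n + 1) → Fin (n + 1) → B}, IsCrystalFamily w → ∀ r s, s ≤ r →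
      ‖w r s‖ ≤ 1 := by
    intro w hw r s hs
    let _ : PartialOrder B := CStarAlgebra.spectralOrder B
    have _ : StarOrderedRing B := CStarAlgebra.spectralOrderedRing B
    have h1 : w r s * star (w r s) ≤ 1 := by
      rw [← hw.sum_mul_star r]
      exact Finset.single_le_sum (f := fun s => w r s * star (w r s))
        (fun i _ => mul_star_self_nonneg _) (Finset.mem_Iic.2 hs)
    have h2 := (CStarAlgebra.norm_le_one_iff_of_nonneg _ (mul_star_self_nonneg (w r s))).2 h1
    rw [CStarRing.norm_self_mul_star] at h2
    nlinarith [norm_nonneg (w r s)]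
  rcases le_total j i with hij | hij
  · exact main h i j hij
  · exact main h.transpose j i hij

end IsCrystalFamily

/-! ### The universal C*-algebra of the relations -/

/-- A nonzero unital C*-algebra with elements satisfying the crystal relations. -/
structure CrystalModel (n : ℕ) where
  carrier : Type
  [cstar : CStarAlgebra carrier]
  [nontriv : Nontrivial carrier]
  gen : Fin (n + 1) → Fin (n + 1) → carrier
  crystal : IsCrystalFamily gen

attribute [instance] CrystalModel.cstar CrystalModel.nontriv

noncomputable section

/-- The `ℓ^∞`-product of all models. -/
abbrev ModelProduct (n : ℕ) : Type 1 := lp (fun M : CrystalModel n => M.carrier) ∞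

instance (n : ℕ) : CStarAlgebra (ModelProduct n) where

/-- The element of the product whose component at each model is the generator `z i j` there. -/
def modelGen {n : ℕ} (i j : Fin (n + 1)) : ModelProduct n :=
  ⟨fun M => M.gen i j, memℓp_infty ⟨1, by rintro _ ⟨M, rfl⟩; exact M.crystal.norm_le_one i j⟩⟩

/-- The universal unital C*-algebra with generators `gen i j`, `0 ≤ i, j ≤ n`, subject to the crystal
relations: the C*-subalgebra generated by the `modelGen i j` in the product of all models. -/
def CrystalAlgebra (n : ℕ) : Type 1 :=
  (StarAlgebra.adjoin ℂ (Set.range fun p : Fin (n + 1) × Fin (n + 1) =>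
    modelGen p.1 p.2)).topologicalClosure

instance (n : ℕ) : CStarAlgebra (CrystalAlgebra n) :=
  StarSubalgebra.cstarAlgebra
    (StarAlgebra.adjoin ℂ (Set.range fun p : Fin (n + 1) × Fin (n + 1) =>
      modelGen p.1 p.2)).topologicalClosure
    (h_closed := StarSubalgebra.isClosed_topologicalClosure _)

namespace CrystalAlgebra

variable {n : ℕ}

/-- The canonical generators. -/
def gen (i j : Fin (n + 1)) : CrystalAlgebra n :=
  ⟨modelGen i j, StarSubalgebra.le_topologicalClosure _
    (StarAlgebra.subset_adjoin ℂ _ ⟨(i, j), rfl⟩)⟩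

/-- Evaluation at a model. -/
def eval (M : CrystalModel n) : CrystalAlgebra n →⋆ₐ[ℂ] M.carrier where
  toFun x := x.1 M
  map_one' := rfl
  map_mul' _ _ := rfl
  map_zero' := rfl
  map_add' _ _ := rfl
  commutes' _ := rfl
  map_star' _ := rfl

theorem eval_gen (M : CrystalModel n) (i j : Fin (n + 1)) : eval M (gen i j) = M.gen i j := rfl

theorem eval_ext {x y : CrystalAlgebra n} (h : ∀ M, eval M x = eval M y) : x = y :=
  Subtype.ext (lp.ext (funext h))

/-- A representation is determined by its values on the generators. -/
theorem hom_ext {B : Type*} [CStarAlgebra B] {φ ψ : CrystalAlgebra n →⋆ₐ[ℂ] B}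
    (h : ∀ i j, φ (gen i j) = ψ (gen i j)) : φ = ψ := by
  have hφ : Continuous φ := AddMonoidHomClass.continuous_of_bound φ 1
    (by simpa only [one_mul] using NonUnitalStarAlgHom.norm_apply_le φ)
  have hψ : Continuous ψ := AddMonoidHomClass.continuous_of_bound ψ 1
    (by simpa only [one_mul] using NonUnitalStarAlgHom.norm_apply_le ψ)
  refine StarAlgHom.ext_topologicalClosure (R := ℂ) (S := StarAlgebra.adjoin ℂ (Set.range
    fun p : Fin (n + 1) × Fin (n + 1) => modelGen p.1 p.2)) hφ hψ ?_
  refine StarAlgHom.ext_adjoin ?_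
  rintro ⟨_, hx⟩ ⟨⟨i, j⟩, rfl⟩
  exact h i j

theorem eval_list (M : CrystalModel n) (l : List (CrystalAlgebra n)) :
    eval M l.prod = (l.map (eval M)).prod := map_list_prod _ _

theorem isCrystalFamily_gen : IsCrystalFamily (gen (n := n)) where
  row i j l hjl := eval_ext fun M => by simpa [eval_gen] using M.crystal.row i j l hjl
  col i k j h := eval_ext fun M => by simpa [eval_gen] using M.crystal.col i k j h
  anti_comm i k j l h h' := eval_ext fun M => by
    simpa [eval_gen] using M.crystal.anti_comm i k j l h h'
  anti_zero i k j l h h' h'' := eval_ext fun M => by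
    simpa only [map_mul, map_zero, eval_gen] using M.crystal.anti_zero i k j l h h' h''
  diag_adjacent i k j l h h' h'' := eval_ext fun M => by
    simpa only [map_sub, map_mul, eval_gen] using M.crystal.diag_adjacent i k j l h h' h''
  diag_far i k j l h h' h'' := eval_ext fun M => by
    simpa only [map_mul, eval_gen] using M.crystal.diag_far i k j l h h' h''
  det_one := eval_ext fun M => by
    rw [eval_list, List.map_ofFn, map_one]
    exact M.crystal.det_one
  star_eq r s := eval_ext fun M => by
    rw [map_star, eval_list, List.map_ofFn]
    exact M.crystal.star_eq r s

/-- The universal property. -/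
theorem existsUnique_lift {B : Type} [CStarAlgebra B] {w : Fin (n + 1) → Fin (n + 1) → B}
    (hw : IsCrystalFamily w) :
    ∃! φ : CrystalAlgebra n →⋆ₐ[ℂ] B, ∀ i j, φ (gen i j) = w i j := by
  refine existsUnique_of_exists_of_unique ?_ fun φ ψ h h' => hom_ext fun i j => by rw [h, h']
  rcases subsingleton_or_nontrivial B with hB | hB
  · exact ⟨{ toFun := fun _ => 0
             map_one' := Subsingleton.elim _ _
             map_mul' := fun _ _ => Subsingleton.elim _ _
             map_zero' := Subsingleton.elim _ _
             map_add' := fun _ _ => Subsingleton.elim _ _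
             commutes' := fun _ => Subsingleton.elim _ _
             map_star' := fun _ => Subsingleton.elim _ _ }, fun _ _ => Subsingleton.elim _ _⟩
  · exact ⟨eval { carrier := B, gen := w, crystal := hw }, fun _ _ => rfl⟩

end CrystalAlgebra

/-! ### Hilbert space tensor products -/

section Tensor

open UniformSpace TensorProduct

/-- The Hilbert space tensor product. -/
abbrev HilbertTensor (H K : Type*) [NormedAddCommGroup H] [InnerProductSpace ℂ H]
    [NormedAddCommGroup K] [InnerProductSpace ℂ K] : Type _ :=
  Completion (H ⊗[ℂ] K)

theorem inner_map_id {H K : Type*} [NormedAddCommGroup H] [InnerProductSpace ℂ H]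
    [CompleteSpace H] [NormedAddCommGroup K] [InnerProductSpace ℂ K]
    (A : H →L[ℂ] H) (x y : H ⊗[ℂ] K) :
    inner ℂ (TensorProduct.map (A : H →ₗ[ℂ] H) LinearMap.id x) y
      = inner ℂ x (TensorProduct.map (A.adjoint : H →ₗ[ℂ] H) LinearMap.id y) := by
  induction x with
  | zero => simp
  | add x₁ x₂ h₁ h₂ => simp only [map_add, inner_add_left, h₁, h₂]
  | tmul a b =>
    induction y with
    | zero => simp
    | add y₁ y₂ h₁ h₂ => simp only [map_add, inner_add_right, h₁, h₂]
    | tmul c d => simp [TensorProduct.inner_tmul, ContinuousLinearMap.adjoint_inner_right]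

theorem norm_map_id_le {H K : Type*} [NormedAddCommGroup H] [InnerProductSpace ℂ H]
    [CompleteSpace H] [NormedAddCommGroup K] [InnerProductSpace ℂ K]
    (A : H →L[ℂ] H) (x : H ⊗[ℂ] K) :
    ‖TensorProduct.map (A : H →ₗ[ℂ] H) LinearMap.id x‖ ≤ ‖A‖ * ‖x‖ := by
  have e1 : TensorProduct.map
      ((algebraMap ℝ (H →L[ℂ] H) (‖A‖ ^ 2) - star A * A : H →L[ℂ] H) : H →ₗ[ℂ] H) LinearMap.id x
      = ((‖A‖ ^ 2 : ℝ) : ℂ) • x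
        - TensorProduct.map ((star A * A : H →L[ℂ] H) : H →ₗ[ℂ] H) LinearMap.id x := by
    induction x with
    | zero => simp
    | add x₁ x₂ h₁ h₂ =>
      simp only [map_add, smul_add] at h₁ h₂ ⊢
      rw [h₁, h₂]
      abel
    | tmul a b =>
      have e2 : (algebraMap ℝ (H →L[ℂ] H) (‖A‖ ^ 2) - star A * A) a
          = ((‖A‖ ^ 2 : ℝ) : ℂ) • a - (star A * A) a := by
        rw [Complex.coe_smul, sub_apply, Algebra.algebraMap_eq_smul_one]
        rfl
      simp only [TensorProduct.map_tmul, ContinuousLinearMap.coe_coe, LinearMap.id_apply]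
      rw [e2, TensorProduct.sub_tmul, TensorProduct.smul_tmul']
  have hle : star A * A ≤ algebraMap ℝ (H →L[ℂ] H) (‖A‖ ^ 2) :=
    CStarAlgebra.star_mul_le_algebraMap_norm_sq
  obtain ⟨C, hC⟩ := CStarAlgebra.nonneg_iff_eq_star_mul_self.1 (sub_nonneg.2 hle)
  have hsq : ∀ T : H →L[ℂ] H, ((‖TensorProduct.map (T : H →ₗ[ℂ] H) LinearMap.id x‖ ^ 2 : ℝ) : ℂ)
      = inner ℂ x (TensorProduct.map ((star T * T : H →L[ℂ] H) : H →ₗ[ℂ] H) LinearMap.id x) := by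
    intro T
    have h1 := inner_self_eq_norm_sq_to_K (𝕜 := ℂ)
      (TensorProduct.map (T : H →ₗ[ℂ] H) LinearMap.id x)
    rw [inner_map_id, ← LinearMap.comp_apply, ← TensorProduct.map_comp] at h1
    rw [Complex.ofReal_pow]
    exact h1.symm
  have hA := hsq A
  have hCx := hsq C
  rw [← hC] at hCx
  have e3 : inner ℂ x (((‖A‖ ^ 2 : ℝ) : ℂ) • x) = ((‖A‖ ^ 2 : ℝ) : ℂ) * (‖x‖ : ℂ) ^ 2 :=
    (inner_smul_right x x _).trans (congrArg _ (inner_self_eq_norm_sq_to_K x))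
  rw [e1, inner_sub_right, ← hA, e3] at hCx
  have hre : ‖TensorProduct.map (C : H →ₗ[ℂ] H) LinearMap.id x‖ ^ 2
      = ‖A‖ ^ 2 * ‖x‖ ^ 2 - ‖TensorProduct.map (A : H →ₗ[ℂ] H) LinearMap.id x‖ ^ 2 := by
    apply Complex.ofReal_injective
    rw [hCx]
    push_cast
    rfl
  refine abs_le_of_sq_le_sq' ?_ (by positivity) |>.2
  nlinarith [sq_nonneg ‖TensorProduct.map (C : H →ₗ[ℂ] H) LinearMap.id x‖]

variable {H K : Type*} [NormedAddCommGroup H] [InnerProductSpace ℂ H] [CompleteSpace H]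
  [NormedAddCommGroup K] [InnerProductSpace ℂ K] [CompleteSpace K]

theorem norm_map_le (A : H →L[ℂ] H) (B : K →L[ℂ] K) (x : H ⊗[ℂ] K) :
    ‖TensorProduct.map (A : H →ₗ[ℂ] H) (B : K →ₗ[ℂ] K) x‖ ≤ ‖A‖ * ‖B‖ * ‖x‖ := by
  have h1 : TensorProduct.map (A : H →ₗ[ℂ] H) (B : K →ₗ[ℂ] K) x
      = TensorProduct.map (A : H →ₗ[ℂ] H) LinearMap.id
        (TensorProduct.comm ℂ K H (TensorProduct.map (B : K →ₗ[ℂ] K) LinearMap.id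
          (TensorProduct.comm ℂ H K x))) := by
    induction x with
    | zero => simp
    | add x₁ x₂ h₁ h₂ => simp only [map_add, h₁, h₂]
    | tmul a b => simp
  rw [h1]
  refine (norm_map_id_le A _).trans ?_
  rw [TensorProduct.norm_comm, mul_assoc]
  refine mul_le_mul_of_nonneg_left ((norm_map_id_le B _).trans ?_) (norm_nonneg _)
  rw [TensorProduct.norm_comm]

/-- The operator `A ⊗ B` on the Hilbert space tensor product. -/
def tensorOp (A : H →L[ℂ] H) (B : K →L[ℂ] K) : HilbertTensor H K →L[ℂ] HilbertTensor H K :=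
  ((TensorProduct.map (A : H →ₗ[ℂ] H) (B : K →ₗ[ℂ] K)).mkContinuous (‖A‖ * ‖B‖)
    (norm_map_le A B)).completion

theorem tensorOp_tmul (A : H →L[ℂ] H) (B : K →L[ℂ] K) (x : H) (y : K) :
    tensorOp A B ((x ⊗ₜ[ℂ] y : H ⊗[ℂ] K) : HilbertTensor H K)
      = ((A x ⊗ₜ[ℂ] B y : H ⊗[ℂ] K) : HilbertTensor H K) := by
  simp [tensorOp]

end Tensor

/-! ### The operators of the representations -/

/-- The Hilbert space `ℓ²(ℕ)`. -/
abbrev EllTwo : Type := lp (fun _ : ℕ => ℂ) 2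

theorem summable_shift (x : EllTwo) : Summable fun k => ‖x (k + 1)‖ ^ (2 : ℕ) := by
  have h := lp.memℓp x
  rw [memℓp_gen_iff (by norm_num)] at h
  have h' : Summable fun k => ‖x k‖ ^ (2 : ℕ) := by simpa using h
  exact h'.comp_injective (add_left_injective 1)

/-- The backward shift `S` on `ℓ²(ℕ)`: `S e₀ = 0`, `S e_{k+1} = e_k`. -/
def backwardShift : EllTwo →L[ℂ] EllTwo :=
  LinearMap.mkContinuous
    { toFun := fun x => ⟨fun k => x (k + 1), by
        have h := summable_shift x
        exact (memℓp_gen_iff (E := fun _ : ℕ => ℂ) (f := fun k => x (k + 1)) (by norm_num)).2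
          (by simpa using h)⟩
      map_add' := fun _ _ => rfl
      map_smul' := fun _ _ => rfl } 1 (by
    intro x
    rw [one_mul]
    refine abs_le_of_sq_le_sq' ?_ (norm_nonneg _) |>.2
    have hn : ∀ y : EllTwo, ‖y‖ ^ 2 = ∑' k, ‖y k‖ ^ (2 : ℕ) := fun y => by
      simpa using lp.norm_rpow_eq_tsum (p := 2) (by norm_num) y
    have hx : Summable fun k => ‖x k‖ ^ (2 : ℕ) := by
      have h := lp.memℓp x
      rw [memℓp_gen_iff (by norm_num)] at h
      simpa using h
    rw [hn, hn, hx.tsum_eq_zero_add]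
    exact le_add_of_nonneg_left (sq_nonneg ‖x 0‖))

theorem backwardShift_apply (x : EllTwo) (k : ℕ) : backwardShift x k = x (k + 1) := rfl

/-- The projection `P₀ = 1 - S* S` onto the line through `e₀`. -/
def vacuumProjection : EllTwo →L[ℂ] EllTwo :=
  1 - backwardShift.adjoint ∘L backwardShift

/-- A Hilbert space with operators indexed like the generators, the candidate values of a
representation of `CrystalAlgebra n` on the generators. -/
structure OperatorFamily (n : ℕ) where
  space : Type
  [normed : NormedAddCommGroup space]
  [inner : InnerProductSpace ℂ space]
  [complete : CompleteSpace space]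
  op : Fin (n + 1) → Fin (n + 1) → space →L[ℂ] space

attribute [instance] OperatorFamily.normed OperatorFamily.inner OperatorFamily.complete

namespace OperatorFamily

variable {n : ℕ}

/-- `π` is the representation of `CrystalAlgebra n` with values `X.op i j` on the generators. -/
def IsRepresentation (X : OperatorFamily n)
    (π : CrystalAlgebra n →⋆ₐ[ℂ] (X.space →L[ℂ] X.space)) : Prop :=
  ∀ i j, π (CrystalAlgebra.gen i j) = X.op i j

/-- The convolution `(X ⊗ Y) ∘ Δ`, where `Δ (z i j)` is the sum of `z i k ⊗ z k j` over
`min i j ≤ k ≤ max i j`. -/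
def conv (X Y : OperatorFamily n) : OperatorFamily n where
  space := HilbertTensor X.space Y.space
  op i j := ∑ k ∈ Finset.Icc (min i j) (max i j), tensorOp (X.op i k) (Y.op k j)

/-- The trivial one-dimensional representation (the unit for convolution). -/
def trivial (n : ℕ) : OperatorFamily n where
  space := ℂ
  op i j := if i = j then 1 else 0

/-- The representation `π_{s_r}` on `ℓ²(ℕ)`, for the transposition `s_r = (r, r+1)`. -/
def elementary (r : Fin n) : OperatorFamily n where
  space := EllTwo
  op i j :=
    if i = r.castSucc ∧ j = r.castSucc then backwardShift
    else if i = r.succ ∧ j = r.succ then backwardShift.adjoint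
    else if i = r.castSucc ∧ j = r.succ then vacuumProjection
    else if i = r.succ ∧ j = r.castSucc then vacuumProjection
    else if i = j then 1
    else 0

/-- The diagonal entries `t₁, conj t₁ * t₂, ..., conj tₙ₋₁ * tₙ, conj tₙ` of the point of the maximal
torus of `SU(n+1)` with coordinates `t`. -/
def torusEntry (t : Fin n → Circle) (i : Fin (n + 1)) : ℂ :=
  (if h : 0 < (i : ℕ) then star (t ⟨i - 1, by omega⟩ : ℂ) else 1) *
    (if h : (i : ℕ) < n then (t ⟨i, h⟩ : ℂ) else 1)

/-- The character `χ_t`. -/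
def character (t : Fin n → Circle) : OperatorFamily n where
  space := ℂ
  op i j := if i = j then torusEntry t i • 1 else 0

/-- `π_a = π_{s_{i₁}} * ⋯ * π_{s_{iₘ}}` for the word `a = [i₁, ..., iₘ]`. -/
def ofWord : List (Fin n) → OperatorFamily n
  | [] => trivial n
  | r :: a => conv (elementary r) (ofWord a)

/-- `π_{t,a} = χ_t * π_a`. -/
def ofTorusWord (t : Fin n → Circle) (a : List (Fin n)) : OperatorFamily n :=
  conv (character t) (ofWord a)

end OperatorFamily

/-! ### Reduced expressions -/

/-- The permutation `s_{i₁} ⋯ s_{iₘ}` expressed by the word `[i₁, ..., iₘ]`, where `s_r` is the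
adjacent transposition `(r, r+1)`. -/
def wordPerm {n : ℕ} (a : List (Fin n)) : Equiv.Perm (Fin (n + 1)) :=
  (a.map fun r => Equiv.swap r.castSucc r.succ).prod

/-- `a` is a reduced expression of the permutation `w`: it expresses `w` and no shorter word does. -/
def IsReducedExpression {n : ℕ} (w : Equiv.Perm (Fin (n + 1))) (a : List (Fin n)) : Prop :=
  wordPerm a = w ∧ ∀ b : List (Fin n), wordPerm b = w → a.length ≤ b.length

/-! ### Representations on Hilbert spaces -/

section Representations

variable {A : Type*} [CStarAlgebra A]

/-- Topological irreducibility: the space is nonzero and its only closed invariant subspaces are the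
trivial ones. -/
def IsIrreducible {H : Type*} [NormedAddCommGroup H] [InnerProductSpace ℂ H] [CompleteSpace H]
    (π : A →⋆ₐ[ℂ] (H →L[ℂ] H)) : Prop :=
  Nontrivial H ∧ ∀ V : Submodule ℂ H, IsClosed (V : Set H) →
    (∀ a, ∀ v ∈ V, π a v ∈ V) → V = ⊥ ∨ V = ⊤

/-- Unitary equivalence of representations. -/
def UnitarilyEquivalent {H K : Type*} [NormedAddCommGroup H] [InnerProductSpace ℂ H]
    [CompleteSpace H] [NormedAddCommGroup K] [InnerProductSpace ℂ K] [CompleteSpace K]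
    (π : A →⋆ₐ[ℂ] (H →L[ℂ] H)) (ρ : A →⋆ₐ[ℂ] (K →L[ℂ] K)) : Prop :=
  ∃ U : H ≃ₗᵢ[ℂ] K, ∀ a v, U (π a v) = ρ a (U v)

end Representations

end

end CrystalSU

/-!
# Irreducible representations of the crystallization of `C(SU_q(n+1))`

By the universal property a representation of the crystal algebra is the same as an array of
operators satisfying the crystal relations, and unitary equivalence and irreducibility can be tested
on the entries (`unitarilyEquivalent_iff`, `isIrreducible_iff`). Arrays are indexed by `ℕ` (with a
bound `n`, `IsCrystalArray`), so that arrays of different sizes can be compared.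

**Reduced expressions.** Convolution with the elementary representation of `s_r` changes only the
rows `r` and `r + 1`, and this row operation preserves the crystal relations
(`IsCrystalArray.shiftArray`). Braid moves of the word change the array by a unitary operator that
permutes the basis vectors `e_a ⊗ e_b` and `e_a ⊗ e_b ⊗ e_c`, in the second case by the piecewise
linear map `(a, b, c) ↦ (b + (c - a)⁺, min a c, b + (a - c)⁺)` (`IsShift.comm_equiv`,
`IsShift.braid_equiv`). Every reduced expression is braid equivalent to the normal word of its
permutation, a product of coset representatives `s_k s_{k+1} ⋯ s_{n-1}` for the chain of symmetric
groups (`IsNormalWord`, `exists_isNormalWord`). So the array of a reduced expression depends, up to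
equivalence, only on the permutation, and only normal words need be considered. The character `χ_t`
multiplies the rows by phases with product one (`natOp_ofTorusWord_equiv`).

**The last column.** The entries of the last column are partial isometries with orthogonal ranges,
and the initial projection of each is the sum of the range projections of the entries above it and
of its own (`IsCrystalArray.star_last_mul_last`). Let row `k` contain the first nonzero one. It is a
normal partial isometry and its functions commute with all lower entries outside row `k`. The spaces
of vacuum vectors are contained in its range; applying the later entries of the last column to them
yields Fock vectors, whose span is invariant under the array (`IsVacuum.dense`). If the entry in row
`k` is a projection, the lower entries outside row `k` act on the vacuum vectors by an array of
smaller size, with row `k` and the last column deleted (`IsVacuumEmbedding`), and this smaller array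
determines the large one, since the inner products of Fock vectors and the action on them follow
from the relations (`IsVacuumEmbedding.arrayEquiv`).

**Normal words.** For the word `s_k ⋯ s_{n-1} a` the first nonzero row is `k`, and the vacuum vectors
`e_0 ⊗ ⋯ ⊗ e_0 ⊗ x` carry the array of `a` (`exists_isVacuumEmbedding`). Induction gives
irreducibility (`IsNormalWord.isIrreducibleArray`) and recovers the word and the phases from the
equivalence class (`IsNormalWord.eq_of_arrayEquiv`).

**Classification.** In an irreducible array, two functions of the first nonzero entry of the last
column with product zero cannot both be nonzero on its support, since each of their ranges would
generate a dense space of Fock vectors; by the functional calculus this entry is a phase times a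
projection (`IsFirstRow.exists_circle_smul`), and the phase can be moved to another row. The operators
on the vacuum vectors then satisfy the crystal relations of the smaller size. This is seen on Fock
vectors with large exponents, where every entry acts as a fixed shift of the exponents combined with
an operator on the vacuum vectors, its symbol; taking symbols is multiplicative, so that relations
between the entries pass to the symbols (`IsVacuumIsometry.isCrystalArray`). The smaller array is
again irreducible, and is a normal word array up to phases by induction, hence so is the given one
(`IsIrreducibleArray.exists_isNormalWord`).
-/

namespace CrystalSU

noncomputable section

/-! ### Crystal relations for arrays indexed by natural numbers -/

section Arrays

/-- The ordered product `f 0 * f 1 * ⋯ * f (m - 1)`. -/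
def rangeProd {B : Type*} [Monoid B] (m : ℕ) (f : ℕ → B) : B := ((List.range m).map f).prod

/-- The increasing enumeration of the natural numbers different from `r`
(`Fin.succAbove` for natural numbers). -/
def skip (r k : ℕ) : ℕ := if k < r then k else k + 1

section Monoid

variable {B : Type*} [Monoid B]

@[simp] theorem rangeProd_zero (f : ℕ → B) : rangeProd 0 f = 1 := rfl

theorem rangeProd_succ (m : ℕ) (f : ℕ → B) : rangeProd (m + 1) f = rangeProd m f * f m := by
  simp [rangeProd, List.range_succ]

theorem rangeProd_congr {m : ℕ} {f g : ℕ → B} (h : ∀ k < m, f k = g k) :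
    rangeProd m f = rangeProd m g := by
  unfold rangeProd
  congr 1
  exact List.map_congr_left fun k hk => h k (List.mem_range.1 hk)

theorem rangeProd_add (p m : ℕ) (f : ℕ → B) :
    rangeProd (p + m) f = rangeProd p f * rangeProd m fun i => f (p + i) := by
  induction m with
  | zero => simp
  | succ m ih => rw [← add_assoc, rangeProd_succ, ih, rangeProd_succ, mul_assoc]

theorem rangeProd_split {p n : ℕ} (hp : p < n) (f : ℕ → B) :
    rangeProd n f = rangeProd p f * f p * rangeProd (n - p - 1) fun i => f (p + 1 + i) := by
  obtain ⟨m, rfl⟩ : ∃ m, n = p + 1 + m := ⟨n - p - 1, by omega⟩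
  rw [rangeProd_add, rangeProd_succ]
  congr 2
  omega

theorem rangeProd_split_two (p m : ℕ) (f : ℕ → B) : rangeProd (p + 2 + m) f
    = rangeProd p f * (f p * f (p + 1)) * rangeProd m fun i => f (p + 2 + i) := by
  rw [rangeProd_add, rangeProd_succ, rangeProd_succ, mul_assoc (rangeProd p f)]

theorem rangeProd_succ' (m : ℕ) (f : ℕ → B) :
    rangeProd (m + 1) f = f 0 * rangeProd m fun i => f (i + 1) := by
  rw [add_comm m, rangeProd_add]
  simp [rangeProd_succ, add_comm]

theorem commute_rangeProd {m : ℕ} {f : ℕ → B} {x : B} (h : ∀ k < m, Commute x (f k)) :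
    Commute x (rangeProd m f) := by
  refine Commute.list_prod_right _ _ fun y hy => ?_
  obtain ⟨k, hk, rfl⟩ := List.mem_map.1 hy
  exact h k (List.mem_range.1 hk)

theorem map_rangeProd {C F : Type*} [Monoid C] [FunLike F B C] [MonoidHomClass F B C] (φ : F)
    (m : ℕ) (f : ℕ → B) : φ (rangeProd m f) = rangeProd m fun k => φ (f k) := by
  simp [rangeProd, map_list_prod, Function.comp_def]

theorem ofFn_prod_eq_rangeProd {m : ℕ} (f : Fin m → B) (g : ℕ → B) (h : ∀ k : Fin m, g k = f k) :
    (List.ofFn f).prod = rangeProd m g := by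
  unfold rangeProd
  congr 1
  refine List.ext_getElem (by simp) fun k hk _ => ?_
  simp only [List.length_ofFn] at hk
  simp only [List.getElem_ofFn, List.getElem_map, List.getElem_range]
  exact (h ⟨k, hk⟩).symm

end Monoid

/-- The crystal relations between the entries `Z i j` with `i, j ≤ n` of an infinite array; the
entries with larger indices are arbitrary. Using natural numbers as indices makes the passage between
different `n` free of coercions. In `star_eq` both formulas for the adjoint, below and above the
diagonal, are the ordered product of the entries whose row and column indices enumerate the
complements of `r` and `s`. -/
structure IsCrystalArray {B : Type*} [Ring B] [StarRing B] (n : ℕ) (Z : ℕ → ℕ → B) : Prop where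
  row : ∀ i j l, i ≤ n → l ≤ n → j < l → Z i j * Z i l = 0
  col : ∀ i k j, k ≤ n → j ≤ n → i < k → Z i j * Z k j = 0
  anti_comm : ∀ i k j l, k ≤ n → l ≤ n → i < k → j < l → Z i l * Z k j = Z k j * Z i l
  anti_zero : ∀ i k j l, k ≤ n → l ≤ n → i < k → j < l → min k l ≤ max i j → Z i l * Z k j = 0
  diag_adjacent : ∀ i k j l, k ≤ n → l ≤ n → i < k → j < l → max i j + 1 = min k l →
    Z i j * Z k l - Z k l * Z i j = Z i l * Z k j
  diag_far : ∀ i k j l, k ≤ n → l ≤ n → i < k → j < l → max i j + 1 < min k l →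
    Z i j * Z k l = Z k l * Z i j
  det_one : rangeProd (n + 1) (fun i => Z i i) = 1
  star_eq : ∀ r s, r ≤ n → s ≤ n → star (Z r s) = rangeProd n fun k => Z (skip r k) (skip s k)

variable {B : Type*} [Ring B] [StarRing B] {n : ℕ}

theorem val_succAbove_eq_skip (r : Fin (n + 1)) (k : Fin n) :
    ((r.succAbove k : Fin (n + 1)) : ℕ) = skip r k := by
  simp only [Fin.succAbove, Fin.lt_def, Fin.val_castSucc, skip]
  split_ifs <;> rfl

theorem isCrystalArray_iff {z : Fin (n + 1) → Fin (n + 1) → B} {Z : ℕ → ℕ → B}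
    (h : ∀ i j : Fin (n + 1), Z i j = z i j) : IsCrystalArray n Z ↔ IsCrystalFamily z := by
  have hdet : (List.ofFn fun i => z i i).prod = rangeProd (n + 1) fun i => Z i i :=
    ofFn_prod_eq_rangeProd _ _ fun k => h k k
  have hstar : ∀ r s : Fin (n + 1),
      (List.ofFn fun k : Fin n => z (r.succAbove k) (s.succAbove k)).prod
        = rangeProd n fun k => Z (skip r k) (skip s k) := fun r s =>
    ofFn_prod_eq_rangeProd _ _ fun k => by
      rw [← val_succAbove_eq_skip, ← val_succAbove_eq_skip, h]
  have hmin : ∀ a b : Fin (n + 1), ((min a b : Fin (n + 1)) : ℕ) = min (a : ℕ) b :=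
    fun a b => Fin.val_strictMono.monotone.map_min
  have hmax : ∀ a b : Fin (n + 1), ((max a b : Fin (n + 1)) : ℕ) = max (a : ℕ) b :=
    fun a b => Fin.val_strictMono.monotone.map_max
  constructor
  · intro H
    refine ⟨fun i j l hjl => ?_, fun i k j hik => ?_, fun i k j l hik hjl => ?_,
      fun i k j l hik hjl hm => ?_, fun i k j l hik hjl hm => ?_, fun i k j l hik hjl hm => ?_,
      ?_, fun r s => ?_⟩
    · simpa only [h] using H.row i j l (by omega) (by omega) hjl
    · simpa only [h] using H.col i k j (by omega) (by omega) hik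
    · simpa only [h] using H.anti_comm i k j l (by omega) (by omega) hik hjl
    · rw [hmin, hmax] at hm
      simpa only [h] using H.anti_zero i k j l (by omega) (by omega) hik hjl hm
    · rw [hmin, hmax] at hm
      simpa only [h] using H.diag_adjacent i k j l (by omega) (by omega) hik hjl hm
    · rw [hmin, hmax] at hm
      simpa only [h] using H.diag_far i k j l (by omega) (by omega) hik hjl hm
    · rw [hdet, H.det_one]
    · rw [hstar, ← H.star_eq r s (by omega) (by omega), h]
  · intro H
    have e : ∀ {i j : ℕ} (hi : i < n + 1) (hj : j < n + 1), Z i j = z ⟨i, hi⟩ ⟨j, hj⟩ :=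
      fun hi hj => h ⟨_, hi⟩ ⟨_, hj⟩
    refine ⟨fun i j l hi hl hjl => ?_, fun i k j hk hj hik => ?_, fun i k j l hk hl hik hjl => ?_,
      fun i k j l hk hl hik hjl hm => ?_, fun i k j l hk hl hik hjl hm => ?_,
      fun i k j l hk hl hik hjl hm => ?_, ?_, fun r s hr hs => ?_⟩
    · rw [e (by omega : i < n + 1) (by omega : j < n + 1), e (by omega) (by omega : l < n + 1)]
      exact H.row _ _ _ hjl
    · rw [e (by omega : i < n + 1) (by omega : j < n + 1), e (by omega : k < n + 1) (by omega)]
      exact H.col _ _ _ hik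
    · rw [e (by omega : i < n + 1) (by omega : l < n + 1),
        e (by omega : k < n + 1) (by omega : j < n + 1)]
      exact H.anti_comm _ _ _ _ hik hjl
    · rw [e (by omega : i < n + 1) (by omega : l < n + 1),
        e (by omega : k < n + 1) (by omega : j < n + 1)]
      exact H.anti_zero _ _ _ _ hik hjl (by rw [hmin, hmax]; exact hm)
    · rw [e (by omega : i < n + 1) (by omega : l < n + 1),
        e (by omega : k < n + 1) (by omega : j < n + 1),
        e (by omega : i < n + 1) (by omega : j < n + 1),
        e (by omega : k < n + 1) (by omega : l < n + 1)]
      exact H.diag_adjacent _ _ _ _ hik hjl (by rw [hmin, hmax]; exact hm)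
    · rw [e (by omega : i < n + 1) (by omega : j < n + 1),
        e (by omega : k < n + 1) (by omega : l < n + 1)]
      exact H.diag_far _ _ _ _ hik hjl (by rw [hmin, hmax]; exact hm)
    · rw [← hdet, H.det_one]
    · have := H.star_eq ⟨r, by omega⟩ ⟨s, by omega⟩
      rw [hstar] at this
      rw [← this, ← h]

theorem IsCrystalArray.congr {Z Z' : ℕ → ℕ → B} (hZ : IsCrystalArray n Z)
    (h : ∀ i j, i ≤ n → j ≤ n → Z' i j = Z i j) : IsCrystalArray n Z' := by
  let z : Fin (n + 1) → Fin (n + 1) → B := fun i j => Z i j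
  have h1 : IsCrystalFamily z := (isCrystalArray_iff fun _ _ => rfl).1 hZ
  exact (isCrystalArray_iff fun i j => h i j (by omega) (by omega)).2 h1

theorem IsCrystalArray.map {C : Type*} [Ring C] [StarRing C] (φ : B →+* C)
    (hφ : ∀ x, φ (star x) = star (φ x)) {Z : ℕ → ℕ → B} (hZ : IsCrystalArray n Z) :
    IsCrystalArray n fun i j => φ (Z i j) where
  row i j l h1 h2 h3 := by rw [← map_mul, hZ.row i j l h1 h2 h3, map_zero]
  col i k j h1 h2 h3 := by rw [← map_mul, hZ.col i k j h1 h2 h3, map_zero]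
  anti_comm i k j l h1 h2 h3 h4 := by rw [← map_mul, hZ.anti_comm i k j l h1 h2 h3 h4, map_mul]
  anti_zero i k j l h1 h2 h3 h4 h5 := by
    rw [← map_mul, hZ.anti_zero i k j l h1 h2 h3 h4 h5, map_zero]
  diag_adjacent i k j l h1 h2 h3 h4 h5 := by
    rw [← map_mul, ← map_mul, ← map_sub, hZ.diag_adjacent i k j l h1 h2 h3 h4 h5, map_mul]
  diag_far i k j l h1 h2 h3 h4 h5 := by
    rw [← map_mul, hZ.diag_far i k j l h1 h2 h3 h4 h5, map_mul]
  det_one := by rw [← map_rangeProd, hZ.det_one, map_one]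
  star_eq r s h1 h2 := by rw [← hφ, hZ.star_eq r s h1 h2, map_rangeProd]

/-- For `i ≤ j` all factors lie on or below the diagonal (`skip_le_skip`), so that the lower triangle
determines the array. -/
theorem IsCrystalArray.eq_star_rangeProd {Z : ℕ → ℕ → B} (hZ : IsCrystalArray n Z) {i j : ℕ}
    (hi : i ≤ n) (hj : j ≤ n) : Z i j = star (rangeProd n fun k => Z (skip i k) (skip j k)) := by
  rw [← hZ.star_eq i j hi hj, star_star]

theorem skip_le_skip {i j : ℕ} (h : i ≤ j) (k : ℕ) : skip j k ≤ skip i k := by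
  unfold skip; split_ifs <;> omega

theorem skip_le {n k : ℕ} (i : ℕ) (h : k < n) : skip i k ≤ n := by
  unfold skip; split_ifs <;> omega

/-- An array whose last diagonal entry is the identity restricts to the smaller size. -/
theorem IsCrystalArray.restrict {Z : ℕ → ℕ → B} (hZ : IsCrystalArray (n + 1) Z)
    (h1 : Z (n + 1) (n + 1) = 1) : IsCrystalArray n Z where
  row i j l h1 h2 h3 := hZ.row i j l (by omega) (by omega) h3
  col i k j h1 h2 h3 := hZ.col i k j (by omega) (by omega) h3
  anti_comm i k j l h1 h2 h3 h4 := hZ.anti_comm i k j l (by omega) (by omega) h3 h4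
  anti_zero i k j l h1 h2 h3 h4 h5 := hZ.anti_zero i k j l (by omega) (by omega) h3 h4 h5
  diag_adjacent i k j l h1 h2 h3 h4 h5 := hZ.diag_adjacent i k j l (by omega) (by omega) h3 h4 h5
  diag_far i k j l h1 h2 h3 h4 h5 := hZ.diag_far i k j l (by omega) (by omega) h3 h4 h5
  det_one := by
    have := hZ.det_one
    rwa [rangeProd_succ, h1, mul_one] at this
  star_eq r s hr hs := by
    rw [hZ.star_eq r s (by omega) (by omega), rangeProd_succ]
    have e : ∀ r ≤ n, skip r n = n + 1 := fun r hr => by unfold skip; rw [if_neg (by omega)]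
    rw [e r hr, e s hs, h1, mul_one]

end Arrays

/-! ### Convolution with an elementary representation, algebraically -/

section Shift

variable {B : Type*} [Ring B] [StarRing B]

/-- The array obtained from `y` by the row operation that convolution with the elementary
representation `π_{s_r}` induces; the isometry `T` plays the role of the forward shift. -/
def shiftArray (T : B) (r : ℕ) (y : ℕ → ℕ → B) (i j : ℕ) : B :=
  if i = r then star T * y r j + (1 - T * star T) * (if r < j then y (r + 1) j else 0)
  else if i = r + 1 then T * y (r + 1) j + (1 - T * star T) * (if j ≤ r then y r j else 0)
  else y i j

theorem shiftArray_left (T : B) (r : ℕ) (y : ℕ → ℕ → B) (j : ℕ) : shiftArray T r y r j =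
    star T * y r j + (1 - T * star T) * (if r < j then y (r + 1) j else 0) := if_pos rfl

theorem shiftArray_right (T : B) (r : ℕ) (y : ℕ → ℕ → B) (j : ℕ) : shiftArray T r y (r + 1) j =
    T * y (r + 1) j + (1 - T * star T) * (if j ≤ r then y r j else 0) := by
  rw [shiftArray, if_neg (by omega), if_pos rfl]

theorem shiftArray_other (T : B) {r i : ℕ} (y : ℕ → ℕ → B) (h1 : i ≠ r) (h2 : i ≠ r + 1) (j : ℕ) :
    shiftArray T r y i j = y i j := by
  rw [shiftArray, if_neg h1, if_neg h2]

/-- The crystal relations are stable under the row operation of an elementary representation. Only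
the rows `r` and `r + 1` change, and each relation reduces to relations of `y` and to the relations
`T* T = 1`, `T* P = 0 = P T` of the isometry `T` and `P = 1 - T T*`. -/
theorem IsCrystalArray.shiftArray {n r : ℕ} (hr : r < n) {T : B} (hT : star T * T = 1)
    {y : ℕ → ℕ → B} (hy : IsCrystalArray n y) (hc : ∀ i j, Commute (y i j) T)
    (hc' : ∀ i j, Commute (y i j) (star T)) : IsCrystalArray n (shiftArray T r y) := by
  obtain ⟨P, hP⟩ : ∃ P, P = 1 - T * star T := ⟨_, rfl⟩
  have hSP : star T * P = 0 := by rw [hP, mul_sub, ← mul_assoc, hT]; simp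
  have hPT : P * T = 0 := by rw [hP, sub_mul, mul_assoc, hT]; simp
  have hPP : P * P = P := by
    have : P * P = (1 - T * star T) * P := by rw [← hP]
    rw [this, sub_mul, mul_assoc, hSP]
    simp
  have hTS : T * star T = 1 - P := by rw [hP]; abel
  have hPs : star P = P := by rw [hP]; simp
  have hcP : ∀ i j, Commute (y i j) P := fun i j => by
    rw [hP]; exact (Commute.one_right _).sub_right ((hc i j).mul_right (hc' i j))
  -- the coefficients of `P` in the rows `r` and `r + 1`
  obtain ⟨u, hu⟩ : ∃ u : ℕ → B, ∀ j, u j = if r < j then y (r + 1) j else 0 := ⟨_, fun _ => rfl⟩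
  obtain ⟨v, hv⟩ : ∃ v : ℕ → B, ∀ j, v j = if j ≤ r then y r j else 0 := ⟨_, fun _ => rfl⟩
  have u1 : ∀ j, r < j → u j = y (r + 1) j := fun j h => by rw [hu, if_pos h]
  have u0 : ∀ j, j ≤ r → u j = 0 := fun j h => by rw [hu, if_neg (by omega)]
  have v1 : ∀ j, j ≤ r → v j = y r j := fun j h => by rw [hv, if_pos h]
  have v0 : ∀ j, r < j → v j = 0 := fun j h => by rw [hv, if_neg (by omega)]
  have zl : ∀ j, CrystalSU.shiftArray T r y r j = star T * y r j + P * u j := fun j => by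
    rw [shiftArray_left, hP, hu]
  have zr : ∀ j, CrystalSU.shiftArray T r y (r + 1) j = T * y (r + 1) j + P * v j := fun j => by
    rw [shiftArray_right, hP, hv]
  have zo : ∀ i j, i ≠ r → i ≠ r + 1 → CrystalSU.shiftArray T r y i j = y i j := fun i j h1 h2 =>
    shiftArray_other T y h1 h2 j
  -- products with an entry that commutes with the coefficients
  have ml : ∀ (C : B) (i j : ℕ) (b c : B), Commute (y i j) C →
      y i j * (C * b + P * c) = C * (y i j * b) + P * (y i j * c) := fun C i j b c h => by
    rw [mul_add, ← mul_assoc, ← mul_assoc, h.eq, (hcP i j).eq, mul_assoc, mul_assoc]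
  have mr : ∀ (C a b c : B), (C * b + P * c) * a = C * (b * a) + P * (c * a) := fun C a b c => by
    rw [add_mul, mul_assoc, mul_assoc]
  -- products of the two special rows
  have hcu : ∀ (j : ℕ), Commute (u j) T ∧ Commute (u j) (star T) ∧ Commute (u j) P := fun j => by
    rw [hu]; split_ifs
    · exact ⟨hc _ _, hc' _ _, hcP _ _⟩
    · exact ⟨Commute.zero_left _, Commute.zero_left _, Commute.zero_left _⟩
  have hcv : ∀ (j : ℕ), Commute (v j) T ∧ Commute (v j) (star T) ∧ Commute (v j) P := fun j => by
    rw [hv]; split_ifs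
    · exact ⟨hc _ _, hc' _ _, hcP _ _⟩
    · exact ⟨Commute.zero_left _, Commute.zero_left _, Commute.zero_left _⟩
  have pp : ∀ (C D a b c d : B), Commute b D → Commute b P → Commute a D → Commute a P →
      (C * a + P * b) * (D * c + P * d)
        = C * D * (a * c) + C * P * (a * d) + (P * D * (b * c) + P * P * (b * d)) := by
    intro C D a b c d h1 h2 h3 h4
    have e : ∀ X Y a c : B, Commute a Y → X * a * (Y * c) = X * Y * (a * c) :=
      fun X Y a c h => by
        rw [mul_assoc, ← mul_assoc a, h.eq]; simp only [mul_assoc]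
    rw [mul_add, add_mul, add_mul, e _ _ _ _ h3, e _ _ _ _ h4, e _ _ _ _ h1, e _ _ _ _ h2]
    abel
  have zlr : ∀ j l, CrystalSU.shiftArray T r y r j * CrystalSU.shiftArray T r y (r + 1) l
      = y r j * y (r + 1) l + P * (u j * v l) := fun j l => by
    rw [zl, zr, pp _ _ _ _ _ _ (hcu j).1 (hcu j).2.2 (hc _ _) (hcP _ _), hT, hSP, hPT, hPP]
    simp
  have zrl : ∀ j l, CrystalSU.shiftArray T r y (r + 1) l * CrystalSU.shiftArray T r y r j
      = (1 - P) * (y (r + 1) l * y r j) + T * P * (y (r + 1) l * u j)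
        + (P * star T * (v l * y r j) + P * (v l * u j)) := fun j l => by
    rw [zl, zr, pp _ _ _ _ _ _ (hcv l).2.1 (hcv l).2.2 (hc' _ _) (hcP _ _), hTS, hPP]
  have hcase : ∀ i, i = r ∨ i = r + 1 ∨ (i ≠ r ∧ i ≠ r + 1) := fun i => by omega
  -- the cross terms vanish
  have x1 : ∀ j l, j < l → l ≤ n → u j * y r l = 0 := fun j l h hl => by
    rcases Nat.lt_or_ge r j with h' | h'
    · rw [u1 j h', ← hy.anti_comm r (r + 1) j l (by omega) hl (by omega) h]
      exact hy.anti_zero r (r + 1) j l (by omega) hl (by omega) h (by omega)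
    · rw [u0 j h', zero_mul]
  have x2 : ∀ j l, j < l → l ≤ n → y (r + 1) j * v l = 0 := fun j l h hl => by
    rcases Nat.lt_or_ge r l with h' | h'
    · rw [v0 l h', mul_zero]
    · rw [v1 l h', ← hy.anti_comm r (r + 1) j l (by omega) hl (by omega) h]
      exact hy.anti_zero r (r + 1) j l (by omega) hl (by omega) h (by omega)
  -- the relations in the order of the fields; in each, a row is one of the two special rows or not
  refine ⟨?_, ?_, ?_, ?_, ?_, ?_, ?_, ?_⟩
  · intro i j l hi hl hjl
    have hrow := fun i hi => hy.row i j l hi hl hjl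
    rcases hcase i with rfl | rfl | ⟨h1, h2⟩
    · rw [zl, zl, pp _ _ _ _ _ _ (hcu j).2.1 (hcu j).2.2 (hc' _ _) (hcP _ _), hSP, hPP,
        hrow _ hi, x1 j l hjl hl]
      have : u j * u l = 0 := by
        rcases Nat.lt_or_ge i j with h' | h'
        · rw [u1 j h', u1 l (by omega), hrow _ (by omega)]
        · rw [u0 j h', zero_mul]
      simp [this]
    · rw [zr, zr, pp _ _ _ _ _ _ (hcv j).1 (hcv j).2.2 (hc _ _) (hcP _ _), hPT, hPP,
        hrow _ hi, x2 j l hjl hl]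
      have : v j * v l = 0 := by
        rcases Nat.lt_or_ge r l with h' | h'
        · rw [v0 l h', mul_zero]
        · rw [v1 j (by omega), v1 l h', hrow _ (by omega)]
      simp [this]
    · rw [zo i j h1 h2, zo i l h1 h2, hrow i hi]
  · intro i k j hk hj hik
    have hcol := fun i k hk hik => hy.col i k j hk hj hik
    have huv : u j * v j = 0 := by
      rcases Nat.lt_or_ge r j with h' | h'
      · rw [v0 j h', mul_zero]
      · rw [u0 j h', zero_mul]
    rcases hcase i with rfl | rfl | ⟨h1, h2⟩
    · rcases hcase k with rfl | rfl | ⟨h3, h4⟩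
      · omega
      · rw [zlr, hcol _ _ hk hik, huv]; simp
      · rw [zl, zo k j h3 h4, mr, hcol _ _ hk hik]
        have : u j * y k j = 0 := by
          rw [hu]; split_ifs
          · exact hcol _ _ hk (by omega)
          · rw [zero_mul]
        simp [this]
    · rw [zr, zo k j (by omega) (by omega), mr, hcol _ _ hk hik]
      have : v j * y k j = 0 := by
        rw [hv]; split_ifs
        · exact hcol _ _ hk (by omega)
        · rw [zero_mul]
      simp [this]
    · rw [zo i j h1 h2]
      rcases hcase k with rfl | rfl | ⟨h3, h4⟩
      · rw [zl, ml _ _ _ _ _ (hc' _ _), hcol _ _ hk hik]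
        have : y i j * u j = 0 := by
          rw [hu]; split_ifs
          · exact hcol _ _ (by omega) (by omega)
          · rw [mul_zero]
        simp [this]
      · rw [zr, ml _ _ _ _ _ (hc _ _), hcol _ _ hk hik]
        have : y i j * v j = 0 := by
          rw [hv]; split_ifs
          · exact hcol _ _ (by omega) (by omega)
          · rw [mul_zero]
        simp [this]
      · rw [zo k j h3 h4, hcol _ _ hk hik]
  · intro i k j l hk hl hik hjl
    have ha := fun i k hk hik => hy.anti_comm i k j l hk hl hik hjl
    rcases hcase i with rfl | rfl | ⟨h1, h2⟩
    · rcases hcase k with rfl | rfl | ⟨h3, h4⟩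
      · omega
      · rw [zlr, zrl, ha _ _ hk hik]
        have e1 : y (i + 1) j * u l = 0 := by
          rw [hu]; split_ifs
          · exact hy.row _ _ _ hk hl hjl
          · rw [mul_zero]
        have e2 : v j * y i l = 0 := by
          rw [hv]; split_ifs
          · exact hy.row _ _ _ (by omega) hl hjl
          · rw [zero_mul]
        have e3 : u l * v j = v j * u l - y (i + 1) j * y i l := by
          by_cases h : j ≤ i ∧ i < l
          · rw [u1 l h.2, v1 j h.1, ← ha _ _ hk hik, ← hy.diag_adjacent i (i + 1) j l hk hl hik hjl
              (by omega)]
            abel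
          · rw [← ha _ _ hk hik, hy.anti_zero i (i + 1) j l hk hl hik hjl (by omega)]
            rcases Nat.lt_or_ge i j with h' | h'
            · rw [v0 j h']; simp
            · rw [u0 l (by omega)]; simp
        rw [e1, e2, e3]
        noncomm_ring
      · rw [zl, zo k j h3 h4, mr, ml _ _ _ _ _ (hc' _ _), ha _ _ hk hik]
        have : u l * y k j = y k j * u l := by
          rw [hu]; split_ifs
          · exact ha _ _ hk (by omega)
          · rw [zero_mul, mul_zero]
        rw [this]
    · rw [zr, zo k j (by omega) (by omega), mr, ml _ _ _ _ _ (hc _ _), ha _ _ hk hik]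
      have : v l * y k j = y k j * v l := by
        rw [hv]; split_ifs
        · exact ha _ _ hk (by omega)
        · rw [zero_mul, mul_zero]
      rw [this]
    · rw [zo i l h1 h2]
      rcases hcase k with rfl | rfl | ⟨h3, h4⟩
      · rw [zl, ml _ _ _ _ _ (hc' _ _), mr, ha _ _ hk hik]
        have : y i l * u j = u j * y i l := by
          rw [hu]; split_ifs
          · exact ha _ _ (by omega) (by omega)
          · rw [zero_mul, mul_zero]
        rw [this]
      · rw [zr, ml _ _ _ _ _ (hc _ _), mr, ha _ _ hk hik]
        have : y i l * v j = v j * y i l := by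
          rw [hv]; split_ifs
          · exact ha _ _ (by omega) (by omega)
          · rw [zero_mul, mul_zero]
        rw [this]
      · rw [zo k j h3 h4, ha _ _ hk hik]
  · intro i k j l hk hl hik hjl hm
    rcases hcase i with rfl | rfl | ⟨h1, h2⟩
    · rcases hcase k with rfl | rfl | ⟨h3, h4⟩
      · omega
      · rw [zlr, hy.anti_zero _ _ j l hk hl hik hjl hm]
        have : u l * v j = 0 := by
          rcases Nat.lt_or_ge i j with h' | h'
          · rw [v0 j h', mul_zero]
          · rw [u0 l (by omega), zero_mul]
        simp [this]
      · rw [zl, zo k j h3 h4, mr, hy.anti_zero _ _ j l hk hl hik hjl hm]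
        have : u l * y k j = 0 := by
          rw [hu]; split_ifs
          · exact hy.anti_zero _ _ j l hk hl (by omega) hjl (by omega)
          · rw [zero_mul]
        simp [this]
    · rw [zr, zo k j (by omega) (by omega), mr, hy.anti_zero _ _ j l hk hl hik hjl hm]
      have : v l * y k j = 0 := by
        rw [hv]; split_ifs
        · exact hy.anti_zero _ _ j l hk hl (by omega) hjl (by omega)
        · rw [zero_mul]
      simp [this]
    · rw [zo i l h1 h2]
      rcases hcase k with rfl | rfl | ⟨h3, h4⟩
      · rw [zl, ml _ _ _ _ _ (hc' _ _), hy.anti_zero _ _ j l hk hl hik hjl hm]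
        have : y i l * u j = 0 := by
          rw [hu]; split_ifs
          · exact hy.anti_zero _ _ j l (by omega) hl (by omega) hjl (by omega)
          · rw [mul_zero]
        simp [this]
      · rw [zr, ml _ _ _ _ _ (hc _ _), hy.anti_zero _ _ j l hk hl hik hjl hm]
        have : y i l * v j = 0 := by
          rw [hv]; split_ifs
          · exact hy.anti_zero _ _ j l (by omega) hl (by omega) hjl (by omega)
          · rw [mul_zero]
        simp [this]
      · rw [zo k j h3 h4, hy.anti_zero _ _ j l hk hl hik hjl hm]
  · intro i k j l hk hl hik hjl hm
    have comb : ∀ (C a a' b c c' d : B), a - a' = b → c - c' = d →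
        C * a + P * c - (C * a' + P * c') = C * b + P * d := by
      rintro C a a' b c c' d rfl rfl
      noncomm_ring
    rcases hcase i with rfl | rfl | ⟨h1, h2⟩
    · rcases hcase k with rfl | rfl | ⟨h3, h4⟩
      · omega
      · rw [zlr, zlr, zrl, u0 j (by omega), v0 l (by omega), u1 l (by omega), v1 j (by omega),
          ← hy.diag_adjacent i (i + 1) j l hk hl hik hjl hm]
        noncomm_ring
      · rw [zl, zl, zo k j h3 h4, zo k l h3 h4, mr, mr, ml _ _ _ _ _ (hc' _ _)]
        refine comb _ _ _ _ _ _ _ (hy.diag_adjacent _ _ j l hk hl hik hjl hm) ?_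
        rw [u1 l (by omega)]
        rcases Nat.lt_or_ge i j with h' | h'
        · rw [u1 j h']
          exact hy.diag_adjacent _ _ j l hk hl (by omega) hjl (by omega)
        · rw [u0 j h', hy.anti_zero (i + 1) k j l hk hl (by omega) hjl (by omega)]
          simp
    · rw [zr, zr, zo k j (by omega) (by omega), zo k l (by omega) (by omega), mr, mr,
        ml _ _ _ _ _ (hc _ _)]
      refine comb _ _ _ _ _ _ _ (hy.diag_adjacent _ _ j l hk hl hik hjl hm) ?_
      rw [v0 l (by omega)]
      rcases Nat.lt_or_ge r j with h' | h'
      · rw [v0 j h']; simp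
      · rw [v1 j h', hy.diag_far r k j l hk hl (by omega) hjl (by omega)]
        simp
    · rw [zo i j h1 h2, zo i l h1 h2]
      rcases hcase k with rfl | rfl | ⟨h3, h4⟩
      · rw [zl, zl, mr, ml _ _ _ _ _ (hc' _ _), ml _ _ _ _ _ (hc' _ _)]
        refine comb _ _ _ _ _ _ _ (hy.diag_adjacent _ _ j l hk hl hik hjl hm) ?_
        rw [u0 j (by omega)]
        rcases Nat.lt_or_ge k l with h' | h'
        · rw [u1 l h', hy.diag_far i (k + 1) j l (by omega) hl (by omega) hjl (by omega)]
          simp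
        · rw [u0 l h']; simp
      · rw [zr, zr, mr, ml _ _ _ _ _ (hc _ _), ml _ _ _ _ _ (hc _ _)]
        refine comb _ _ _ _ _ _ _ (hy.diag_adjacent _ _ j l hk hl hik hjl hm) ?_
        rw [v1 j (by omega)]
        rcases Nat.lt_or_ge r l with h' | h'
        · rw [v0 l h', hy.anti_zero i r j l (by omega) hl (by omega) hjl (by omega)]
          simp
        · rw [v1 l h']
          exact hy.diag_adjacent _ _ j l (by omega) hl (by omega) hjl (by omega)
      · rw [zo k j h3 h4, zo k l h3 h4]
        exact hy.diag_adjacent _ _ j l hk hl hik hjl hm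
  · intro i k j l hk hl hik hjl hm
    rcases hcase i with rfl | rfl | ⟨h1, h2⟩
    · have h3 : k ≠ i + 1 := by omega
      rw [zl, zo k l (by omega) h3, mr, ml _ _ _ _ _ (hc' _ _),
        hy.diag_far _ _ j l hk hl hik hjl hm]
      have : u j * y k l = y k l * u j := by
        rw [hu]; split_ifs
        · exact hy.diag_far _ _ j l hk hl (by omega) hjl (by omega)
        · rw [zero_mul, mul_zero]
      rw [this]
    · rw [zr, zo k l (by omega) (by omega), mr, ml _ _ _ _ _ (hc _ _),
        hy.diag_far _ _ j l hk hl hik hjl hm]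
      have : v j * y k l = y k l * v j := by
        rw [hv]; split_ifs
        · exact hy.diag_far _ _ j l hk hl (by omega) hjl (by omega)
        · rw [zero_mul, mul_zero]
      rw [this]
    · rw [zo i j h1 h2]
      rcases hcase k with rfl | rfl | ⟨h3, h4⟩
      · rw [zl, mr, ml _ _ _ _ _ (hc' _ _), hy.diag_far _ _ j l hk hl hik hjl hm]
        have : y i j * u l = u l * y i j := by
          rw [hu]; split_ifs
          · exact hy.diag_far _ _ j l (by omega) hl (by omega) hjl (by omega)
          · rw [zero_mul, mul_zero]
        rw [this]
      · rw [zr, mr, ml _ _ _ _ _ (hc _ _), hy.diag_far _ _ j l hk hl hik hjl hm]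
        have : y i j * v l = v l * y i j := by
          rw [hv]; split_ifs
          · exact hy.diag_far _ _ j l (by omega) hl (by omega) hjl (by omega)
          · rw [zero_mul, mul_zero]
        rw [this]
      · rw [zo k l h3 h4, hy.diag_far _ _ j l hk hl hik hjl hm]
  · obtain ⟨m, rfl⟩ : ∃ m, n = r + 1 + m := ⟨n - r - 1, by omega⟩
    have e : r + 1 + m + 1 = r + 2 + m := by omega
    rw [← hy.det_one, e, rangeProd_split_two, rangeProd_split_two, zlr, u0 r le_rfl, zero_mul,
      mul_zero, add_zero]
    congr 1
    · congr 1
      exact rangeProd_congr fun k hk => zo _ _ (by omega) (by omega)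
    · exact rangeProd_congr fun k hk => zo _ _ (by omega) (by omega)
  · intro r₀ s hr₀ hs
    have hcs : ∀ i j, Commute (star (y i j)) T ∧ Commute (star (y i j)) (star T)
        ∧ Commute (star (y i j)) P := fun i j => by
      refine ⟨?_, (hc i j).star_star, ?_⟩
      · simpa using (hc' i j).star_star
      · simpa [hPs] using (hcP i j).star_star
    by_cases h1 : r₀ = r ∨ r₀ = r + 1
    · -- exactly one of the rows `r` and `r + 1` occurs in the product, at position `r`
      have hsplit : ∀ (C a b : B) (Z : ℕ → ℕ → B), (∀ i j, i ≠ r → i ≠ r + 1 → Z i j = y i j) →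
          Z (skip r₀ r) (skip s r) = C * a + P * b → (∀ i j, Commute (y i j) C) →
          rangeProd n (fun k => Z (skip r₀ k) (skip s k))
            = C * (rangeProd r (fun k => y (skip r₀ k) (skip s k)) * a
                * rangeProd (n - r - 1) fun i => y (skip r₀ (r + 1 + i)) (skip s (r + 1 + i)))
              + P * (rangeProd r (fun k => y (skip r₀ k) (skip s k)) * b
                * rangeProd (n - r - 1) fun i => y (skip r₀ (r + 1 + i)) (skip s (r + 1 + i))) := by
        intro C a b Z hZ hZr hC
        rw [rangeProd_split hr, hZr]
        have e1 : rangeProd r (fun k => Z (skip r₀ k) (skip s k))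
            = rangeProd r fun k => y (skip r₀ k) (skip s k) :=
          rangeProd_congr fun k hk => hZ _ _ (by unfold skip; split_ifs <;> omega)
            (by unfold skip; split_ifs <;> omega)
        have e2 : rangeProd (n - r - 1) (fun i => Z (skip r₀ (r + 1 + i)) (skip s (r + 1 + i)))
            = rangeProd (n - r - 1) fun i => y (skip r₀ (r + 1 + i)) (skip s (r + 1 + i)) :=
          rangeProd_congr fun k hk => hZ _ _ (by unfold skip; split_ifs <;> omega)
            (by unfold skip; split_ifs <;> omega)
        have c1 : Commute (rangeProd r fun k => y (skip r₀ k) (skip s k)) C :=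
          (commute_rangeProd fun k _ => (hC _ _).symm).symm
        have c2 : Commute (rangeProd r fun k => y (skip r₀ k) (skip s k)) P :=
          (commute_rangeProd fun k _ => (hcP _ _).symm).symm
        rw [e1, e2, mul_add, ← mul_assoc, ← mul_assoc, c1.eq, c2.eq, add_mul]
        simp only [mul_assoc]
      have hsr : ∀ i, i = r ∨ i = r + 1 → ∀ k, k ≠ r → skip i k = skip r₀ k := by
        intro i hi k hk
        unfold skip; split_ifs <;> omega
      have hfull : ∀ i, i = r ∨ i = r + 1 → star (y i s) =
          rangeProd r (fun k => y (skip r₀ k) (skip s k)) * y (skip i r) (skip s r)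
            * rangeProd (n - r - 1) fun i => y (skip r₀ (r + 1 + i)) (skip s (r + 1 + i)) := by
        intro i hi
        rw [hy.star_eq i s (by omega) hs, rangeProd_split hr]
        congr 1
        · congr 1
          exact rangeProd_congr fun k hk => by rw [hsr i hi k (by omega)]
        · exact rangeProd_congr fun k hk => by rw [hsr i hi _ (by omega)]
      have hs1 : skip r r = r + 1 := by simp [skip]
      have hs2 : skip (r + 1) r = r := by simp [skip]
      rcases h1 with rfl | rfl
      · rw [hsplit T (y (r₀ + 1) (skip s r₀)) (v (skip s r₀)) _ zo (by rw [hs1, zr]) hc, zl,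
          star_add, star_mul, star_mul, star_star, hPs, (hcs _ _).1.eq]
        have := hfull r₀ (Or.inl rfl)
        rw [hs1] at this
        rw [← this]
        rcases Nat.lt_or_ge r₀ s with h | h
        · have h2 := hfull (r₀ + 1) (Or.inr rfl)
          have h3 : skip s r₀ = r₀ := by simp [skip, h]
          rw [hs2, h3] at h2
          rw [h3, v1 _ le_rfl, ← h2, u1 s h, (hcs _ _).2.2.eq]
        · have h3 : skip s r₀ = r₀ + 1 := by simp [skip, h]
          rw [h3, v0 _ (by omega), u0 s h]
          simp
      · rw [hsplit (star T) (y r (skip s r)) (u (skip s r)) _ zo (by rw [hs2, zl]) hc', zr,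
          star_add, star_mul, star_mul, hPs, (hcs _ _).2.1.eq]
        have := hfull (r + 1) (Or.inr rfl)
        rw [hs2] at this
        rw [← this]
        rcases Nat.lt_or_ge r s with h | h
        · have h3 : skip s r = r := by simp [skip, h]
          rw [h3, u0 _ le_rfl, v0 s h]
          simp
        · have h2 := hfull r (Or.inl rfl)
          have h3 : skip s r = r + 1 := by simp [skip, h]
          rw [hs1, h3] at h2
          rw [h3, u1 _ (by omega), ← h2, v1 s h, (hcs _ _).2.2.eq]
    · push Not at h1
      rw [zo _ _ h1.1 h1.2, hy.star_eq r₀ s hr₀ hs]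
      -- the rows `r` and `r + 1` occur at the adjacent positions `p` and `p + 1`
      obtain ⟨p, hp⟩ : ∃ p, p = if r < r₀ then r else r - 1 := ⟨_, rfl⟩
      obtain ⟨m, rfl⟩ : ∃ m, n = p + 2 + m := ⟨n - p - 2, by split_ifs at hp <;> omega⟩
      have e1 : skip r₀ p = r := by unfold skip; split_ifs at hp ⊢ <;> omega
      have e2 : skip r₀ (p + 1) = r + 1 := by unfold skip; split_ifs at hp ⊢ <;> omega
      rw [rangeProd_split_two, rangeProd_split_two, e1, e2, zlr]
      have : u (skip s p) * v (skip s (p + 1)) = 0 := by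
        rcases Nat.lt_or_ge r (skip s (p + 1)) with h' | h'
        · rw [v0 _ h', mul_zero]
        · rw [u0 _ (by unfold skip at h' ⊢; split_ifs at h' ⊢ <;> omega), zero_mul]
      rw [this, mul_zero, add_zero]
      congr 1
      · congr 1
        exact rangeProd_congr fun k hk => (zo _ _ (by unfold skip; split_ifs at hp ⊢ <;> omega)
          (by unfold skip; split_ifs at hp ⊢ <;> omega)).symm
      · exact rangeProd_congr fun k hk => (zo _ _ (by unfold skip; split_ifs at hp ⊢ <;> omega)
          (by unfold skip; split_ifs at hp ⊢ <;> omega)).symm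

end Shift

/-! ### Unitaries from Gram matrices -/

section Gram

variable {H K : Type*} [NormedAddCommGroup H] [InnerProductSpace ℂ H]
  [NormedAddCommGroup K] [InnerProductSpace ℂ K]

/-- The closed linear span of the family `f` is the whole space. -/
def IsTotal {ι : Sort*} (f : ι → H) : Prop :=
  ∀ V : Submodule ℂ H, IsClosed (V : Set H) → (∀ i, f i ∈ V) → V = ⊤

theorem IsTotal.denseRange {ι : Type*} {f : ι → H} (hf : IsTotal f) :
    DenseRange (Finsupp.linearCombination ℂ f) := by
  have h := hf (LinearMap.range (Finsupp.linearCombination ℂ f)).topologicalClosure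
    (Submodule.isClosed_topologicalClosure _) fun i =>
      Submodule.le_topologicalClosure _ ⟨Finsupp.single i 1, by simp⟩
  have h' := (Submodule.dense_iff_topologicalClosure_eq_top).2 h
  rwa [DenseRange, ← LinearMap.coe_range]

theorem IsTotal.ext {ι : Sort*} {f : ι → H} (hf : IsTotal f) {A B : H →L[ℂ] K}
    (h : ∀ i, A (f i) = B (f i)) : A = B := by
  have h1 : LinearMap.eqLocus A.toLinearMap B.toLinearMap = ⊤ :=
    hf _ (isClosed_eq A.continuous B.continuous) h
  ext x
  have : x ∈ LinearMap.eqLocus A.toLinearMap B.toLinearMap := by rw [h1]; trivial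
  exact this

/-- Two total families with the same Gram matrix are related by a unitary operator. -/
theorem exists_unitary_of_inner_eq [CompleteSpace H] [CompleteSpace K] {ι : Type*} {f : ι → H}
    {g : ι → K} (hf : IsTotal f) (hg : IsTotal g)
    (h : ∀ i j, inner ℂ (f i) (f j) = inner ℂ (g i) (g j)) :
    ∃ U : H ≃ₗᵢ[ℂ] K, ∀ i, U (f i) = g i := by
  have key : ∀ x : ι →₀ ℂ, ‖Finsupp.linearCombination ℂ g x‖
      = ‖Finsupp.linearCombination ℂ f x‖ := by
    intro x
    have e : inner ℂ (Finsupp.linearCombination ℂ g x) (Finsupp.linearCombination ℂ g x)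
        = inner ℂ (Finsupp.linearCombination ℂ f x) (Finsupp.linearCombination ℂ f x) := by
      simp only [Finsupp.linearCombination_apply, Finsupp.sum, sum_inner, inner_sum,
        inner_smul_left, inner_smul_right, h]
    have e' : ‖Finsupp.linearCombination ℂ g x‖ ^ 2 = ‖Finsupp.linearCombination ℂ f x‖ ^ 2 := by
      rw [@norm_sq_eq_re_inner ℂ, @norm_sq_eq_re_inner ℂ, e]
    exact (sq_eq_sq₀ (norm_nonneg _) (norm_nonneg _)).1 e'
  have h1 : ∃ C, ∀ x, ‖Finsupp.linearCombination ℂ g (LinearEquiv.refl ℂ (ι →₀ ℂ) x)‖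
      ≤ C * ‖Finsupp.linearCombination ℂ f x‖ := ⟨1, fun x => by simp [key]⟩
  have h2 : ∃ C, ∀ x, ‖Finsupp.linearCombination ℂ f ((LinearEquiv.refl ℂ (ι →₀ ℂ)).symm x)‖
      ≤ C * ‖Finsupp.linearCombination ℂ g x‖ := ⟨1, fun x => by simp [key]⟩
  let U := (LinearEquiv.refl ℂ (ι →₀ ℂ)).extend (Finsupp.linearCombination ℂ f)
    (Finsupp.linearCombination ℂ g) hf.denseRange h1 hg.denseRange h2
  have hU : ∀ x, U (Finsupp.linearCombination ℂ f x) = Finsupp.linearCombination ℂ g x :=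
    fun x => LinearEquiv.extend_eq _ _ _ _ _ _ _ x
  refine ⟨⟨U.toLinearEquiv, fun x => ?_⟩, fun i => ?_⟩
  · refine hf.denseRange.induction_on (p := fun x => ‖U x‖ = ‖x‖) x
      (isClosed_eq U.continuous.norm continuous_norm) fun y => ?_
    rw [hU, key]
  · have := hU (Finsupp.single i 1)
    simpa using this

end Gram

/-! ### Operators on Hilbert space tensor products -/

section TensorOp

open UniformSpace TensorProduct

variable {H K : Type*} [NormedAddCommGroup H] [InnerProductSpace ℂ H] [CompleteSpace H]
  [NormedAddCommGroup K] [InnerProductSpace ℂ K] [CompleteSpace K]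

theorem isTotal_tmul (H K : Type*) [NormedAddCommGroup H] [InnerProductSpace ℂ H]
    [NormedAddCommGroup K] [InnerProductSpace ℂ K] :
    IsTotal fun p : H × K => ((p.1 ⊗ₜ[ℂ] p.2 : H ⊗[ℂ] K) : HilbertTensor H K) := by
  intro V hV h
  have h1 : ∀ x : H ⊗[ℂ] K, (x : HilbertTensor H K) ∈ V := by
    intro x
    induction x with
    | zero => rw [Completion.coe_zero]; exact V.zero_mem
    | add x y hx hy => rw [Completion.coe_add]; exact V.add_mem hx hy
    | tmul a b => exact h (a, b)
  rw [eq_top_iff]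
  rintro x -
  exact Completion.induction_on (p := fun x => x ∈ V) x hV h1

theorem tensorOp_mul (A A' : H →L[ℂ] H) (B B' : K →L[ℂ] K) :
    tensorOp A B * tensorOp A' B' = tensorOp (A * A') (B * B') :=
  (isTotal_tmul H K).ext fun p => by
    simp only [mul_apply_eq_comp, tensorOp_tmul]

theorem tensorOp_one_one : tensorOp (1 : H →L[ℂ] H) (1 : K →L[ℂ] K) = 1 :=
  (isTotal_tmul H K).ext fun p => by simp [tensorOp_tmul]

theorem tensorOp_add (A : H →L[ℂ] H) (B B' : K →L[ℂ] K) :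
    tensorOp A (B + B') = tensorOp A B + tensorOp A B' :=
  (isTotal_tmul H K).ext fun p => by
    simp only [add_apply, tensorOp_tmul, TensorProduct.tmul_add, Completion.coe_add]

theorem tensorOp_zero (A : H →L[ℂ] H) : tensorOp A (0 : K →L[ℂ] K) = 0 :=
  (isTotal_tmul H K).ext fun p => by
    simp [tensorOp_tmul]

theorem tensorOp_star (A : H →L[ℂ] H) (B : K →L[ℂ] K) :
    star (tensorOp A B) = tensorOp (star A) (star B) := by
  symm
  rw [ContinuousLinearMap.star_eq_adjoint (tensorOp A B), ContinuousLinearMap.eq_adjoint_iff]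
  intro x y
  have h1 : ∀ q : H × K, ∀ x, inner ℂ (tensorOp (star A) (star B) x)
      ((q.1 ⊗ₜ[ℂ] q.2 : H ⊗[ℂ] K) : HilbertTensor H K)
      = inner ℂ x (tensorOp A B ((q.1 ⊗ₜ[ℂ] q.2 : H ⊗[ℂ] K) : HilbertTensor H K)) := by
    intro q x
    have := (isTotal_tmul H K).ext
      (A := (innerSL ℂ ((q.1 ⊗ₜ[ℂ] q.2 : H ⊗[ℂ] K) : HilbertTensor H K)).comp
        (tensorOp (star A) (star B)))
      (B := innerSL ℂ (tensorOp A B ((q.1 ⊗ₜ[ℂ] q.2 : H ⊗[ℂ] K) : HilbertTensor H K)))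
      fun p => by
        simp only [ContinuousLinearMap.comp_apply, innerSL_apply_apply, tensorOp_tmul,
          Completion.inner_coe, TensorProduct.inner_tmul, ContinuousLinearMap.star_eq_adjoint,
          ContinuousLinearMap.adjoint_inner_right]
    have h := congrArg (fun f => f x) this
    simp only [ContinuousLinearMap.comp_apply, innerSL_apply_apply] at h
    rw [← inner_conj_symm, h, inner_conj_symm]
  have := (isTotal_tmul H K).ext
      (A := innerSL ℂ (tensorOp (star A) (star B) x))
      (B := (innerSL ℂ x).comp (tensorOp A B)) fun p => by
        simp only [ContinuousLinearMap.comp_apply, innerSL_apply_apply]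
        exact h1 p x
  exact congrArg (fun f => f y) this

/-- The amplification `B ↦ 1 ⊗ B`. -/
def amplify (H : Type*) [NormedAddCommGroup H] [InnerProductSpace ℂ H] [CompleteSpace H]
    {K : Type*} [NormedAddCommGroup K] [InnerProductSpace ℂ K] [CompleteSpace K] :
    (K →L[ℂ] K) →+* (HilbertTensor H K →L[ℂ] HilbertTensor H K) where
  toFun B := tensorOp 1 B
  map_one' := tensorOp_one_one
  map_mul' B B' := by rw [tensorOp_mul, one_mul]
  map_zero' := tensorOp_zero _
  map_add' := tensorOp_add _

theorem amplify_apply (B : K →L[ℂ] K) : amplify H B = tensorOp 1 B := rfl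

end TensorOp

/-! ### The shift on `ℓ²(ℕ)` tensored with the identity -/

section FockVec

open UniformSpace TensorProduct

/-- The standard basis vector `e_m` of `ℓ²(ℕ)`. -/
def ket (m : ℕ) : EllTwo := lp.single 2 m (1 : ℂ)

theorem ket_apply (m k : ℕ) : ket m k = if k = m then 1 else 0 := by
  rw [ket, lp.single_apply, Pi.single_apply]

theorem inner_ket (m k : ℕ) : inner ℂ (ket m) (ket k) = if m = k then (1 : ℂ) else 0 := by
  rw [ket, lp.inner_single_left, ket_apply]
  simp

theorem isTotal_ket : IsTotal ket := by
  intro V hV h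
  rw [eq_top_iff]
  rintro x -
  refine hV.mem_of_tendsto (lp.hasSum_single (by norm_num) x)
    (Filter.Eventually.of_forall fun s => V.sum_mem fun i _ => ?_)
  have : lp.single 2 i (x i) = x i • ket i := by
    rw [ket, ← lp.single_smul, smul_eq_mul, mul_one]
  rw [this]
  exact V.smul_mem _ (h i)

theorem backwardShift_ket_zero : backwardShift (ket 0) = 0 := by
  ext k
  rw [backwardShift_apply, ket_apply]
  simp

theorem backwardShift_ket_succ (m : ℕ) : backwardShift (ket (m + 1)) = ket m := by
  ext k
  rw [backwardShift_apply, ket_apply, ket_apply]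
  simp

theorem adjoint_backwardShift_ket (m : ℕ) : backwardShift.adjoint (ket m) = ket (m + 1) := by
  refine ext_inner_left ℂ fun x => ?_
  rw [ContinuousLinearMap.adjoint_inner_right, ket, ket, lp.inner_single_right,
    lp.inner_single_right, backwardShift_apply]

theorem vacuumProjection_ket_zero : vacuumProjection (ket 0) = ket 0 := by
  simp [vacuumProjection, backwardShift_ket_zero]

theorem vacuumProjection_ket_succ (m : ℕ) : vacuumProjection (ket (m + 1)) = 0 := by
  simp [vacuumProjection, backwardShift_ket_succ, adjoint_backwardShift_ket]

theorem backwardShift_mul_star : backwardShift * star backwardShift = 1 :=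
  isTotal_ket.ext fun m => by
    rw [mul_apply_eq_comp, ContinuousLinearMap.star_eq_adjoint, adjoint_backwardShift_ket,
      backwardShift_ket_succ, one_apply_eq_self]

variable {K : Type*} [NormedAddCommGroup K] [InnerProductSpace ℂ K]

/-- The isometry `x ↦ e_m ⊗ x`. -/
def fockVec (m : ℕ) : K →ₗᵢ[ℂ] HilbertTensor EllTwo K where
  toFun x := ((ket m ⊗ₜ[ℂ] x : EllTwo ⊗[ℂ] K) : HilbertTensor EllTwo K)
  map_add' x y := by rw [TensorProduct.tmul_add, Completion.coe_add]
  map_smul' c x := by rw [TensorProduct.tmul_smul, Completion.coe_smul, RingHom.id_apply]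
  norm_map' x := by
    have : ‖ket m‖ = 1 := by rw [ket, lp.norm_single (by norm_num)]; simp
    change ‖((ket m ⊗ₜ[ℂ] x : EllTwo ⊗[ℂ] K) : HilbertTensor EllTwo K)‖ = ‖x‖
    rw [Completion.norm_coe, TensorProduct.norm_tmul, this, one_mul]

theorem fockVec_apply (m : ℕ) (x : K) :
    fockVec m x = ((ket m ⊗ₜ[ℂ] x : EllTwo ⊗[ℂ] K) : HilbertTensor EllTwo K) := rfl

theorem inner_fockVec (m k : ℕ) (x y : K) :
    inner ℂ (fockVec m x) (fockVec k y) = if m = k then inner ℂ x y else 0 := by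
  rw [fockVec_apply, fockVec_apply, Completion.inner_coe, TensorProduct.inner_tmul, inner_ket]
  split_ifs <;> simp

theorem isTotal_fockVec {ι : Sort*} {f : ι → K} (hf : IsTotal f) :
    IsTotal fun p : PProd ℕ ι => fockVec p.1 (f p.2) := by
  intro V hV h
  have h1 : ∀ m (y : K), fockVec m y ∈ V := fun m y => by
    have : V.comap (fockVec m).toLinearMap = ⊤ :=
      hf _ (hV.preimage (fockVec m).continuous) fun i => h ⟨m, i⟩
    have hy : y ∈ V.comap (fockVec m).toLinearMap := by rw [this]; trivial
    exact hy
  refine isTotal_tmul EllTwo K V hV ?_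
  rintro ⟨x, y⟩
  let L : EllTwo →L[ℂ] HilbertTensor EllTwo K := LinearMap.mkContinuous
    { toFun := fun x => ((x ⊗ₜ[ℂ] y : EllTwo ⊗[ℂ] K) : HilbertTensor EllTwo K)
      map_add' := fun a b => by rw [TensorProduct.add_tmul, Completion.coe_add]
      map_smul' := fun c a => by
        rw [← TensorProduct.smul_tmul', Completion.coe_smul, RingHom.id_apply] } ‖y‖ fun x => by
      change ‖((x ⊗ₜ[ℂ] y : EllTwo ⊗[ℂ] K) : HilbertTensor EllTwo K)‖ ≤ _
      rw [Completion.norm_coe, TensorProduct.norm_tmul, mul_comm]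
  have h2 : V.comap L.toLinearMap = ⊤ :=
    isTotal_ket _ (hV.preimage L.continuous) fun m => h1 m y
  have hx : x ∈ V.comap L.toLinearMap := by rw [h2]; trivial
  exact hx

theorem isTotal_id : IsTotal fun x : K => x := fun V _ h => by
  rw [eq_top_iff]; exact fun x _ => h x

variable [CompleteSpace K]

theorem tensorOp_shift_zero (B : K →L[ℂ] K) (x : K) :
    tensorOp backwardShift B (fockVec 0 x) = 0 := by
  rw [fockVec_apply, tensorOp_tmul, backwardShift_ket_zero, TensorProduct.zero_tmul,
    Completion.coe_zero]

theorem tensorOp_shift_succ (B : K →L[ℂ] K) (m : ℕ) (x : K) :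
    tensorOp backwardShift B (fockVec (m + 1) x) = fockVec m (B x) := by
  rw [fockVec_apply, tensorOp_tmul, backwardShift_ket_succ, fockVec_apply]

theorem tensorOp_adjoint_shift (B : K →L[ℂ] K) (m : ℕ) (x : K) :
    tensorOp backwardShift.adjoint B (fockVec m x) = fockVec (m + 1) (B x) := by
  rw [fockVec_apply, tensorOp_tmul, adjoint_backwardShift_ket, fockVec_apply]

theorem tensorOp_vacuum_zero (B : K →L[ℂ] K) (x : K) :
    tensorOp vacuumProjection B (fockVec 0 x) = fockVec 0 (B x) := by
  rw [fockVec_apply, tensorOp_tmul, vacuumProjection_ket_zero, fockVec_apply]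

theorem tensorOp_vacuum_succ (B : K →L[ℂ] K) (m : ℕ) (x : K) :
    tensorOp vacuumProjection B (fockVec (m + 1) x) = 0 := by
  rw [fockVec_apply, tensorOp_tmul, vacuumProjection_ket_succ, TensorProduct.zero_tmul,
    Completion.coe_zero]

theorem tensorOp_one_fockVec (B : K →L[ℂ] K) (m : ℕ) (x : K) :
    tensorOp 1 B (fockVec m x) = fockVec m (B x) := by
  rw [fockVec_apply, tensorOp_tmul, fockVec_apply, one_apply_eq_self]

/-- The convolution of the elementary representation `π_{s_r}` with the operators `y i j`. The
condition that the summation index lies between `i` and `j` removes one term in the special rows. -/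
def shiftOp (r : ℕ) (y : ℕ → ℕ → K →L[ℂ] K) (i j : ℕ) :
    HilbertTensor EllTwo K →L[ℂ] HilbertTensor EllTwo K :=
  if i = r then tensorOp backwardShift (y r j)
    + tensorOp vacuumProjection (if r < j then y (r + 1) j else 0)
  else if i = r + 1 then tensorOp backwardShift.adjoint (y (r + 1) j)
    + tensorOp vacuumProjection (if j ≤ r then y r j else 0)
  else tensorOp 1 (y i j)

theorem shiftOp_left (r : ℕ) (y : ℕ → ℕ → K →L[ℂ] K) (j : ℕ) : shiftOp r y r j =
    tensorOp backwardShift (y r j) + tensorOp vacuumProjection (if r < j then y (r + 1) j else 0) :=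
  if_pos rfl

theorem shiftOp_right (r : ℕ) (y : ℕ → ℕ → K →L[ℂ] K) (j : ℕ) : shiftOp r y (r + 1) j =
    tensorOp backwardShift.adjoint (y (r + 1) j)
      + tensorOp vacuumProjection (if j ≤ r then y r j else 0) := by
  rw [shiftOp, if_neg (by omega), if_pos rfl]

theorem shiftOp_other {r i : ℕ} (y : ℕ → ℕ → K →L[ℂ] K) (h1 : i ≠ r) (h2 : i ≠ r + 1) (j : ℕ) :
    shiftOp r y i j = tensorOp 1 (y i j) := by
  rw [shiftOp, if_neg h1, if_neg h2]

theorem shiftOp_left_zero (r : ℕ) (y : ℕ → ℕ → K →L[ℂ] K) (j : ℕ) (x : K) :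
    shiftOp r y r j (fockVec 0 x) = fockVec 0 ((if r < j then y (r + 1) j else 0) x) := by
  rw [shiftOp_left, add_apply, tensorOp_shift_zero, tensorOp_vacuum_zero, zero_add]

theorem shiftOp_left_succ (r : ℕ) (y : ℕ → ℕ → K →L[ℂ] K) (j m : ℕ) (x : K) :
    shiftOp r y r j (fockVec (m + 1) x) = fockVec m (y r j x) := by
  rw [shiftOp_left, add_apply, tensorOp_shift_succ, tensorOp_vacuum_succ, add_zero]

theorem shiftOp_right_zero (r : ℕ) (y : ℕ → ℕ → K →L[ℂ] K) (j : ℕ) (x : K) :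
    shiftOp r y (r + 1) j (fockVec 0 x)
      = fockVec 1 (y (r + 1) j x) + fockVec 0 ((if j ≤ r then y r j else 0) x) := by
  rw [shiftOp_right, add_apply, tensorOp_adjoint_shift, tensorOp_vacuum_zero, zero_add]

theorem shiftOp_right_succ (r : ℕ) (y : ℕ → ℕ → K →L[ℂ] K) (j m : ℕ) (x : K) :
    shiftOp r y (r + 1) j (fockVec (m + 1) x) = fockVec (m + 2) (y (r + 1) j x) := by
  rw [shiftOp_right, add_apply, tensorOp_adjoint_shift, tensorOp_vacuum_succ, add_zero]

theorem shiftOp_other_fockVec {r i : ℕ} (y : ℕ → ℕ → K →L[ℂ] K) (h1 : i ≠ r) (h2 : i ≠ r + 1)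
    (j m : ℕ) (x : K) : shiftOp r y i j (fockVec m x) = fockVec m (y i j x) := by
  rw [shiftOp_other y h1 h2, tensorOp_one_fockVec]

theorem IsCrystalArray.shiftOp {n r : ℕ} (hr : r < n) {y : ℕ → ℕ → K →L[ℂ] K}
    (hy : IsCrystalArray n y) : IsCrystalArray n (shiftOp r y) := by
  have hT : star (tensorOp (star backwardShift) (1 : K →L[ℂ] K))
      = tensorOp backwardShift (1 : K →L[ℂ] K) := by
    rw [tensorOp_star, star_star, star_one]
  have h := (hy.map (amplify EllTwo) fun B => by
    rw [amplify_apply, amplify_apply, tensorOp_star, star_one]).shiftArray hr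
    (T := tensorOp (star backwardShift) (1 : K →L[ℂ] K))
    (by rw [hT, tensorOp_mul, backwardShift_mul_star, one_mul, tensorOp_one_one])
    (fun i j => by
      rw [Commute, SemiconjBy, amplify_apply, tensorOp_mul, tensorOp_mul]; simp)
    (fun i j => by
      rw [Commute, SemiconjBy, hT, amplify_apply, tensorOp_mul, tensorOp_mul]; simp)
  refine h.congr fun i j _ _ => ?_
  have hP : ∀ B : K →L[ℂ] K, (1 - tensorOp (star backwardShift) (1 : K →L[ℂ] K)
      * star (tensorOp (star backwardShift) 1)) * amplify EllTwo B
      = tensorOp vacuumProjection B := fun B => by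
    refine (isTotal_fockVec isTotal_id).ext fun p => ?_
    obtain ⟨m, x⟩ := p
    rw [hT, tensorOp_mul, one_mul, amplify_apply, mul_apply_eq_comp, tensorOp_one_fockVec, sub_apply]
    rcases m with _ | m
    · simp only [tensorOp_vacuum_zero, one_apply_eq_self]
      rw [fockVec_apply, tensorOp_tmul, mul_apply_eq_comp, backwardShift_ket_zero]
      simp
    · simp only [tensorOp_vacuum_succ, one_apply_eq_self]
      rw [fockVec_apply, tensorOp_tmul, mul_apply_eq_comp, backwardShift_ket_succ,
        ContinuousLinearMap.star_eq_adjoint, adjoint_backwardShift_ket]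
      simp
  have hi : ∀ (p : Prop) [Decidable p] (B : K →L[ℂ] K),
      (if p then amplify EllTwo B else 0) = amplify EllTwo (if p then B else 0) := by
    intro p _ B; split_ifs <;> simp
  by_cases h1 : i = r
  · subst h1
    rw [shiftOp_left, shiftArray_left, hi, hP, hT, amplify_apply, tensorOp_mul, mul_one, one_mul]
  by_cases h2 : i = r + 1
  · subst h2
    rw [shiftOp_right, shiftArray_right, hi, hP, amplify_apply, tensorOp_mul, mul_one, one_mul]
    rfl
  · rw [shiftOp_other y h1 h2, shiftArray_other _ _ h1 h2, amplify_apply]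

end FockVec

/-! ### Unitary equivalence of arrays of operators -/

section Equivalence

variable {H K L : Type*} [NormedAddCommGroup H] [InnerProductSpace ℂ H]
  [NormedAddCommGroup K] [InnerProductSpace ℂ K]
  [NormedAddCommGroup L] [InnerProductSpace ℂ L] {n : ℕ}

/-- Unitary equivalence of two arrays of operators, on the indices `0, ..., n`. -/
def ArrayEquiv (n : ℕ) (z : ℕ → ℕ → H →L[ℂ] H) (z' : ℕ → ℕ → K →L[ℂ] K) : Prop :=
  ∃ U : H ≃ₗᵢ[ℂ] K, ∀ i j, i ≤ n → j ≤ n → ∀ v, U (z i j v) = z' i j (U v)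

theorem ArrayEquiv.of_eq {z z' : ℕ → ℕ → H →L[ℂ] H} (h : ∀ i j, i ≤ n → j ≤ n → z i j = z' i j) :
    ArrayEquiv n z z' :=
  ⟨LinearIsometryEquiv.refl ℂ H, fun i j hi hj v => by simp [h i j hi hj]⟩

theorem ArrayEquiv.symm {z : ℕ → ℕ → H →L[ℂ] H} {z' : ℕ → ℕ → K →L[ℂ] K}
    (h : ArrayEquiv n z z') : ArrayEquiv n z' z := by
  obtain ⟨U, hU⟩ := h
  exact ⟨U.symm, fun i j hi hj v => U.injective (by simp [hU i j hi hj])⟩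

theorem ArrayEquiv.trans {z : ℕ → ℕ → H →L[ℂ] H} {z' : ℕ → ℕ → K →L[ℂ] K}
    {z'' : ℕ → ℕ → L →L[ℂ] L} (h : ArrayEquiv n z z') (h' : ArrayEquiv n z' z'') :
    ArrayEquiv n z z'' := by
  obtain ⟨U, hU⟩ := h
  obtain ⟨W, hW⟩ := h'
  exact ⟨U.trans W, fun i j hi hj v => by simp [hU i j hi hj, hW i j hi hj]⟩

/-- The array with row `i` multiplied by the phase `τ i`. -/
def scaleRows (τ : ℕ → Circle) (z : ℕ → ℕ → H →L[ℂ] H) (i j : ℕ) : H →L[ℂ] H := (τ i : ℂ) • z i j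

theorem ArrayEquiv.scaleRows {z : ℕ → ℕ → H →L[ℂ] H} {z' : ℕ → ℕ → K →L[ℂ] K}
    (h : ArrayEquiv n z z') (τ : ℕ → Circle) :
    ArrayEquiv n (scaleRows τ z) (scaleRows τ z') := by
  obtain ⟨U, hU⟩ := h
  exact ⟨U, fun i j hi hj v => by simp [CrystalSU.scaleRows, hU i j hi hj]⟩

theorem scaleRows_scaleRows (τ τ' : ℕ → Circle) (z : ℕ → ℕ → H →L[ℂ] H) :
    scaleRows τ (scaleRows τ' z) = scaleRows (τ * τ') z := by
  ext i j v
  simp [scaleRows, mul_smul]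

theorem scaleRows_one (z : ℕ → ℕ → H →L[ℂ] H) : scaleRows 1 z = z := by
  ext i j v
  simp [scaleRows]

theorem rangeProd_smul {B : Type*} [Ring B] [Algebra ℂ B] (m : ℕ) (c : ℕ → ℂ) (f : ℕ → B) :
    rangeProd m (fun k => c k • f k) = (∏ k ∈ Finset.range m, c k) • rangeProd m f := by
  induction m with
  | zero => simp
  | succ m ih => rw [rangeProd_succ, ih, rangeProd_succ, Finset.prod_range_succ, smul_mul_smul_comm]

@[to_additive]
theorem prod_range_skip {M : Type*} [CommMonoid M] (f : ℕ → M) {r n : ℕ} (hr : r ≤ n) :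
    f r * ∏ k ∈ Finset.range n, f (skip r k) = ∏ k ∈ Finset.range (n + 1), f k := by
  have h := Fin.prod_univ_succAbove (fun k : Fin (n + 1) => f k) ⟨r, by omega⟩
  simp only [val_succAbove_eq_skip] at h
  rw [← Fin.prod_univ_eq_prod_range fun k => f (skip r k), ← Fin.prod_univ_eq_prod_range f, h]

variable [CompleteSpace H] [CompleteSpace K]

/-- Rescaling the rows by phases with product one preserves the crystal relations. -/
theorem IsCrystalArray.scaleRows {z : ℕ → ℕ → H →L[ℂ] H} (hz : IsCrystalArray n z)
    {τ : ℕ → Circle} (hτ : ∏ k ∈ Finset.range (n + 1), τ k = 1) :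
    IsCrystalArray n (scaleRows τ z) where
  row i j l h1 h2 h3 := by
    rw [CrystalSU.scaleRows, CrystalSU.scaleRows, smul_mul_smul_comm, hz.row i j l h1 h2 h3,
      smul_zero]
  col i k j h1 h2 h3 := by
    rw [CrystalSU.scaleRows, CrystalSU.scaleRows, smul_mul_smul_comm, hz.col i k j h1 h2 h3,
      smul_zero]
  anti_comm i k j l h1 h2 h3 h4 := by
    rw [CrystalSU.scaleRows, CrystalSU.scaleRows, smul_mul_smul_comm, smul_mul_smul_comm,
      hz.anti_comm i k j l h1 h2 h3 h4, mul_comm]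
  anti_zero i k j l h1 h2 h3 h4 h5 := by
    rw [CrystalSU.scaleRows, CrystalSU.scaleRows, smul_mul_smul_comm,
      hz.anti_zero i k j l h1 h2 h3 h4 h5, smul_zero]
  diag_adjacent i k j l h1 h2 h3 h4 h5 := by
    simp only [CrystalSU.scaleRows, smul_mul_smul_comm]
    rw [← hz.diag_adjacent i k j l h1 h2 h3 h4 h5, smul_sub, mul_comm (τ k : ℂ)]
  diag_far i k j l h1 h2 h3 h4 h5 := by
    rw [CrystalSU.scaleRows, CrystalSU.scaleRows, smul_mul_smul_comm, smul_mul_smul_comm,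
      hz.diag_far i k j l h1 h2 h3 h4 h5, mul_comm]
  det_one := by
    have h : ∏ k ∈ Finset.range (n + 1), (τ k : ℂ) = 1 := by
      rw [← Circle.coe_one, ← hτ]; exact (map_prod Circle.coeHom τ _).symm
    simp only [CrystalSU.scaleRows]
    rw [rangeProd_smul, h, one_smul, hz.det_one]
  star_eq r s hr hs := by
    have h : ∏ k ∈ Finset.range n, (τ (skip r k) : ℂ) = star (τ r : ℂ) := by
      have h1 := (prod_range_skip τ hr).trans hτ
      have h2 : ∏ k ∈ Finset.range n, τ (skip r k) = (τ r)⁻¹ := eq_inv_of_mul_eq_one_right h1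
      have h3 : ((∏ k ∈ Finset.range n, τ (skip r k) : Circle) : ℂ)
        = ∏ k ∈ Finset.range n, (τ (skip r k) : ℂ) := map_prod Circle.coeHom _ _
      rw [← h3, h2, Circle.coe_inv_eq_conj]
      rfl
    simp only [CrystalSU.scaleRows]
    rw [rangeProd_smul, h, star_smul, hz.star_eq r s hr hs]

theorem ArrayEquiv.isCrystalArray {z : ℕ → ℕ → H →L[ℂ] H} {z' : ℕ → ℕ → K →L[ℂ] K}
    (h : ArrayEquiv n z z') (hz : IsCrystalArray n z) : IsCrystalArray n z' := by
  obtain ⟨U, hU⟩ := h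
  refine (hz.map (U.conjStarAlgEquiv : _ →+* (K →L[ℂ] K)) fun x => map_star U.conjStarAlgEquiv x).congr
    fun i j hi hj => ?_
  ext v
  have := hU i j hi hj (U.symm v)
  rw [U.apply_symm_apply] at this
  rw [← this]
  rfl

/-- The crystal relations express the upper triangle through the lower one, so that an operator
intertwining the lower triangles of two crystal arrays is an equivalence. -/
theorem ArrayEquiv.of_lower {z : ℕ → ℕ → H →L[ℂ] H} {z' : ℕ → ℕ → K →L[ℂ] K}
    (hz : IsCrystalArray n z) (hz' : IsCrystalArray n z') (U : H ≃ₗᵢ[ℂ] K)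
    (hU : ∀ i j, i ≤ n → j ≤ i → ∀ v, U (z i j v) = z' i j (U v)) : ArrayEquiv n z z' := by
  refine ⟨U, fun i j hi hj v => ?_⟩
  have key : ∀ i j, i ≤ n → j ≤ i → U.conjStarAlgEquiv (z i j) = z' i j := by
    intro i j hi hj
    ext v
    have := hU i j hi hj (U.symm v)
    rw [U.apply_symm_apply] at this
    rw [← this]
    rfl
  rcases le_total j i with hji | hij
  · exact hU i j hi hji v
  have h1 : U.conjStarAlgEquiv (z i j) = z' i j := by
    rw [hz.eq_star_rangeProd hi hj, hz'.eq_star_rangeProd hi hj, map_star, map_rangeProd]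
    congr 1
    exact rangeProd_congr fun k hk => key _ _ (skip_le i hk) (skip_le_skip hij k)
  rw [← h1]
  simp [LinearIsometryEquiv.conjStarAlgEquiv_apply_apply]

/-- Total families with equal Gram matrices give an equivalence of crystal arrays as soon as the
resulting unitary operator intertwines the lower triangles on the first family. -/
theorem ArrayEquiv.of_inner_eq {z : ℕ → ℕ → H →L[ℂ] H} {z' : ℕ → ℕ → K →L[ℂ] K}
    (hz : IsCrystalArray n z) (hz' : IsCrystalArray n z') {ι : Type*} {f : ι → H} {g : ι → K}
    (hf : IsTotal f) (hg : IsTotal g) (h : ∀ p q, inner ℂ (f p) (f q) = inner ℂ (g p) (g q))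
    (hU : ∀ U : H ≃ₗᵢ[ℂ] K, (∀ p, U (f p) = g p) → ∀ i j, i ≤ n → j ≤ i → ∀ p,
      U (z i j (f p)) = z' i j (g p)) : ArrayEquiv n z z' := by
  obtain ⟨U, hU'⟩ := exists_unitary_of_inner_eq hf hg h
  refine ArrayEquiv.of_lower hz hz' U fun i j hi hj v => ?_
  have := hf.ext (A := (U : H →L[ℂ] K).comp (z i j)) (B := (z' i j).comp (U : H →L[ℂ] K))
    fun p => by
      simpa [hU'] using hU U hU' i j hi hj p
  exact congrArg (fun f => f v) this

/-- Convolution with an elementary representation respects equivalence. -/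
theorem ArrayEquiv.shiftOp {y : ℕ → ℕ → H →L[ℂ] H} {y' : ℕ → ℕ → K →L[ℂ] K}
    (h : ArrayEquiv n y y') (hy : IsCrystalArray n y) {r : ℕ} (hr : r < n) :
    ArrayEquiv n (shiftOp r y) (shiftOp r y') := by
  have hy' := h.isCrystalArray hy
  obtain ⟨U, hU⟩ := h
  refine ArrayEquiv.of_inner_eq (hy.shiftOp hr) (hy'.shiftOp hr) (isTotal_fockVec isTotal_id)
    (isTotal_fockVec (f := U) fun V hV h => ?_) (fun p q => ?_) fun W hW i j hi hj p => ?_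
  · rw [eq_top_iff]
    rintro x -
    simpa using h (U.symm x)
  · simp only [inner_fockVec, LinearIsometryEquiv.inner_map_map]
  · obtain ⟨m, x⟩ := p
    have hW' : ∀ m x, W (fockVec m x) = fockVec m (U x) := fun m x => hW ⟨m, x⟩
    by_cases h1 : i = r
    · subst h1
      rcases m with _ | m
      · simp only [shiftOp_left_zero, hW']
        split_ifs
        · rw [hU _ _ (by omega) (by omega)]
        · simp
      · simp only [shiftOp_left_succ, hW']
        rw [hU _ _ (by omega) (by omega)]
    by_cases h2 : i = r + 1
    · subst h2
      rcases m with _ | m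
      · simp only [shiftOp_right_zero, hW', map_add]
        rw [hU _ _ (by omega) (by omega)]
        split_ifs
        · rw [hU _ _ (by omega) (by omega)]
        · simp
      · simp only [shiftOp_right_succ, hW']
        rw [hU _ _ (by omega) (by omega)]
    · simp only [shiftOp_other_fockVec _ h1 h2, hW']
      rw [hU _ _ (by omega) (by omega)]

/-- Phases on the rows can be moved through the convolution with an elementary representation, at
the price of an exchange of two of them: the operator `e_m ↦ (τ r / τ (r + 1)) ^ m e_m` rescales the
shift. -/
theorem shiftOp_scaleRows_equiv {y : ℕ → ℕ → H →L[ℂ] H} (hy : IsCrystalArray n y) {τ : ℕ → Circle}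
    (hτ : ∏ k ∈ Finset.range (n + 1), τ k = 1) {r : ℕ} (hr : r < n) :
    (∏ k ∈ Finset.range (n + 1), τ (Equiv.swap r (r + 1) k) = 1) ∧
    ArrayEquiv n (shiftOp r (scaleRows τ y))
      (scaleRows (fun i => τ (Equiv.swap r (r + 1) i)) (shiftOp r y)) := by
  have hτ' : ∏ k ∈ Finset.range (n + 1), τ (Equiv.swap r (r + 1) k) = 1 := by
    rw [← hτ]
    refine Finset.prod_bij (fun k _ => Equiv.swap r (r + 1) k) (fun k hk => ?_)
      (fun a _ b _ h => (Equiv.injective _) h) (fun b hb => ⟨Equiv.swap r (r + 1) b, ?_, by simp⟩)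
      fun _ _ => rfl
    · rw [Finset.mem_range] at hk ⊢
      rw [Equiv.swap_apply_def]; split_ifs <;> omega
    · rw [Finset.mem_range] at hb ⊢
      rw [Equiv.swap_apply_def]; split_ifs <;> omega
  refine ⟨hτ', ?_⟩
  let μ : Circle := τ r / τ (r + 1)
  have hμ : μ * τ (r + 1) = τ r := div_mul_cancel _ _
  have hμ' : ∀ m, (τ r : ℂ) * (μ : ℂ) ^ m = τ (r + 1) * (μ : ℂ) ^ (m + 1) := fun m => by
    rw [← hμ, Circle.coe_mul]; ring
  refine ArrayEquiv.of_inner_eq ((hy.scaleRows hτ).shiftOp hr) ((hy.shiftOp hr).scaleRows hτ')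
    (isTotal_fockVec isTotal_id)
    (g := fun p : PProd ℕ H => (μ : ℂ) ^ p.1 • fockVec p.1 p.2)
    (fun V hV h => isTotal_fockVec isTotal_id V hV fun p => ?_)
    (fun p q => ?_) fun W hW i j hi hj p => ?_
  · have := V.smul_mem ((μ : ℂ) ^ p.1)⁻¹ (h p)
    rwa [smul_smul, inv_mul_cancel₀ (pow_ne_zero _ μ.coe_ne_zero), one_smul] at this
  · simp only [inner_fockVec, inner_smul_left, inner_smul_right]
    split_ifs with h
    · have hn : ‖(μ : ℂ) ^ q.1‖ = 1 := by rw [norm_pow, Circle.norm_coe, one_pow]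
      rw [h, ← mul_assoc, Complex.mul_conj, Complex.normSq_eq_norm_sq, hn]
      simp
    · simp
  · obtain ⟨m, x⟩ := p
    have hW' : ∀ m x, W (fockVec m x) = (μ : ℂ) ^ m • fockVec m x := fun m x => hW ⟨m, x⟩
    by_cases h1 : i = r
    · subst h1
      rcases m with _ | m
      · simp [scaleRows, shiftOp_left_zero, Nat.not_lt.2 hj]
      · simp only [scaleRows, shiftOp_left_succ, hW', smul_apply, map_smul, smul_smul,
          Equiv.swap_apply_left]
        rw [hμ', mul_comm]
    by_cases h2 : i = r + 1
    · subst h2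
      rcases m with _ | m
      · simp only [scaleRows, shiftOp_right_zero, hW', smul_apply, map_smul, smul_smul, map_add,
          Equiv.swap_apply_right, pow_zero, one_smul, smul_add, pow_one]
        congr 1
        · congr 1
          have := hμ' 0
          simpa using this.symm
        · split_ifs <;> simp
      · simp only [scaleRows, shiftOp_right_succ, hW', smul_apply, map_smul, smul_smul,
          Equiv.swap_apply_right]
        rw [mul_comm _ (τ r : ℂ), hμ' (m + 1)]
    · simp only [scaleRows, shiftOp_other_fockVec _ h1 h2, hW', smul_apply, map_smul, smul_smul,
        Equiv.swap_apply_of_ne_of_ne h1 h2]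
      rw [mul_comm]

end Equivalence

/-! ### Words in the simple transpositions -/

section Words

/-- The permutation of `ℕ` expressed by a word in the transpositions `(r, r + 1)`. -/
def natWordPerm (a : List ℕ) : Equiv.Perm ℕ := (a.map fun r => Equiv.swap r (r + 1)).prod

theorem natWordPerm_cons (r : ℕ) (a : List ℕ) :
    natWordPerm (r :: a) = Equiv.swap r (r + 1) * natWordPerm a := by
  simp [natWordPerm]

theorem natWordPerm_append (a b : List ℕ) :
    natWordPerm (a ++ b) = natWordPerm a * natWordPerm b := by
  simp [natWordPerm]

theorem natWordPerm_of_lt {n : ℕ} {a : List ℕ} (ha : ∀ r ∈ a, r < n) {i : ℕ} (hi : n < i) :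
    natWordPerm a i = i := by
  induction a with
  | nil => rfl
  | cons r a ih =>
    have hr := ha r (by simp)
    rw [natWordPerm_cons, Equiv.Perm.mul_apply, ih fun s hs => ha s (by simp [hs]),
      Equiv.swap_apply_of_ne_of_ne (by omega) (by omega)]

/-- The equivalence of words generated by the braid moves. -/
inductive Braid : List ℕ → List ℕ → Prop
  | refl (a : List ℕ) : Braid a a
  | symm {a b : List ℕ} : Braid a b → Braid b a
  | trans {a b c : List ℕ} : Braid a b → Braid b c → Braid a c
  | cons (r : ℕ) {a b : List ℕ} : Braid a b → Braid (r :: a) (r :: b)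
  | comm (r s : ℕ) (a : List ℕ) : r + 2 ≤ s → Braid (r :: s :: a) (s :: r :: a)
  | braid (r : ℕ) (a : List ℕ) : Braid (r :: (r + 1) :: r :: a) ((r + 1) :: r :: (r + 1) :: a)

theorem Braid.append_left (c : List ℕ) {a b : List ℕ} (h : Braid a b) :
    Braid (c ++ a) (c ++ b) := by
  induction c with
  | nil => exact h
  | cons r c ih => exact ih.cons r

theorem Braid.length_eq {a b : List ℕ} (h : Braid a b) : a.length = b.length := by
  induction h <;> simp_all

theorem Braid.mem_iff {a b : List ℕ} (h : Braid a b) (x : ℕ) : x ∈ a ↔ x ∈ b := by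
  induction h with
  | refl => rfl
  | symm _ ih => exact ih.symm
  | trans _ _ ih ih' => exact ih.trans ih'
  | cons r _ ih => simp [ih]
  | comm r s a _ => simp only [List.mem_cons]; tauto
  | braid r a => simp only [List.mem_cons]; tauto

theorem Braid.natWordPerm_eq {a b : List ℕ} (h : Braid a b) : natWordPerm a = natWordPerm b := by
  induction h with
  | refl => rfl
  | symm _ ih => exact ih.symm
  | trans _ _ ih ih' => exact ih.trans ih'
  | cons r _ ih => rw [natWordPerm_cons, natWordPerm_cons, ih]
  | comm r s a hrs =>
    simp only [natWordPerm_cons, ← mul_assoc]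
    congr 1
    ext x
    simp only [Equiv.Perm.mul_apply, Equiv.swap_apply_def]
    split_ifs <;> omega
  | braid r a =>
    simp only [natWordPerm_cons, ← mul_assoc]
    congr 1
    ext x
    simp only [Equiv.Perm.mul_apply, Equiv.swap_apply_def]
    split_ifs <;> omega

/-- A letter commutes with a word all of whose letters are far above it. -/
theorem Braid.pass {r : ℕ} {c : List ℕ} (hc : ∀ s ∈ c, r + 2 ≤ s) (a : List ℕ) :
    Braid (r :: (c ++ a)) (c ++ r :: a) := by
  induction c with
  | nil => exact Braid.refl _
  | cons s c ih =>
    exact (Braid.comm r s _ (hc s (by simp))).trans ((ih fun t ht => hc t (by simp [ht])).cons s)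

/-- A letter commutes with a word all of whose letters are far below it. -/
theorem Braid.pass' {r : ℕ} {c : List ℕ} (hc : ∀ s ∈ c, s + 2 ≤ r) (a : List ℕ) :
    Braid (r :: (c ++ a)) (c ++ r :: a) := by
  induction c with
  | nil => exact Braid.refl _
  | cons s c ih =>
    exact (Braid.comm s r _ (hc s (by simp))).symm.trans
      ((ih fun t ht => hc t (by simp [ht])).cons s)

/-- Normal forms of the elements of `S_{n+1}`: products of descending coset representatives
`s_k s_{k+1} ⋯ s_{n-1}` for the chain of symmetric groups. -/
inductive IsNormalWord : ℕ → List ℕ → Prop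
  | nil : IsNormalWord 0 []
  | cons {n k : ℕ} {a : List ℕ} : IsNormalWord n a → k ≤ n + 1 →
      IsNormalWord (n + 1) (List.range' k (n + 1 - k) ++ a)

theorem IsNormalWord.lt {n : ℕ} {a : List ℕ} (h : IsNormalWord n a) : ∀ r ∈ a, r < n := by
  induction h with
  | nil => simp
  | cons h hk ih =>
    intro r hr
    rcases List.mem_append.1 hr with hr | hr
    · rw [List.mem_range'_1] at hr; omega
    · have := ih r hr; omega

theorem IsNormalWord.exists_nil : ∀ n, IsNormalWord n [] := fun n => by
  induction n with
  | zero => exact .nil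
  | succ n ih => simpa using ih.cons (k := n + 1) le_rfl

theorem natWordPerm_range' (k m : ℕ) : natWordPerm (List.range' k m) (k + m) = k := by
  induction m generalizing k with
  | zero => simp [natWordPerm]
  | succ m ih =>
    have := ih (k + 1)
    rw [List.range'_succ, natWordPerm_cons, Equiv.Perm.mul_apply,
      show k + (m + 1) = k + 1 + m by omega, this, Equiv.swap_apply_right]

/-- The first coset representative in a normal word is read off from the image of `n + 1`. -/
theorem IsNormalWord.cons_apply {n k : ℕ} {a : List ℕ} (h : IsNormalWord n a) (hk : k ≤ n + 1) :
    natWordPerm (List.range' k (n + 1 - k) ++ a) (n + 1) = k := by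
  rw [natWordPerm_append, Equiv.Perm.mul_apply, natWordPerm_of_lt h.lt (Nat.lt_succ_self n)]
  have := natWordPerm_range' k (n + 1 - k)
  rwa [Nat.add_sub_cancel' hk] at this

/-- A permutation has only one normal word. -/
theorem IsNormalWord.eq_of_natWordPerm_eq {n : ℕ} {a b : List ℕ} (ha : IsNormalWord n a)
    (hb : IsNormalWord n b) (h : natWordPerm a = natWordPerm b) : a = b := by
  induction ha generalizing b with
  | nil => cases hb; rfl
  | @cons n k a ha hk ih =>
    cases hb with
    | @cons _ k' b hb hk' =>
      have h1 := ha.cons_apply hk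
      rw [h, hb.cons_apply hk'] at h1
      subst h1
      rw [natWordPerm_append, natWordPerm_append, mul_right_inj] at h
      rw [ih hb h]

/-- A letter in front of a normal word can be absorbed by braid moves, or the normal word is itself
braid equivalent to a word starting with that letter, which then cancels. -/
theorem IsNormalWord.insert {n : ℕ} {a : List ℕ} (ha : IsNormalWord n a) {r : ℕ} (hr : r < n) :
    ∃ a', IsNormalWord n a' ∧ (Braid (r :: a) a' ∨ Braid a (r :: a')) := by
  induction ha generalizing r with
  | nil => omega
  | @cons n k a ha hk ih =>
    rcases lt_trichotomy (r + 1) k with h1 | h1 | h1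
    · obtain ⟨a', ha', h | h⟩ := ih (r := r) (by omega)
      · exact ⟨_, ha'.cons hk, .inl ((Braid.pass (fun s hs => by
          rw [List.mem_range'_1] at hs; omega) a).trans (h.append_left _))⟩
      · exact ⟨_, ha'.cons hk, .inr ((h.append_left _).trans (Braid.pass (fun s hs => by
          rw [List.mem_range'_1] at hs; omega) a').symm)⟩
    · refine ⟨_, ha.cons (k := r) (by omega), .inl ?_⟩
      rw [show n + 1 - r = (n + 1 - k) + 1 by omega, List.range'_succ, h1]
      exact Braid.refl _
    -- for `r = k` the letter `s_r` is the first letter of the word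
    rcases Nat.eq_or_lt_of_le (Nat.lt_succ_iff.1 h1) with h2 | h2
    · subst h2
      refine ⟨_, ha.cons (k := k + 1) (by omega), .inr ?_⟩
      rw [show n + 1 - k = (n + 1 - (k + 1)) + 1 by omega, List.range'_succ]
      exact Braid.refl _
    · -- `s_r s_k ⋯ s_n = s_k ⋯ s_n s_{r-1}` for `k < r`
      obtain ⟨p, rfl⟩ : ∃ p, r = k + p + 1 := ⟨r - k - 1, by omega⟩
      obtain ⟨q, rfl⟩ : ∃ q, n = k + p + 1 + q := ⟨n - (k + p + 1), by omega⟩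
      have hsplit : List.range' k (k + p + 1 + q + 1 - k)
          = List.range' k p ++ (k + p) :: (k + p + 1) :: List.range' (k + p + 2) q := by
        rw [show k + p + 1 + q + 1 - k = p + (q + 1 + 1) by omega, ← List.range'_append_1,
          List.range'_succ, List.range'_succ]
      have key : ∀ b, Braid ((k + p + 1) :: (List.range' k (k + p + 1 + q + 1 - k) ++ b))
          (List.range' k (k + p + 1 + q + 1 - k) ++ (k + p) :: b) := by
        intro b
        rw [hsplit]
        simp only [List.append_assoc, List.cons_append]
        refine (Braid.pass' (fun s hs => ?_) _).trans (Braid.append_left _ ?_)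
        · rw [List.mem_range'_1] at hs; omega
        · exact (Braid.braid (k + p) _).symm.trans (((Braid.pass (fun s hs => by
            rw [List.mem_range'_1] at hs; omega) b).cons _).cons _)
      obtain ⟨a', ha', h | h⟩ := ih (r := k + p) (by omega)
      · exact ⟨_, ha'.cons hk, .inl ((key a).trans (h.append_left _))⟩
      · exact ⟨_, ha'.cons hk, .inr ((h.append_left _).trans (key a').symm)⟩

/-- Every word is braid equivalent to a normal word, or not reduced. -/
theorem exists_isNormalWord {n : ℕ} {a : List ℕ} (ha : ∀ r ∈ a, r < n) :
    ∃ b, IsNormalWord n b ∧ natWordPerm b = natWordPerm a ∧ (Braid a b ∨ b.length < a.length) := by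
  induction a with
  | nil => exact ⟨[], .exists_nil n, rfl, .inl (.refl _)⟩
  | cons r a ih =>
    obtain ⟨b, hb, hp, h⟩ := ih fun s hs => ha s (by simp [hs])
    have hl : b.length ≤ a.length := by
      rcases h with h | h
      · exact h.length_eq.ge
      · exact h.le
    obtain ⟨b', hb', h' | h'⟩ := hb.insert (ha r (by simp))
    · refine ⟨b', hb', ?_, ?_⟩
      · rw [← h'.natWordPerm_eq, natWordPerm_cons, natWordPerm_cons, hp]
      · rcases h with h | h
        · exact .inl ((h.cons r).trans h')
        · right
          have := h'.length_eq
          simp only [List.length_cons] at this ⊢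
          omega
    · refine ⟨b', hb', ?_, .inr ?_⟩
      · rw [natWordPerm_cons, ← hp, h'.natWordPerm_eq, natWordPerm_cons, ← mul_assoc,
          Equiv.swap_mul_self, one_mul]
      · have := h'.length_eq
        simp only [List.length_cons] at this ⊢
        omega

theorem natWordPerm_map_val {n : ℕ} (a : List (Fin n)) (i : Fin (n + 1)) :
    natWordPerm (a.map Fin.val) i = (wordPerm a i : ℕ) := by
  induction a with
  | nil => rfl
  | cons r a ih =>
    have h : wordPerm (r :: a) = Equiv.swap r.castSucc r.succ * wordPerm a := by simp [wordPerm]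
    rw [List.map_cons, natWordPerm_cons, Equiv.Perm.mul_apply, ih, h, Equiv.Perm.mul_apply,
      Equiv.swap_apply_def, Equiv.swap_apply_def]
    simp only [Fin.ext_iff, Fin.val_castSucc, Fin.val_succ]
    split_ifs <;> simp

theorem natWordPerm_map_val_eq_iff {n : ℕ} (a b : List (Fin n)) :
    natWordPerm (a.map Fin.val) = natWordPerm (b.map Fin.val) ↔ wordPerm a = wordPerm b := by
  constructor
  · intro h
    ext i
    rw [← natWordPerm_map_val, h, natWordPerm_map_val]
  · intro h
    ext i
    rcases Nat.lt_or_ge n i with hi | hi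
    · rw [natWordPerm_of_lt (by simp) hi, natWordPerm_of_lt (by simp) hi]
    · have h1 := natWordPerm_map_val a ⟨i, by omega⟩
      have h2 := natWordPerm_map_val b ⟨i, by omega⟩
      rw [h] at h1
      exact h1.trans h2.symm

theorem exists_map_val_eq {n : ℕ} {a : List ℕ} (ha : ∀ r ∈ a, r < n) :
    ∃ b : List (Fin n), b.map Fin.val = a :=
  ⟨a.pmap Fin.mk ha, by simp [List.map_pmap]⟩

/-- A reduced expression is braid equivalent to the normal word of its permutation. -/
theorem IsReducedExpression.exists_isNormalWord {n : ℕ} {w : Equiv.Perm (Fin (n + 1))}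
    {a : List (Fin n)} (ha : IsReducedExpression w a) :
    ∃ b, IsNormalWord n b ∧ natWordPerm b = natWordPerm (a.map Fin.val)
      ∧ Braid (a.map Fin.val) b := by
  obtain ⟨b, hb, hp, h | h⟩ := CrystalSU.exists_isNormalWord (n := n) (a := a.map Fin.val) (by simp)
  · exact ⟨b, hb, hp, h⟩
  · obtain ⟨b', rfl⟩ := exists_map_val_eq hb.lt
    have := ha.2 b' (by rw [(natWordPerm_map_val_eq_iff _ _).1 hp, ha.1])
    simp only [List.length_map] at h
    omega

theorem exists_isReducedExpression {n : ℕ} (a : List (Fin n)) :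
    ∃ b, IsReducedExpression (wordPerm a) b := by
  classical
  have h : ∃ m, ∃ b : List (Fin n), wordPerm b = wordPerm a ∧ b.length = m := ⟨_, a, rfl, rfl⟩
  obtain ⟨b, hb, hl⟩ := Nat.find_spec h
  exact ⟨b, hb, fun c hc => hl ▸ Nat.find_min' h ⟨c, hc, rfl⟩⟩

end Words

/-! ### The representations attached to words -/

/-- A Hilbert space with operators indexed by pairs of natural numbers. -/
structure OperatorArray where
  space : Type
  [normed : NormedAddCommGroup space]
  [inner : InnerProductSpace ℂ space]
  [complete : CompleteSpace space]
  op : ℕ → ℕ → space →L[ℂ] space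

attribute [instance] OperatorArray.normed OperatorArray.inner OperatorArray.complete

namespace OperatorArray

/-- Convolution with the elementary representation of the transposition `(r, r + 1)` on the left. -/
def shift (r : ℕ) (Y : OperatorArray) : OperatorArray where
  space := HilbertTensor EllTwo Y.space
  op := shiftOp r Y.op

/-- The trivial representation. -/
def unit : OperatorArray where
  space := ℂ
  op i j := if i = j then 1 else 0

/-- The successive convolution of the elementary representations in a word with `Y`. -/
def prepend (a : List ℕ) (Y : OperatorArray) : OperatorArray := a.foldr shift Y

theorem prepend_append (a b : List ℕ) (Y : OperatorArray) :
    prepend (a ++ b) Y = prepend a (prepend b Y) := List.foldr_append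

/-- The representation attached to a word. -/
def ofWord (a : List ℕ) : OperatorArray := prepend a unit

end OperatorArray

open OperatorArray

theorem rangeProd_one {B : Type*} [Monoid B] (m : ℕ) : rangeProd m (fun _ => (1 : B)) = 1 := by
  simp [rangeProd]

/-- The relations of the trivial representation; its adjoint relation off the diagonal holds because
some factor of the product lies off the diagonal. -/
theorem isCrystalArray_delta (B : Type*) [Ring B] [StarRing B] (n : ℕ) :
    IsCrystalArray n fun i j => if i = j then (1 : B) else 0 where
  row i j l _ _ h := by
    split_ifs <;> first | omega | simp
  col i k j _ _ h := by
    split_ifs <;> first | omega | simp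
  anti_comm i k j l _ _ h h' := by
    split_ifs <;> first | omega | simp
  anti_zero i k j l _ _ h h' hm := by
    split_ifs <;> first | omega | simp
  diag_adjacent i k j l _ _ h h' hm := by
    split_ifs <;> first | omega | simp
  diag_far i k j l _ _ h h' hm := by
    split_ifs <;> first | omega | simp
  det_one := by simp [rangeProd_one]
  star_eq r s hr hs := by
    rcases eq_or_ne r s with rfl | h
    · simp [rangeProd_one]
    · have hp : ∃ p < n, skip r p ≠ skip s p := by
        refine ⟨min r s, by omega, ?_⟩
        unfold skip; split_ifs <;> omega
      obtain ⟨p, hp, hne⟩ := hp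
      rw [rangeProd_split hp]
      simp [h, hne]

theorem isCrystalArray_unit (n : ℕ) : IsCrystalArray n unit.op := isCrystalArray_delta (ℂ →L[ℂ] ℂ) n

theorem isCrystalArray_prepend {n : ℕ} {a : List ℕ} (ha : ∀ r ∈ a, r < n) {Y : OperatorArray}
    (hY : IsCrystalArray n Y.op) : IsCrystalArray n (prepend a Y).op := by
  induction a with
  | nil => exact hY
  | cons r a ih => exact (ih fun s hs => ha s (by simp [hs])).shiftOp (ha r (by simp))

theorem isCrystalArray_ofWord {n : ℕ} {a : List ℕ} (ha : ∀ r ∈ a, r < n) :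
    IsCrystalArray n (ofWord a).op := isCrystalArray_prepend ha (isCrystalArray_unit n)

/-! ### Braid moves -/

section Braid

variable {K H H₁ H₂ H' H₁' H₂' : Type*}
  [NormedAddCommGroup K] [InnerProductSpace ℂ K]
  [NormedAddCommGroup H] [InnerProductSpace ℂ H]
  [NormedAddCommGroup H₁] [InnerProductSpace ℂ H₁]
  [NormedAddCommGroup H₂] [InnerProductSpace ℂ H₂]
  [NormedAddCommGroup H'] [InnerProductSpace ℂ H']
  [NormedAddCommGroup H₁'] [InnerProductSpace ℂ H₁']
  [NormedAddCommGroup H₂'] [InnerProductSpace ℂ H₂'] {n : ℕ}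

/-- The array `z` is the convolution of the elementary representation of `(r, r + 1)` with the array
`y`, where the isometries `e m` play the role of `x ↦ e_m ⊗ x`. -/
structure IsShift (r : ℕ) (y : ℕ → ℕ → K →L[ℂ] K) (z : ℕ → ℕ → H →L[ℂ] H)
    (e : ℕ → K →ₗᵢ[ℂ] H) : Prop where
  total : ∀ V : Submodule ℂ H, IsClosed (V : Set H) → (∀ m x, e m x ∈ V) → V = ⊤
  inner_eq : ∀ m k x x', inner ℂ (e m x) (e k x') = if m = k then inner ℂ x x' else 0
  left_zero : ∀ j x, z r j (e 0 x) = e 0 ((if r < j then y (r + 1) j else 0) x)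
  left_succ : ∀ j m x, z r j (e (m + 1) x) = e m (y r j x)
  right_zero : ∀ j x, z (r + 1) j (e 0 x)
    = e 1 (y (r + 1) j x) + e 0 ((if j ≤ r then y r j else 0) x)
  right_succ : ∀ j m x, z (r + 1) j (e (m + 1) x) = e (m + 2) (y (r + 1) j x)
  other : ∀ i, i ≠ r → i ≠ r + 1 → ∀ j m x, z i j (e m x) = e m (y i j x)

theorem isShift_shift (r : ℕ) (Y : OperatorArray) :
    IsShift r Y.op (shift r Y).op (H := (shift r Y).space) fockVec where
  total V hV h := isTotal_fockVec isTotal_id V hV fun p => h p.1 p.2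
  inner_eq := inner_fockVec
  left_zero := shiftOp_left_zero r Y.op
  left_succ := shiftOp_left_succ r Y.op
  right_zero := shiftOp_right_zero r Y.op
  right_succ := shiftOp_right_succ r Y.op
  other _ h h' j m x := shiftOp_other_fockVec Y.op h h' j m x

theorem IsShift.isTotal {r : ℕ} {y : ℕ → ℕ → K →L[ℂ] K} {z : ℕ → ℕ → H →L[ℂ] H}
    {e : ℕ → K →ₗᵢ[ℂ] H} (h : IsShift r y z e) {ι : Sort*} {f : ι → K} (hf : IsTotal f) :
    IsTotal fun p : PProd ℕ ι => e p.1 (f p.2) := by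
  intro V hV hm
  refine h.total V hV fun m x => ?_
  have : V.comap (e m).toLinearMap = ⊤ := hf _ (hV.preimage (e m).continuous) fun i => hm ⟨m, i⟩
  have hx : x ∈ V.comap (e m).toLinearMap := by rw [this]; trivial
  exact hx

/-- Distant transpositions: the flip of the two factors `ℓ²(ℕ)` is an equivalence. -/
theorem IsShift.comm_equiv [CompleteSpace H₁] [CompleteSpace H₁'] {y : ℕ → ℕ → K →L[ℂ] K} {r s : ℕ} (hrs : r + 2 ≤ s)
    {y₁ : ℕ → ℕ → H →L[ℂ] H} {y₁' : ℕ → ℕ → H' →L[ℂ] H'} {z : ℕ → ℕ → H₁ →L[ℂ] H₁}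
    {z' : ℕ → ℕ → H₁' →L[ℂ] H₁'} {e : ℕ → K →ₗᵢ[ℂ] H} {e₁ : ℕ → H →ₗᵢ[ℂ] H₁}
    {e' : ℕ → K →ₗᵢ[ℂ] H'} {e₁' : ℕ → H' →ₗᵢ[ℂ] H₁'}
    (h : IsShift s y y₁ e) (h₁ : IsShift r y₁ z e₁)
    (h' : IsShift r y y₁' e') (h₁' : IsShift s y₁' z' e₁')
    (hz : IsCrystalArray n z) (hz' : IsCrystalArray n z') : ArrayEquiv n z z' := by
  refine ArrayEquiv.of_inner_eq hz hz' (h₁.isTotal (h.isTotal isTotal_id))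
    (g := fun p : PProd ℕ (PProd ℕ K) => e₁' p.2.1 (e' p.1 p.2.2))
    (fun V hV hm => h₁'.isTotal (h'.isTotal isTotal_id) V hV fun p => hm ⟨p.2.1, p.1, p.2.2⟩)
    (fun p q => ?_) fun U hU i j hi hj p => ?_
  · simp only [h.inner_eq, h₁.inner_eq, h'.inner_eq, h₁'.inner_eq]
    split_ifs <;> rfl
  · obtain ⟨a, b, x⟩ := p
    have hU' : ∀ a b x, U (e₁ a (e b x)) = e₁' b (e' a x) := fun a b x => hU ⟨a, b, x⟩
    by_cases h1 : i = r
    · subst h1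
      have e1 : i ≠ s := by omega
      have e2 : i ≠ s + 1 := by omega
      rcases a with _ | a
      · simp [h₁.left_zero, h'.left_zero, Nat.not_lt.2 hj, h₁'.other _ e1 e2]
      · simp only [h₁.left_succ, h'.left_succ, h.other _ e1 e2, h₁'.other _ e1 e2, hU']
    by_cases h2 : i = r + 1
    · subst h2
      have e1 : r + 1 ≠ s := by omega
      have e2 : r + 1 ≠ s + 1 := by omega
      have e3 : r ≠ s := by omega
      have e4 : r ≠ s + 1 := by omega
      rcases a with _ | a
      · by_cases hjr : j ≤ r
        · simp only [h₁.right_zero, h'.right_zero, h.other _ e1 e2, h₁'.other _ e1 e2,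
            h.other _ e3 e4, hU', map_add, if_pos hjr]
        · simp only [h₁.right_zero, h'.right_zero, h.other _ e1 e2, h₁'.other _ e1 e2, hU',
            if_neg hjr, zero_apply, map_zero, add_zero]
      · simp only [h₁.right_succ, h'.right_succ, h.other _ e1 e2, h₁'.other _ e1 e2, hU']
    by_cases h3 : i = s
    · subst h3
      rcases b with _ | b
      · simp [h.left_zero, h₁'.left_zero, Nat.not_lt.2 hj, h₁.other _ h1 h2]
      · simp only [h.left_succ, h₁'.left_succ, h₁.other _ h1 h2, h'.other _ h1 h2, hU']
    by_cases h4 : i = s + 1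
    · subst h4
      have e3 : s ≠ r := by omega
      have e4 : s ≠ r + 1 := by omega
      rcases b with _ | b
      · by_cases hjs : j ≤ s
        · simp only [h.right_zero, h₁'.right_zero, h₁.other _ h1 h2, h'.other _ h1 h2,
            h'.other _ e3 e4, hU', map_add, if_pos hjs]
        · simp only [h.right_zero, h₁'.right_zero, h₁.other _ h1 h2, h'.other _ h1 h2, hU',
            if_neg hjs, zero_apply, map_zero, add_zero]
      · simp only [h.right_succ, h₁'.right_succ, h₁.other _ h1 h2, h'.other _ h1 h2, hU']
    · simp only [h₁.other _ h1 h2, h'.other _ h1 h2, h.other _ h3 h4, h₁'.other _ h3 h4, hU']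

set_option maxHeartbeats 4000000 in
/-- Adjacent transpositions: the equivalence permutes the basis of `ℓ²(ℕ) ⊗ ℓ²(ℕ) ⊗ ℓ²(ℕ)` by the
tropical limit of the change of coordinates between the two reduced expressions. -/
theorem IsShift.braid_equiv [CompleteSpace H₂] [CompleteSpace H₂'] {y : ℕ → ℕ → K →L[ℂ] K} {r : ℕ}
    {y₁ : ℕ → ℕ → H →L[ℂ] H} {y₂ : ℕ → ℕ → H₁ →L[ℂ] H₁} {z : ℕ → ℕ → H₂ →L[ℂ] H₂}
    {y₁' : ℕ → ℕ → H' →L[ℂ] H'} {y₂' : ℕ → ℕ → H₁' →L[ℂ] H₁'} {z' : ℕ → ℕ → H₂' →L[ℂ] H₂'}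
    {e : ℕ → K →ₗᵢ[ℂ] H} {e₁ : ℕ → H →ₗᵢ[ℂ] H₁} {e₂ : ℕ → H₁ →ₗᵢ[ℂ] H₂}
    {e' : ℕ → K →ₗᵢ[ℂ] H'} {e₁' : ℕ → H' →ₗᵢ[ℂ] H₁'} {e₂' : ℕ → H₁' →ₗᵢ[ℂ] H₂'}
    (h : IsShift r y y₁ e) (h₁ : IsShift (r + 1) y₁ y₂ e₁) (h₂ : IsShift r y₂ z e₂)
    (h' : IsShift (r + 1) y y₁' e') (h₁' : IsShift r y₁' y₂' e₁')
    (h₂' : IsShift (r + 1) y₂' z' e₂')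
    (hz : IsCrystalArray n z) (hz' : IsCrystalArray n z') : ArrayEquiv n z z' := by
  refine ArrayEquiv.of_inner_eq hz hz' (h₂.isTotal (h₁.isTotal (h.isTotal isTotal_id)))
    (g := fun p : PProd ℕ (PProd ℕ (PProd ℕ K)) =>
      e₂' (p.2.1 + (p.2.2.1 - p.1)) (e₁' (min p.1 p.2.2.1)
        (e' (p.2.1 + (p.1 - p.2.2.1)) p.2.2.2)))
    (fun V hV hm => h₂'.isTotal (h₁'.isTotal (h'.isTotal isTotal_id)) V hV fun p => ?_)
    (fun p q => ?_) fun U hU i j hi hj p => ?_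
  · -- the change of coordinates is an involution
    obtain ⟨a, b, c, x⟩ := p
    have := hm ⟨b + (c - a), min a c, b + (a - c), x⟩
    simp only at this ⊢
    convert this using 3 <;> first | omega | (congr 1; congr 1; omega)
  · obtain ⟨a, b, c, x⟩ := p
    obtain ⟨a', b', c', x'⟩ := q
    simp only [h.inner_eq, h₁.inner_eq, h₂.inner_eq, h'.inner_eq, h₁'.inner_eq, h₂'.inner_eq]
    split_ifs <;> first | rfl | omega
  · obtain ⟨a, b, c, x⟩ := p
    have hU' : ∀ a b c x, U (e₂ a (e₁ b (e c x))) = e₂' (b + (c - a))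
      (e₁' (min a c) (e' (b + (a - c)) x)) := fun a b c x => hU ⟨a, b, c, x⟩
    clear hU
    have h3 : ∀ {a b c a' b' c' : ℕ} (x : K), a = a' → b = b' → c = c' →
        e₂' a (e₁' b (e' c x)) = e₂' a' (e₁' b' (e' c' x)) := by
      rintro a b c _ _ _ x rfl rfl rfl; rfl
    have hassoc : ∀ u v w : H₂', u + v + w = u + (v + w) := add_assoc
    have hlt : r < j ↔ ¬ j ≤ r := not_le.symm
    have hlt' : r + 1 < j ↔ ¬ j ≤ r + 1 := not_le.symm
    by_cases h1 : i = r
    · subst h1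
      have e1 : i ≠ i + 1 := by omega
      have e2 : i ≠ i + 1 + 1 := by omega
      rcases a with _ | a
      · simp [h₂.left_zero, Nat.not_lt.2 hj, h₁'.left_zero, h₂'.other _ e1 e2]
      rcases c with _ | c
      · simp [h₂.left_succ, h.left_zero, h₁'.left_zero, Nat.not_lt.2 hj, h₁.other _ e1 e2,
          h₂'.other _ e1 e2]
      · simp only [h₂.left_succ, h.left_succ, h₁'.left_succ, h₁.other _ e1 e2, h'.other _ e1 e2,
          h₂'.other _ e1 e2, hU', Nat.add_sub_add_right, Nat.add_min_add_right]
    by_cases h2 : i = r + 1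
    · subst h2
      have e1 : r ≠ r + 1 := by omega
      have e2 : r ≠ r + 1 + 1 := by omega
      have e3 : ¬ r + 1 < j := by omega
      obtain ⟨A, hA⟩ : ∃ A, A = b + (c - a) := ⟨_, rfl⟩
      obtain ⟨B, hB⟩ : ∃ B, B = min a c := ⟨_, rfl⟩
      obtain ⟨C, hC⟩ : ∃ C, C = b + (a - c) := ⟨_, rfl⟩
      simp only [← hA, ← hB, ← hC]
      by_cases hjr : j ≤ r <;> rcases a with _ | a <;> rcases b with _ | b <;> rcases c with _ | c <;>
        rcases A with _ | A <;> rcases B with _ | B <;> rcases C with _ | C <;>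
        first
        | (exfalso; omega)
        | (simp only [h₂.right_zero, h₂.right_succ, h₁.left_zero, h₁.left_succ, h₁.other _ e1 e2,
            h.right_zero, h.right_succ, h.left_zero, h.left_succ, h₂'.left_zero, h₂'.left_succ,
            h₁'.right_zero, h₁'.right_succ, h'.left_zero, h'.left_succ, h'.other _ e1 e2,
            hU', hjr, hlt, if_true, if_false, not_true_eq_false, if_neg e3,
            map_add, map_zero, zero_apply, add_zero, zero_add]
           try (repeat' refine congrArg₂ HAdd.hAdd ?_ ?_)
           all_goals first | rfl | exact h3 _ (by omega) (by omega) (by omega))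
    by_cases h4 : i = r + 1 + 1
    · subst h4
      have e1 : r + 1 + 1 ≠ r := by omega
      have e2 : r + 1 + 1 ≠ r + 1 := by omega
      have e3 : r ≠ r + 1 := by omega
      have e4 : r ≠ r + 1 + 1 := by omega
      obtain ⟨A, hA⟩ : ∃ A, A = b + (c - a) := ⟨_, rfl⟩
      obtain ⟨B, hB⟩ : ∃ B, B = min a c := ⟨_, rfl⟩
      obtain ⟨C, hC⟩ : ∃ C, C = b + (a - c) := ⟨_, rfl⟩
      simp only [← hA, ← hB, ← hC]
      by_cases hjr : j ≤ r <;> by_cases hjr' : j ≤ r + 1 <;> rcases a with _ | a <;>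
        rcases b with _ | b <;> rcases c with _ | c <;>
        rcases A with _ | A <;> rcases B with _ | B <;> rcases C with _ | C <;>
        first
        | (exfalso; omega)
        | (simp only [h₂.other _ e1 e2, h₁.right_zero, h₁.right_succ, h.other _ e1 e2,
            h.right_zero, h.right_succ, h₂'.right_zero, h₂'.right_succ, h₁'.other _ e1 e2,
            h₁'.right_zero, h₁'.right_succ, h'.right_zero, h'.right_succ, h'.left_zero,
            h'.left_succ, h'.other _ e3 e4, hU', hjr, hjr', hlt',
            if_true, if_false, not_true_eq_false, map_add, map_zero,
            zero_apply, add_zero, zero_add, hassoc]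
           try (repeat' refine congrArg₂ HAdd.hAdd ?_ ?_)
           all_goals first | rfl | exact h3 _ (by omega) (by omega) (by omega))
    · simp only [h₂.other _ h1 h2, h₁.other _ h2 h4, h.other _ h1 h2, h₂'.other _ h2 h4,
        h₁'.other _ h1 h2, h'.other _ h2 h4, hU']

end Braid

/-- Words related by braid moves have equivalent representations. -/
theorem Braid.ofWord_equiv {n : ℕ} {a b : List ℕ} (h : Braid a b) (ha : ∀ r ∈ a, r < n) :
    ArrayEquiv n (ofWord a).op (ofWord b).op := by
  induction h with
  | refl a => exact ArrayEquiv.of_eq fun _ _ _ _ => rfl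
  | symm h ih => exact (ih fun r hr => ha r ((h.mem_iff r).1 hr)).symm
  | trans h _ ih ih' => exact (ih ha).trans (ih' fun r hr => ha r ((h.mem_iff r).2 hr))
  | cons r h ih =>
    exact (ih fun s hs => ha s (by simp [hs])).shiftOp
      (isCrystalArray_ofWord fun s hs => ha s (by simp [hs])) (ha r (by simp))
  | comm r s a hrs =>
    exact IsShift.comm_equiv hrs (isShift_shift s (ofWord a)) (isShift_shift r _)
      (isShift_shift r (ofWord a)) (isShift_shift s _) (isCrystalArray_ofWord ha)
      (isCrystalArray_ofWord fun t ht => ha t (by simp only [List.mem_cons] at ht ⊢; tauto))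
  | braid r a =>
    exact IsShift.braid_equiv (isShift_shift r (ofWord a)) (isShift_shift (r + 1) _)
      (isShift_shift r _) (isShift_shift (r + 1) (ofWord a)) (isShift_shift r _)
      (isShift_shift (r + 1) _) (isCrystalArray_ofWord ha)
      (isCrystalArray_ofWord fun t ht => ha t (by simp only [List.mem_cons] at ht ⊢; tauto))

open OperatorArray

/-! ### Phases and the families of operators of the statement -/

section Phases

/-- The phases `τ` after they have been moved through the elementary representations of a word. -/
def permPhases (a : List ℕ) (τ : ℕ → Circle) : ℕ → Circle :=
  a.foldr (fun r σ i => σ (Equiv.swap r (r + 1) i)) τ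

/-- Phases on the rows can be moved to the left through the elementary representations of a word. -/
theorem prepend_scaleRows_equiv {n : ℕ} {a : List ℕ} (ha : ∀ r ∈ a, r < n) {Y : OperatorArray}
    (hY : IsCrystalArray n Y.op) {τ : ℕ → Circle} (hτ : ∏ k ∈ Finset.range (n + 1), τ k = 1) :
    (∏ k ∈ Finset.range (n + 1), permPhases a τ k = 1) ∧
    ArrayEquiv n (prepend a { Y with op := scaleRows τ Y.op }).op
      (scaleRows (permPhases a τ) (prepend a Y).op) := by
  induction a with
  | nil => exact ⟨hτ, ArrayEquiv.of_eq fun _ _ _ _ => rfl⟩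
  | cons r a ih =>
    obtain ⟨h1, h2⟩ := ih fun s hs => ha s (by simp [hs])
    have hr := ha r (by simp)
    have ha' : ∀ s ∈ a, s < n := fun s hs => ha s (by simp [hs])
    obtain ⟨h3, h4⟩ := shiftOp_scaleRows_equiv (isCrystalArray_prepend ha' hY) h1 hr
    exact ⟨h3, (h2.shiftOp (isCrystalArray_prepend (Y := { Y with op := scaleRows τ Y.op }) ha'
      (hY.scaleRows hτ)) hr).trans h4⟩

end Phases

section Link

variable {n : ℕ}

/-- The operators of a family, indexed by natural numbers. -/
def OperatorFamily.natOp (X : OperatorFamily n) (i j : ℕ) : X.space →L[ℂ] X.space :=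
  if h : i < n + 1 ∧ j < n + 1 then X.op ⟨i, h.1⟩ ⟨j, h.2⟩ else 0

theorem OperatorFamily.natOp_val (X : OperatorFamily n) (i j : Fin (n + 1)) :
    X.natOp i j = X.op i j := dif_pos ⟨i.2, j.2⟩

theorem OperatorFamily.natOp_of_le (X : OperatorFamily n) {i j : ℕ} (hi : i ≤ n) (hj : j ≤ n) :
    X.natOp i j = X.op ⟨i, Nat.lt_succ_of_le hi⟩ ⟨j, Nat.lt_succ_of_le hj⟩ :=
  dif_pos ⟨Nat.lt_succ_of_le hi, Nat.lt_succ_of_le hj⟩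

/-- The operators of the elementary representation `π_{s_r}`, as operators on `ℓ²(ℕ)`. -/
def elementaryOp (r : Fin n) (i j : Fin (n + 1)) : EllTwo →L[ℂ] EllTwo :=
  if i = r.castSucc ∧ j = r.castSucc then backwardShift
  else if i = r.succ ∧ j = r.succ then backwardShift.adjoint
  else if i = r.castSucc ∧ j = r.succ then vacuumProjection
  else if i = r.succ ∧ j = r.castSucc then vacuumProjection
  else if i = j then 1
  else 0

theorem elementaryOp_castSucc (r : Fin n) (k : Fin (n + 1)) : elementaryOp r r.castSucc k
    = if k = r.castSucc then backwardShift else if k = r.succ then vacuumProjection else 0 := by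
  have h : r.castSucc ≠ r.succ := by simp [Fin.ext_iff]
  by_cases h1 : k = r.castSucc
  · simp [elementaryOp, h1]
  · simp [elementaryOp, h, h1, Ne.symm h1]

theorem elementaryOp_succ (r : Fin n) (k : Fin (n + 1)) :
    elementaryOp r r.succ k = if k = r.succ then backwardShift.adjoint
      else if k = r.castSucc then vacuumProjection else 0 := by
  have h : r.castSucc ≠ r.succ := by simp [Fin.ext_iff]
  by_cases h1 : k = r.succ
  · simp [elementaryOp, h.symm, h1]
  · simp [elementaryOp, h.symm, h1, Ne.symm h1]

theorem elementaryOp_other (r : Fin n) {i : Fin (n + 1)} (h : i ≠ r.castSucc) (h' : i ≠ r.succ)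
    (k : Fin (n + 1)) : elementaryOp r i k = if k = i then 1 else 0 := by
  rw [elementaryOp, if_neg (by tauto), if_neg (by tauto), if_neg (by tauto), if_neg (by tauto)]
  simp only [eq_comm]

theorem zero_tensorOp {H K : Type*} [NormedAddCommGroup H] [InnerProductSpace ℂ H] [CompleteSpace H]
    [NormedAddCommGroup K] [InnerProductSpace ℂ K] [CompleteSpace K] (B : K →L[ℂ] K) :
    tensorOp (0 : H →L[ℂ] H) B = 0 :=
  (isTotal_tmul _ _).ext fun p => by simp [tensorOp_tmul]

/-- At most two terms of the convolution with an elementary representation are nonzero. -/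
theorem conv_elementary_op (r : Fin n) (X : OperatorFamily n) (i j : Fin (n + 1)) :
    ((OperatorFamily.elementary r).conv X).op i j = shiftOp r X.natOp i j := by
  have hsum : ((OperatorFamily.elementary r).conv X).op i j
    = ∑ k ∈ Finset.Icc (min i j) (max i j), tensorOp (elementaryOp r i k) (X.op k j) := rfl
  have hrr : r.succ ≠ r.castSucc := by simp [Fin.ext_iff]
  have hself : i ∈ Finset.Icc (min i j) (max i j) := by simp
  by_cases h1 : i = r.castSucc
  · subst h1
    have e : ∀ k, tensorOp (elementaryOp r r.castSucc k) (X.op k j)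
        = (if k = r.castSucc then tensorOp backwardShift (X.op r.castSucc j) else 0)
          + (if k = r.succ then tensorOp vacuumProjection (X.op r.succ j) else 0) := fun k => by
      rw [elementaryOp_castSucc]
      split_ifs with h h'
      · exact absurd (h'.symm.trans h) hrr
      · rw [h, add_zero]
      · rw [‹k = r.succ›, zero_add]
      · rw [zero_tensorOp, add_zero]
    rw [hsum, Finset.sum_congr rfl fun k _ => e k, Finset.sum_add_distrib, Finset.sum_ite_eq',
      Finset.sum_ite_eq', if_pos hself, Fin.val_castSucc, shiftOp_left]
    have e1 := X.natOp_val r.castSucc j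
    have e2 := X.natOp_val r.succ j
    rw [Fin.val_castSucc] at e1
    rw [Fin.val_succ] at e2
    rw [e1, e2]
    congr 1
    have hm : r.succ ∈ Finset.Icc (min r.castSucc j) (max r.castSucc j) ↔ (r : ℕ) < j := by
      rw [Finset.mem_Icc, min_le_iff, le_max_iff]
      simp only [Fin.le_def, Fin.val_castSucc, Fin.val_succ]
      omega
    simp only [hm]
    split_ifs
    · rfl
    · rw [tensorOp_zero]
  by_cases h2 : i = r.succ
  · subst h2
    have e : ∀ k, tensorOp (elementaryOp r r.succ k) (X.op k j)
        = (if k = r.succ then tensorOp backwardShift.adjoint (X.op r.succ j) else 0)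
          + (if k = r.castSucc then tensorOp vacuumProjection (X.op r.castSucc j) else 0) :=
        fun k => by
      rw [elementaryOp_succ]
      split_ifs with h h'
      · exact absurd (h.symm.trans h') hrr
      · rw [h, add_zero]
      · rw [‹k = r.castSucc›, zero_add]
      · rw [zero_tensorOp, add_zero]
    rw [hsum, Finset.sum_congr rfl fun k _ => e k, Finset.sum_add_distrib, Finset.sum_ite_eq',
      Finset.sum_ite_eq', if_pos hself, Fin.val_succ, shiftOp_right]
    have e1 := X.natOp_val r.castSucc j
    have e2 := X.natOp_val r.succ j
    rw [Fin.val_castSucc] at e1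
    rw [Fin.val_succ] at e2
    rw [e1, e2]
    congr 1
    have hm : r.castSucc ∈ Finset.Icc (min r.succ j) (max r.succ j) ↔ (j : ℕ) ≤ r := by
      rw [Finset.mem_Icc, min_le_iff, le_max_iff]
      simp only [Fin.le_def, Fin.val_castSucc, Fin.val_succ]
      omega
    simp only [hm]
    split_ifs
    · rfl
    · rw [tensorOp_zero]
  · have e : ∀ k, tensorOp (elementaryOp r i k) (X.op k j)
        = if k = i then tensorOp 1 (X.op i j) else 0 := fun k => by
      rw [elementaryOp_other r h1 h2]
      split_ifs with h
      · rw [h]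
      · rw [zero_tensorOp]
    rw [hsum, Finset.sum_congr rfl fun k _ => e k, Finset.sum_ite_eq', if_pos hself]
    refine Eq.trans ?_ (shiftOp_other (r := (r : ℕ)) X.natOp (fun h => h1 (Fin.ext h))
      (fun h => h2 (Fin.ext h)) j).symm
    rw [X.natOp_val]

/-- The family attached to a word over `Fin n` is the array of the underlying word. -/
theorem natOp_ofWord_equiv (a : List (Fin n)) :
    ArrayEquiv n (OperatorFamily.ofWord a).natOp (ofWord (a.map Fin.val)).op := by
  induction a with
  | nil =>
    refine ArrayEquiv.of_eq (H := ℂ) fun i j hi hj => ?_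
    rw [OperatorFamily.natOp_of_le _ hi hj]
    change (if (⟨i, _⟩ : Fin (n + 1)) = ⟨j, _⟩ then (1 : ℂ →L[ℂ] ℂ) else 0) = if i = j then 1 else 0
    simp only [Fin.mk.injEq]
  | cons r a ih =>
    have h1 : ArrayEquiv n (OperatorFamily.ofWord (r :: a)).natOp
        (shiftOp r (OperatorFamily.ofWord a).natOp) := by
      refine ArrayEquiv.of_eq fun i j hi hj => ?_
      rw [OperatorFamily.natOp_of_le _ hi hj]
      exact conv_elementary_op r _ ⟨i, _⟩ ⟨j, _⟩
    exact h1.trans (ih.shiftOp (ih.symm.isCrystalArray (isCrystalArray_ofWord (by simp))) r.2)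

/-- The phases on the rows given by a point of the maximal torus. -/
def torusPhase (t : Fin n → Circle) (i : ℕ) : Circle :=
  (if h : 0 < i ∧ i ≤ n then (t ⟨i - 1, by omega⟩)⁻¹ else 1) * (if h : i < n then t ⟨i, h⟩ else 1)

theorem coe_torusPhase (t : Fin n → Circle) (i : Fin (n + 1)) :
    (torusPhase t i : ℂ) = OperatorFamily.torusEntry t i := by
  have hi := i.2
  unfold torusPhase OperatorFamily.torusEntry
  rw [Circle.coe_mul]
  congr 1
  · by_cases h : 0 < (i : ℕ)
    · rw [dif_pos (by omega), dif_pos h, Circle.coe_inv_eq_conj]; rfl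
    · rw [dif_neg (by omega), dif_neg h, Circle.coe_one]
  · split_ifs <;> simp

/-- The partial products of the phases telescope. -/
theorem prod_torusPhase_lt (t : Fin n → Circle) {m : ℕ} (hm : m ≤ n) :
    ∏ k ∈ Finset.range m, torusPhase t k = if h : 0 < m then t ⟨m - 1, by omega⟩ else 1 := by
  induction m with
  | zero => simp
  | succ m ih =>
    rw [Finset.prod_range_succ, ih (by omega), torusPhase]
    rcases Nat.eq_zero_or_pos m with rfl | h
    · simp [show 0 < n by omega]
    · simp [h, show m ≤ n by omega, show m < n by omega]

theorem prod_torusPhase (t : Fin n → Circle) :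
    ∏ k ∈ Finset.range (n + 1), torusPhase t k = 1 := by
  rw [Finset.prod_range_succ, prod_torusPhase_lt t le_rfl, torusPhase]
  rcases Nat.eq_zero_or_pos n with rfl | h
  · simp
  · simp [h]

theorem torusPhase_injective {t t' : Fin n → Circle}
    (h : ∀ i ≤ n, torusPhase t i = torusPhase t' i) : t = t' := by
  funext i
  have h1 := prod_torusPhase_lt t (m := i + 1) i.2
  have h2 := prod_torusPhase_lt t' (m := i + 1) i.2
  rw [Finset.prod_congr rfl fun k hk => h k (by rw [Finset.mem_range] at hk; omega), h2] at h1
  simpa using h1.symm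

/-- Every sequence of phases with product one comes from a torus point, whose coordinates are the
partial products. -/
theorem exists_torusPhase_eq {τ : ℕ → Circle} (hτ : ∏ k ∈ Finset.range (n + 1), τ k = 1) :
    ∃ t : Fin n → Circle, ∀ i ≤ n, torusPhase t i = τ i := by
  refine ⟨fun i => ∏ k ∈ Finset.range (i + 1), τ k, fun i hi => ?_⟩
  rw [torusPhase]
  have hin : (if h : i < n then ∏ k ∈ Finset.range (i + 1), τ k else 1)
      = ∏ k ∈ Finset.range (i + 1), τ k := by
    split_ifs with h
    · rfl
    · rw [show i = n by omega, hτ]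
  rw [hin, Finset.prod_range_succ, ← mul_assoc]
  rcases Nat.eq_zero_or_pos i with rfl | h
  · simp
  · rw [dif_pos ⟨h, hi⟩]
    simp only [Nat.sub_add_cancel h, inv_mul_cancel, one_mul]

theorem isTotal_one_tmul (K : Type*) [NormedAddCommGroup K] [InnerProductSpace ℂ K] :
    IsTotal fun x : K => ((TensorProduct.tmul ℂ (1 : ℂ) x : TensorProduct ℂ ℂ K) :
      HilbertTensor ℂ K) := by
  intro V hV h
  refine isTotal_tmul ℂ K V hV fun p => ?_
  have h1 : TensorProduct.tmul ℂ p.1 p.2 = TensorProduct.tmul ℂ (1 : ℂ) (p.1 • p.2) := by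
    rw [← TensorProduct.smul_tmul, smul_eq_mul, mul_one]
  simp only [h1]
  exact h _

/-- Convolution with the character `χ_t` multiplies the rows by phases. -/
theorem natOp_ofTorusWord_equiv (t : Fin n → Circle) (a : List (Fin n)) :
    ArrayEquiv n (OperatorFamily.ofTorusWord t a).natOp
      (scaleRows (torusPhase t) (ofWord (a.map Fin.val)).op) := by
  refine ArrayEquiv.trans ?_ ((natOp_ofWord_equiv a).scaleRows (torusPhase t))
  obtain ⟨U, hU⟩ := exists_unitary_of_inner_eq (isTotal_one_tmul (OperatorFamily.ofWord a).space)
    isTotal_id fun x y => by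
      rw [UniformSpace.Completion.inner_coe, TensorProduct.inner_tmul]; simp
  refine ⟨U, fun i j hi hj v => ?_⟩
  let W : HilbertTensor ℂ (OperatorFamily.ofWord a).space →L[ℂ] (OperatorFamily.ofWord a).space :=
    U.toContinuousLinearEquiv
  have hW : ∀ x, W ((TensorProduct.tmul ℂ (1 : ℂ) x : TensorProduct ℂ ℂ _) : HilbertTensor ℂ _) = x :=
    hU
  have key : W.comp (tensorOp ((torusPhase t i : ℂ) • (1 : ℂ →L[ℂ] ℂ))
      ((OperatorFamily.ofWord a).op ⟨i, by omega⟩ ⟨j, by omega⟩))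
      = (scaleRows (torusPhase t) (OperatorFamily.ofWord a).natOp i j).comp W := by
    refine (isTotal_one_tmul _).ext fun x => ?_
    rw [scaleRows, OperatorFamily.natOp_of_le _ hi hj]
    have h2 : ∀ (c : ℂ) (y : (OperatorFamily.ofWord a).space),
        TensorProduct.tmul ℂ c y = c • TensorProduct.tmul ℂ (1 : ℂ) y := fun c y => by
      rw [TensorProduct.smul_tmul', smul_eq_mul, mul_one]
    simp only [ContinuousLinearMap.comp_apply, tensorOp_tmul, smul_apply, one_apply_eq_self,
      smul_eq_mul, mul_one]
    rw [h2, UniformSpace.Completion.coe_smul, map_smul, hW, hW]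
  have hsum : (OperatorFamily.ofTorusWord t a).op ⟨i, by omega⟩ ⟨j, by omega⟩
      = tensorOp ((torusPhase t i : ℂ) • (1 : ℂ →L[ℂ] ℂ))
        ((OperatorFamily.ofWord a).op ⟨i, by omega⟩ ⟨j, by omega⟩) := by
    have hs : (OperatorFamily.ofTorusWord t a).op ⟨i, by omega⟩ ⟨j, by omega⟩
        = ∑ k ∈ Finset.Icc (min (⟨i, by omega⟩ : Fin (n + 1)) ⟨j, by omega⟩)
            (max ⟨i, by omega⟩ ⟨j, by omega⟩),
          tensorOp (if (⟨i, by omega⟩ : Fin (n + 1)) = k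
              then OperatorFamily.torusEntry t ⟨i, by omega⟩ • (1 : ℂ →L[ℂ] ℂ) else 0)
            ((OperatorFamily.ofWord a).op k ⟨j, by omega⟩) := rfl
    rw [hs, Finset.sum_eq_single (⟨i, by omega⟩ : Fin (n + 1))]
    · rw [if_pos rfl, ← coe_torusPhase t ⟨i, by omega⟩]
    · intro k _ hk
      rw [if_neg hk.symm, zero_tensorOp]
    · intro h
      exact absurd (by simp) h
  rw [OperatorFamily.natOp_of_le _ hi hj, hsum]
  exact congrArg (fun f => f v) key

end Link

/-! ### The last column of a crystal array -/

section Column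

variable {B : Type*} [Ring B] [StarRing B] {n : ℕ} {z : ℕ → ℕ → B}

/-- The sum of the range projections of the first entries of the last column. -/
def lastProj (n : ℕ) (z : ℕ → ℕ → B) (l : ℕ) : B :=
  ∑ m ∈ Finset.range (l + 1), z m n * star (z m n)

theorem lastProj_succ (l : ℕ) : lastProj n z (l + 1)
    = lastProj n z l + z (l + 1) n * star (z (l + 1) n) := Finset.sum_range_succ _ _

theorem lastProj_eq_of_zero {k : ℕ} (h : ∀ i, i < k → z i n = 0) :
    lastProj n z k = z k n * star (z k n) := by
  rw [lastProj, Finset.sum_range_succ, Finset.sum_eq_zero, zero_add]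
  intro m hm
  rw [Finset.mem_range] at hm
  rw [h m hm, zero_mul]

namespace IsCrystalArray

theorem mul_last_far (hz : IsCrystalArray n z) {i j l : ℕ} (hji : j ≤ i) (hj : j < n)
    (hil : i + 1 < l) (hl : l ≤ n) : z i j * z l n = z l n * z i j :=
  hz.diag_far i l j n hl le_rfl (by omega) hj (by omega)

theorem mul_last_below (hz : IsCrystalArray n z) {i j l : ℕ} (hi : i ≤ n) (hj : j < n)
    (hil : l < i) : z i j * z l n = z l n * z i j :=
  (hz.anti_comm l i j n hi le_rfl hil hj).symm

theorem mul_last_succ (hz : IsCrystalArray n z) {i j : ℕ} (hji : j ≤ i) (hj : j < n) (hi : i < n) :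
    z i j * z (i + 1) n = z (i + 1) n * z i j + z i n * z (i + 1) j := by
  rw [← hz.diag_adjacent i (i + 1) j n hi le_rfl (Nat.lt_succ_self i) hj (by omega)]
  abel

theorem mul_last_self (hz : IsCrystalArray n z) {i j : ℕ} (hi : i ≤ n) (hj : j < n) :
    z i j * z i n = 0 := hz.row i j n hi le_rfl hj

theorem diag_mul_last (hz : IsCrystalArray n z) {i m : ℕ} (hi : i < n) (hm : m ≤ i) :
    z i i * z m n = 0 := by
  rcases Nat.eq_or_lt_of_le hm with rfl | hm
  · exact hz.row m m n hi.le le_rfl hi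
  · rw [hz.mul_last_below hi.le hi hm]
    exact hz.anti_zero m i i n hi.le le_rfl hm hi (by omega)

/-- The entries outside row `k` commute with the entry of the last column in row `k` if this is the
first nonzero one. -/
theorem mul_last_of_zero (hz : IsCrystalArray n z) {i j k : ℕ} (h : ∀ i, i < k → z i n = 0)
    (hk : k ≤ n) (hji : j ≤ i) (hi : i ≤ n) (hj : j < n) (hik : i ≠ k) :
    z i j * z k n = z k n * z i j := by
  by_cases h1 : k = i + 1
  · subst h1
    rw [hz.mul_last_succ hji hj (by omega), h i (Nat.lt_succ_self i), zero_mul, add_zero]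
  rcases Nat.lt_or_ge k i with h2 | h2
  · exact hz.mul_last_below hi hj h2
  · exact hz.mul_last_far hji hj (by omega) hk

/-- The adjoint of an entry of the last column is a product of diagonal and subdiagonal entries. -/
theorem star_last (hz : IsCrystalArray n z) {l m : ℕ} (h : n = l + m) : star (z l n)
    = (rangeProd l fun k => z k k) * rangeProd m fun k => z (l + k + 1) (l + k) := by
  have e : rangeProd n (fun k => z (skip l k) (skip n k))
      = rangeProd n fun k => z (skip l k) k := rangeProd_congr fun k hk => by
    rw [skip, skip, if_pos hk]
  rw [hz.star_eq l n (by omega) le_rfl, e]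
  conv_lhs => rw [h]
  rw [rangeProd_add]
  congr 1
  · exact rangeProd_congr fun k hk => by rw [skip, if_pos hk]
  · exact rangeProd_congr fun k hk => by rw [skip, if_neg (by omega)]

theorem commute_subdiag (hz : IsCrystalArray n z) {l p m : ℕ} (h : n = p + m) (hl : l ≤ p) :
    Commute (z l n) (rangeProd m fun k => z (p + k + 1) (p + k)) :=
  commute_rangeProd fun k hk => (hz.mul_last_below (i := p + k + 1) (by omega) (by omega)
    (by omega)).symm

/-- The entries of the last column have orthogonal ranges. -/
theorem star_last_mul_last_of_ne (hz : IsCrystalArray n z) {l m : ℕ} (hl : l ≤ n) (hm : m ≤ n)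
    (h : l ≠ m) : star (z l n) * z m n = 0 := by
  obtain ⟨p, hp⟩ : ∃ p, n = l + p := ⟨n - l, by omega⟩
  rw [hz.star_last hp]
  rcases Nat.lt_or_ge m l with hml | hml
  · rw [mul_assoc, ← (hz.commute_subdiag hp hml.le).eq, ← mul_assoc]
    obtain ⟨l, rfl⟩ : ∃ l', l = l' + 1 := ⟨l - 1, by omega⟩
    rw [rangeProd_succ, mul_assoc _ (z l l), hz.diag_mul_last (by omega) (by omega), mul_zero,
      zero_mul]
  · obtain ⟨q, rfl⟩ : ∃ q, m = l + q + 1 := ⟨m - l - 1, by omega⟩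
    obtain ⟨s, rfl⟩ : ∃ s, p = q + 1 + s := ⟨p - q - 1, by omega⟩
    rw [rangeProd_add, rangeProd_succ]
    have e : (rangeProd s fun i => z (l + (q + 1 + i) + 1) (l + (q + 1 + i)))
        = rangeProd s fun k => z (l + q + 1 + k + 1) (l + q + 1 + k) :=
      rangeProd_congr fun k _ => by congr 1 <;> omega
    rw [e]
    simp only [mul_assoc]
    rw [← (hz.commute_subdiag (p := l + q + 1) (m := s) (by omega) le_rfl).eq,
      ← mul_assoc (z (l + q + 1) (l + q)), hz.mul_last_self (by omega) (by omega)]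
    simp

/-- The initial projection of `z l n` is the sum of the range projections of the entries of the last
column in the rows up to `l`. -/
theorem star_last_mul_last (hz : IsCrystalArray n z) {l : ℕ} (hl : l ≤ n) :
    star (z l n) * z l n = lastProj n z l := by
  have key : ∀ l m, n = l + m → (rangeProd l fun k => z k k) * z l n
      * (rangeProd m fun k => z (l + k + 1) (l + k)) = lastProj n z l := by
    intro l
    induction l with
    | zero =>
      intro m h
      rw [lastProj, Finset.sum_range_one, hz.star_last h]
      simp
    | succ l ih =>
      intro m h
      have e : (rangeProd (m + 1) fun k => z (l + k + 1) (l + k))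
          = z (l + 1) l * rangeProd m fun k => z (l + 1 + k + 1) (l + 1 + k) := by
        rw [rangeProd_succ']
        congr 1
        exact rangeProd_congr fun k _ => by congr 1 <;> omega
      have hc : Commute (z (l + 1) n) (rangeProd l fun k => z k k) :=
        commute_rangeProd fun k hk =>
          (hz.mul_last_far (i := k) le_rfl (by omega) (by omega) (by omega)).symm
      rw [lastProj_succ, ← ih (m + 1) (by omega), hz.star_last h, rangeProd_succ, e,
        mul_assoc _ (z l l), hz.mul_last_succ le_rfl (by omega) (by omega)]
      simp only [mul_add, add_mul, ← mul_assoc]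
      rw [hc.eq]
      abel
  obtain ⟨m, hm⟩ : ∃ m, n = l + m := ⟨n - l, by omega⟩
  rw [← key l m hm, hz.star_last hm, mul_assoc, mul_assoc, (hz.commute_subdiag hm le_rfl).eq]

theorem lastProj_last (hz : IsCrystalArray n z) : lastProj n z n = 1 := by
  rw [← hz.star_last_mul_last le_rfl, hz.star_last (Nat.add_zero n).symm, ← hz.det_one,
    rangeProd_succ, rangeProd_zero, mul_one]

/-- The entries of the last column are partial isometries. -/
theorem last_mul_star_mul_last (hz : IsCrystalArray n z) {l : ℕ} (hl : l ≤ n) :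
    z l n * (star (z l n) * z l n) = z l n := by
  have h : lastProj n z n * z l n = z l n := by rw [hz.lastProj_last, one_mul]
  rw [lastProj, Finset.sum_mul, Finset.sum_eq_single l] at h
  · rwa [mul_assoc] at h
  · intro m hm hml
    rw [mul_assoc, hz.star_last_mul_last_of_ne (by rw [Finset.mem_range] at hm; omega) hl hml,
      mul_zero]
  · intro h
    simp only [Finset.mem_range] at h
    omega

theorem lastProj_mul_last (hz : IsCrystalArray n z) {l m : ℕ} (hml : m ≤ l) (hl : l ≤ n) :
    lastProj n z l * z m n = z m n := by
  rw [lastProj, Finset.sum_mul, Finset.sum_eq_single m]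
  · rw [mul_assoc, hz.last_mul_star_mul_last (by omega)]
  · intro p hp hpm
    rw [mul_assoc, hz.star_last_mul_last_of_ne (by rw [Finset.mem_range] at hp; omega) (by omega)
      hpm, mul_zero]
  · intro h
    simp only [Finset.mem_range] at h
    omega

theorem lastProj_mul_lastProj (hz : IsCrystalArray n z) {l m : ℕ} (hml : m ≤ l) (hl : l ≤ n) :
    lastProj n z l * lastProj n z m = lastProj n z m := by
  rw [show lastProj n z m = ∑ p ∈ Finset.range (m + 1), z p n * star (z p n) from rfl,
    Finset.mul_sum]
  refine Finset.sum_congr rfl fun p hp => ?_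
  rw [Finset.mem_range] at hp
  rw [← mul_assoc, hz.lastProj_mul_last (by omega) hl]

/-- The ranges of the entries of the last column span the whole space, which reduces products
`star x * z l n` to the products of `x` with the entries of the last column. -/
theorem star_mul_last_sum (hz : IsCrystalArray n z) (x : B) (l : ℕ) :
    star x * z l n = ∑ m ∈ Finset.range (n + 1), z m n * (star (x * z m n) * z l n) := by
  have h := hz.lastProj_last
  calc star x * z l n = lastProj n z n * (star x * z l n) := by rw [h, one_mul]
    _ = _ := by
      rw [lastProj, Finset.sum_mul]
      exact Finset.sum_congr rfl fun m _ => by rw [star_mul]; simp only [mul_assoc]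

/-- The adjoints of the lower entries outside row `l` commute with `z l n` on the support of
`z l n`. -/
theorem star_mul_last_of_ne (hz : IsCrystalArray n z) {i j l : ℕ} (hji : j ≤ i) (hj : j < n)
    (hi : i ≤ n) (hl : l ≤ n) (hli : l ≠ i) :
    star (z i j) * z l n = z l n * (star (z i j) * lastProj n z l) := by
  rw [hz.star_mul_last_sum, Finset.sum_eq_single l]
  · by_cases h1 : l = i + 1
    · subst h1
      rw [hz.mul_last_succ hji hj (by omega), star_add, star_mul, star_mul, add_mul, mul_assoc,
        hz.star_last_mul_last hl, mul_assoc, hz.star_last_mul_last_of_ne hi hl (by omega), mul_zero,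
        add_zero]
    · have e : z i j * z l n = z l n * z i j := by
        rcases Nat.lt_or_ge l i with h | h
        · exact hz.mul_last_below hi hj h
        · exact hz.mul_last_far hji hj (by omega) hl
      rw [e, star_mul, mul_assoc, hz.star_last_mul_last hl]
  · intro m hm hml
    rw [Finset.mem_range] at hm
    by_cases h0 : m = i
    · rw [h0, hz.mul_last_self hi hj, star_zero, zero_mul, mul_zero]
    by_cases h1 : m = i + 1
    · subst h1
      rw [hz.mul_last_succ hji hj (by omega), star_add, star_mul, star_mul, add_mul, mul_assoc,
        hz.star_last_mul_last_of_ne (by omega) hl hml.symm.symm, mul_assoc,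
        hz.star_last_mul_last_of_ne hi hl hli.symm]
      simp
    · have e : z i j * z m n = z m n * z i j := by
        rcases Nat.lt_or_ge m i with h | h
        · exact hz.mul_last_below hi hj h
        · exact hz.mul_last_far hji hj (by omega) (by omega)
      rw [e, star_mul, mul_assoc, hz.star_last_mul_last_of_ne (by omega) hl hml]
      simp
  · intro h
    simp only [Finset.mem_range] at h
    omega

/-- The adjoint of an entry in row `i` exchanges a factor `z i n` for a factor `z (i + 1) n`. -/
theorem star_mul_last_self (hz : IsCrystalArray n z) {i j : ℕ} (hji : j ≤ i) (hj : j < n)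
    (hi : i < n) :
    star (z i j) * z i n = z (i + 1) n * (star (z (i + 1) j) * lastProj n z i) := by
  rw [hz.star_mul_last_sum, Finset.sum_eq_single (i + 1)]
  · rw [hz.mul_last_succ hji hj hi, star_add, star_mul, star_mul, add_mul, mul_assoc,
      hz.star_last_mul_last_of_ne (by omega) hi.le (by omega), mul_assoc,
      hz.star_last_mul_last hi.le, mul_zero, zero_add]
  · intro m hm hml
    rw [Finset.mem_range] at hm
    by_cases h0 : m = i
    · rw [h0, hz.mul_last_self hi.le hj, star_zero, zero_mul, mul_zero]
    · have e : z i j * z m n = z m n * z i j := by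
        rcases Nat.lt_or_ge m i with h | h
        · exact hz.mul_last_below hi.le hj h
        · exact hz.mul_last_far hji hj (by omega) (by omega)
      rw [e, star_mul, mul_assoc, hz.star_last_mul_last_of_ne (by omega) hi.le h0]
      simp
  · intro h
    simp only [Finset.mem_range] at h
    omega

theorem star_mul_last_last (hz : IsCrystalArray n z) {j : ℕ} (hj : j < n) :
    star (z n j) * z n n = 0 := by
  rw [hz.star_mul_last_sum]
  refine Finset.sum_eq_zero fun m hm => ?_
  rw [Finset.mem_range] at hm
  rcases Nat.eq_or_lt_of_le (Nat.lt_succ_iff.1 hm) with rfl | h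
  · rw [hz.mul_last_self le_rfl hj, star_zero, zero_mul, mul_zero]
  · rw [hz.mul_last_below le_rfl hj h, star_mul, mul_assoc,
      hz.star_last_mul_last_of_ne h.le le_rfl h.ne]
    simp

theorem last_mul_last (hz : IsCrystalArray n z) {i l : ℕ} (hl : l ≤ n) (h : i < l) :
    z i n * z l n = 0 := hz.col i l n hl le_rfl h

end IsCrystalArray

end Column

/-! ### Fock vectors -/

section FockVector

variable {M : Type*} [AddCommGroup M] [Module ℂ M]

/-- The vectors obtained from a set `X` of vacuum vectors by applying creation operators `R l`,
`k < l ≤ n`, with indices increasing from right to left. The index `l` is an upper bound for the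
indices that occur. -/
inductive FockVector (n k : ℕ) (R : ℕ → M →ₗ[ℂ] M) (X : Submodule ℂ M) : ℕ → M → Prop
  | vac {x : M} : x ∈ X → FockVector n k R X k x
  | up {l : ℕ} {x : M} : FockVector n k R X l x → l < n → FockVector n k R X (l + 1) x
  | cre {l : ℕ} {x : M} : FockVector n k R X l x → k < l → FockVector n k R X l (R l x)

/-- The span of the Fock vectors of level at most `l`. -/
def fockSpan (n k : ℕ) (R : ℕ → M →ₗ[ℂ] M) (X : Submodule ℂ M) (l : ℕ) : Submodule ℂ M :=
  Submodule.span ℂ {x | FockVector n k R X l x}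

variable {n k : ℕ} {R : ℕ → M →ₗ[ℂ] M} {X : Submodule ℂ M}

theorem FockVector.mem_fockSpan {l : ℕ} {x : M} (h : FockVector n k R X l x) :
    x ∈ fockSpan n k R X l := Submodule.subset_span h

theorem FockVector.le {l : ℕ} {x : M} (h : FockVector n k R X l x) : k ≤ l := by
  induction h <;> omega

theorem FockVector.le_max {l : ℕ} {x : M} (h : FockVector n k R X l x) (hk : k ≤ n) : l ≤ n := by
  induction h <;> omega

theorem FockVector.mem_of_eq {l : ℕ} {x : M} (h : FockVector n k R X l x) (hl : l = k) : x ∈ X := by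
  induction h with
  | vac h => exact h
  | up h _ _ => have := h.le; omega
  | cre _ h _ => omega

theorem FockVector.mono {l l' : ℕ} {x : M} (h : FockVector n k R X l x) (hl : l ≤ l')
    (hl' : l' ≤ n) : FockVector n k R X l' x := by
  induction l', hl using Nat.le_induction with
  | base => exact h
  | succ m _ ih => exact (ih (by omega)).up (by omega)

theorem fockSpan_mono {l l' : ℕ} (hl : l ≤ l') (hl' : l' ≤ n) :
    fockSpan n k R X l ≤ fockSpan n k R X l' :=
  Submodule.span_mono fun _ h => FockVector.mono h hl hl'

theorem cre_mem_fockSpan {l : ℕ} (h : k < l) {x : M} (hx : x ∈ fockSpan n k R X l) :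
    R l x ∈ fockSpan n k R X l := by
  have : fockSpan n k R X l ≤ (fockSpan n k R X l).comap (R l) :=
    Submodule.span_le.2 fun _ hy => (FockVector.cre hy h).mem_fockSpan
  exact this hx

/-- The commutation relations between the lower entries `z i j` (with `j < n`) and the last column
`R` of a crystal array whose first nonzero entry in the last column is in row `k`, together with
invariance of the space `X` of vacuum vectors. -/
structure IsFockSystem (n k : ℕ) (z : ℕ → ℕ → M →ₗ[ℂ] M) (R : ℕ → M →ₗ[ℂ] M)
    (X : Submodule ℂ M) : Prop where
  far : ∀ i j l x, j ≤ i → j < n → i + 1 < l → l ≤ n → z i j (R l x) = R l (z i j x)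
  below : ∀ i j l x, i ≤ n → j < n → l < i → z i j (R l x) = R l (z i j x)
  succ : ∀ i j x, j ≤ i → j < n → i < n →
    z i j (R (i + 1) x) = R (i + 1) (z i j x) + R i (z (i + 1) j x)
  self : ∀ i j x, i ≤ n → j < n → z i j (R i x) = 0
  cre_cre : ∀ i l x, i < l → l ≤ n → R i (R l x) = 0
  zero : ∀ i x, i < k → R i x = 0
  mem : ∀ i j x, j ≤ i → i ≤ n → j < n → x ∈ X → z i j x ∈ X
  cre_mem : ∀ x, x ∈ X → R k x ∈ X

namespace IsFockSystem

variable {z : ℕ → ℕ → M →ₗ[ℂ] M}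

theorem fockVector_apply (h : IsFockSystem n k z R X) {l : ℕ} {x : M}
    (hx : FockVector n k R X l x) {i j : ℕ} (hli : l < i) (hi : i ≤ n) (hji : j ≤ i) (hj : j < n) :
    FockVector n k R X l (z i j x) := by
  induction hx with
  | vac hx => exact .vac (h.mem i j _ hji hi hj hx)
  | up _ h' ih => exact (ih (by omega)).up h'
  | @cre l x _ hk ih =>
    rw [h.below i j l x hi hj hli]
    exact (ih hli).cre hk

/-- The term `R i (z (i + 1) j x)` in the relation `IsFockSystem.succ` stays in the span of the
Fock vectors of the same level: `z l j` annihilates Fock vectors that start with `R l`, and does not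
raise the level of the others. -/
theorem cre_apply_mem (h : IsFockSystem n k z R X) {l : ℕ} {x : M}
    (hx : FockVector n k R X l x) {i j : ℕ} (hil : i + 1 = l) (hl : l ≤ n) (hji : j ≤ l)
    (hj : j < n) : R i (z l j x) ∈ fockSpan n k R X l := by
  induction hx with
  | vac hx => rw [h.zero i _ (by omega)]; exact Submodule.zero_mem _
  | @up l x hx h' ih =>
    obtain rfl : i = l := by omega
    have h1 := h.fockVector_apply hx (Nat.lt_succ_self i) hl hji hj
    rcases Nat.eq_or_lt_of_le hx.le with hk | hk
    · have h2 := h.cre_mem _ (h1.mem_of_eq hk.symm)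
      rw [hk] at h2
      exact (FockVector.mono (.vac h2) (by omega) (by omega)).mem_fockSpan
    · exact ((h1.cre hk).up h').mem_fockSpan
  | @cre l x _ hk ih =>
    rw [h.self l j x hl hj, map_zero]
    exact Submodule.zero_mem _

theorem apply_mem_of_fockVector (h : IsFockSystem n k z R X) (hkn : k ≤ n) {l : ℕ} {x : M}
    (hx : FockVector n k R X l x) {i j : ℕ} (hi : i ≤ n) (hji : j ≤ i) (hj : j < n) :
    z i j x ∈ fockSpan n k R X l := by
  induction hx with
  | vac hx => exact (FockVector.vac (h.mem i j _ hji hi hj hx)).mem_fockSpan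
  | up _ h' ih => exact fockSpan_mono (Nat.le_succ _) h' ih
  | @cre l x hx hk ih =>
    have hl := hx.le_max hkn
    rcases lt_trichotomy l (i + 1) with h1 | h1 | h1
    · rcases Nat.eq_or_lt_of_le (Nat.lt_succ_iff.1 h1) with rfl | h2
      · rw [h.self l j x hi hj]
        exact Submodule.zero_mem _
      · rw [h.below i j l x hi hj h2]
        exact cre_mem_fockSpan hk ih
    · subst h1
      rw [h.succ i j x hji hj (by omega)]
      exact Submodule.add_mem _ (cre_mem_fockSpan hk ih)
        (h.cre_apply_mem hx rfl hl (by omega) hj)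
    · rw [h.far i j l x hji hj h1 hl]
      exact cre_mem_fockSpan hk ih

/-- The span of the Fock vectors is invariant under the lower entries of the array. -/
theorem apply_mem (h : IsFockSystem n k z R X) (hkn : k ≤ n) {i j : ℕ} (hi : i ≤ n) (hji : j ≤ i)
    (hj : j < n) {x : M} (hx : x ∈ fockSpan n k R X n) : z i j x ∈ fockSpan n k R X n := by
  have : fockSpan n k R X n ≤ (fockSpan n k R X n).comap (z i j) :=
    Submodule.span_le.2 fun y hy => h.apply_mem_of_fockVector hkn hy hi hji hj
  exact this hx

theorem last_mem (h : IsFockSystem n k z R X) (hkn : k ≤ n) {x : M}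
    (hx : x ∈ fockSpan n k R X n) : R n x ∈ fockSpan n k R X n := by
  rcases Nat.eq_or_lt_of_le hkn with hk | hk
  · subst hk
    have : fockSpan k k R X k ≤ (fockSpan k k R X k).comap (R k) :=
      Submodule.span_le.2 fun y (hy : FockVector k k R X k y) =>
        (FockVector.vac (h.cre_mem _ (hy.mem_of_eq rfl))).mem_fockSpan
    exact this hx
  · exact cre_mem_fockSpan hk hx

/-- The span of the Fock vectors is invariant under all creation operators. -/
theorem cre_mem_fockSpan_top (h : IsFockSystem n k z R X) (hkn : k ≤ n) {i : ℕ} (hki : k < i)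
    (hi : i ≤ n) {x : M} (hx : x ∈ fockSpan n k R X n) : R i x ∈ fockSpan n k R X n := by
  have key : ∀ l x, FockVector n k R X l x → R i x ∈ fockSpan n k R X n := by
    intro l x hx
    induction hx with
    | vac hx =>
      exact (FockVector.mono ((FockVector.mono (.vac hx) hki.le hi).cre hki) hi le_rfl).mem_fockSpan
    | up _ _ ih => exact ih
    | @cre l x hx hk ih =>
      rcases Nat.lt_or_ge i l with hil | hil
      · rw [h.cre_cre i l x hil (hx.le_max hkn)]
        exact Submodule.zero_mem _
      · exact (FockVector.mono (((hx.cre hk).mono hil hi).cre hki) hi le_rfl).mem_fockSpan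
  have : fockSpan n k R X n ≤ (fockSpan n k R X n).comap (R i) :=
    Submodule.span_le.2 fun y hy => key n y hy
  exact this hx

end IsFockSystem

end FockVector

section FockArray

variable {H : Type*} [NormedAddCommGroup H] [InnerProductSpace ℂ H] [CompleteSpace H] {n k : ℕ}
  {z : ℕ → ℕ → H →L[ℂ] H} {X : Submodule ℂ H}

/-- A space `X` of vacuum vectors for a crystal array: it reduces the lower entries outside row `k`,
and the first nonzero entry of the last column, in row `k`, restricts to a unitary operator on it. -/
structure IsVacuum (n k : ℕ) (z : ℕ → ℕ → H →L[ℂ] H) (X : Submodule ℂ H) : Prop where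
  le : k ≤ n
  zero : ∀ i, i < k → z i n = 0
  mem : ∀ i j x, j ≤ i → i ≤ n → j < n → i ≠ k → x ∈ X → z i j x ∈ X
  star_mem : ∀ i j x, j ≤ i → i ≤ n → j < n → i ≠ k → x ∈ X → star (z i j) x ∈ X
  cre_mem : ∀ x, x ∈ X → z k n x ∈ X
  star_cre_mem : ∀ x, x ∈ X → star (z k n) x ∈ X
  mul_star : ∀ x, x ∈ X → z k n (star (z k n) x) = x

theorem IsVacuum.isFockSystem (h : IsVacuum n k z X) (hz : IsCrystalArray n z) :
    IsFockSystem n k (fun i j => (z i j : H →ₗ[ℂ] H)) (fun l => (z l n : H →ₗ[ℂ] H)) X where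
  far i j l x h1 h2 h3 h4 := congrArg (fun f => f x) (hz.mul_last_far h1 h2 h3 h4)
  below i j l x h1 h2 h3 := congrArg (fun f => f x) (hz.mul_last_below h1 h2 h3)
  succ i j x h1 h2 h3 := congrArg (fun f => f x) (hz.mul_last_succ h1 h2 h3)
  self i j x h1 h2 := congrArg (fun f => f x) (hz.mul_last_self h1 h2)
  cre_cre i l x h1 h2 := congrArg (fun f => f x) (hz.last_mul_last h2 h1)
  zero i x h1 := by simp [h.zero i h1]
  mem i j x h1 h2 h3 hx := by
    by_cases hik : i = k
    · subst hik
      have e : z i j (z i n (star (z i n) x)) = 0 :=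
        congrArg (fun f => f (star (z i n) x)) (hz.mul_last_self h2 h3)
      rw [h.mul_star x hx] at e
      simp [e]
    · exact h.mem i j x h1 h2 h3 hik hx
  cre_mem := h.cre_mem

/-- The span of the Fock vectors of an array of operators. -/
abbrev arrayFockSpan (n k : ℕ) (z : ℕ → ℕ → H →L[ℂ] H) (X : Submodule ℂ H) (l : ℕ) :
    Submodule ℂ H := fockSpan n k (fun l => (z l n : H →ₗ[ℂ] H)) X l

/-- The Fock vectors of an array of operators, with the entries of the last column as creation
operators. -/
abbrev ArrayFockVector (n k : ℕ) (z : ℕ → ℕ → H →L[ℂ] H) (X : Submodule ℂ H) (l : ℕ) (x : H) :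
    Prop := FockVector n k (fun l => (z l n : H →ₗ[ℂ] H)) X l x

/-- Fock vectors of level `l` lie in the support of `z l n`. -/
theorem IsCrystalArray.lastProj_apply_of_fockVector (hz : IsCrystalArray n z) (hk : k ≤ n)
    (hX : ∀ x ∈ X, lastProj n z k x = x) {l : ℕ} {x : H} (hx : ArrayFockVector n k z X l x) :
    lastProj n z l x = x := by
  induction hx with
  | vac hx => exact hX _ hx
  | @up l x _ hl ih =>
    have e := hz.lastProj_mul_lastProj (Nat.le_succ l) hl
    have e' := congrArg (fun f => f x) e
    simp only [mul_apply_eq_comp, ih] at e'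
    exact e'
  | @cre l x hx hk' ih =>
    exact congrArg (fun f => f x) (hz.lastProj_mul_last le_rfl (hx.le_max hk))

theorem IsVacuum.lastProj_apply (h : IsVacuum n k z X) (hz : IsCrystalArray n z) {l : ℕ} {x : H}
    (hx : ArrayFockVector n k z X l x) : lastProj n z l x = x :=
  hz.lastProj_apply_of_fockVector h.le (fun x hx => by
    rw [lastProj_eq_of_zero h.zero]; exact h.mul_star x hx) hx

/-- The adjoint of a lower entry in row `i` does not raise the level of a Fock vector, except that
it may raise the level `i` to `i + 1`. -/
theorem IsVacuum.star_apply_mem_of_fockVector (h : IsVacuum n k z X) (hz : IsCrystalArray n z)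
    {l : ℕ} {x : H} (hx : ArrayFockVector n k z X l x) {i j l' : ℕ} (hi : i ≤ n) (hji : j ≤ i)
    (hj : j < n) (hl : l ≤ l') (hl' : l' ≤ n) (hil : i = l → i < n → l < l') :
    star (z i j) x ∈ arrayFockSpan n k z X l' := by
  induction hx generalizing i l' with
  | @vac x hx =>
    by_cases hik : i = k
    · subst hik
      rw [← h.mul_star x hx]
      rcases Nat.eq_or_lt_of_le hi with rfl | hin
      · have e := congrArg (fun f => f (star (z i i) x)) (hz.star_mul_last_last hj)
        simp only [mul_apply_eq_comp] at e
        rw [e]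
        exact Submodule.zero_mem _
      · have e := congrArg (fun f => f (star (z i n) x)) (hz.star_mul_last_self hji hj hin)
        simp only [mul_apply_eq_comp] at e
        have hx' := h.star_cre_mem x hx
        rw [e, h.lastProj_apply hz (.vac hx')]
        have h1 := h.star_mem (i + 1) j _ (by omega) hin hj (by omega) hx'
        have h2 : ArrayFockVector n i z X (i + 1) _ := (FockVector.vac h1).up hin
        exact fockSpan_mono (hil rfl hin) hl' (h2.cre (Nat.lt_succ_self i)).mem_fockSpan
    · exact fockSpan_mono hl hl' (FockVector.vac (h.star_mem i j x hji hi hj hik hx)).mem_fockSpan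
  | @up l x hx hln ih => exact ih hi hji (by omega) hl' (by omega)
  | @cre l x hx hk ih =>
    have hln := hx.le_max h.le
    by_cases hil' : i = l
    · subst hil'
      rcases Nat.eq_or_lt_of_le hi with rfl | hin
      · have e := congrArg (fun f => f x) (hz.star_mul_last_last hj)
        simp only [mul_apply_eq_comp] at e
        simp only [ContinuousLinearMap.coe_coe]
        rw [e]
        exact Submodule.zero_mem _
      · have e := congrArg (fun f => f x) (hz.star_mul_last_self hji hj hin)
        simp only [mul_apply_eq_comp] at e
        simp only [ContinuousLinearMap.coe_coe]
        rw [e, h.lastProj_apply hz hx]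
        have h1 := ih (i := i + 1) (l' := i) hin (by omega) le_rfl hln (by omega)
        exact fockSpan_mono (hil rfl hin) hl' (cre_mem_fockSpan (by omega)
          (fockSpan_mono (Nat.le_succ i) hin h1))
    · have e := congrArg (fun f => f x) (hz.star_mul_last_of_ne hji hj hi hln (Ne.symm hil'))
      simp only [mul_apply_eq_comp] at e
      simp only [ContinuousLinearMap.coe_coe]
      rw [e, h.lastProj_apply hz hx]
      exact fockSpan_mono hl hl' (cre_mem_fockSpan hk (ih hi hji le_rfl hln (by omega)))

theorem IsVacuum.star_apply_mem (h : IsVacuum n k z X) (hz : IsCrystalArray n z) {i j : ℕ}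
    (hi : i ≤ n) (hji : j ≤ i) (hj : j < n) {x : H} (hx : x ∈ arrayFockSpan n k z X n) :
    star (z i j) x ∈ arrayFockSpan n k z X n := by
  have : arrayFockSpan n k z X n ≤ (arrayFockSpan n k z X n).comap
      (star (z i j) : H →L[ℂ] H).toLinearMap := Submodule.span_le.2 fun y hy =>
    h.star_apply_mem_of_fockVector hz hy hi hji hj le_rfl le_rfl (by omega)
  exact this hx

theorem IsVacuum.star_last_mem_of_fockVector (h : IsVacuum n k z X) (hz : IsCrystalArray n z)
    {l : ℕ} {x : H} (hx : ArrayFockVector n k z X l x) :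
    star (z n n) x ∈ arrayFockSpan n k z X n := by
  induction hx with
  | @vac x hx =>
    rcases Nat.eq_or_lt_of_le h.le with rfl | hk
    · exact (FockVector.vac (h.star_cre_mem x hx)).mem_fockSpan
    · have e := congrArg (fun f => f (star (z k n) x))
        (hz.star_last_mul_last_of_ne le_rfl h.le hk.ne')
      simp only [mul_apply_eq_comp] at e
      rw [h.mul_star x hx] at e
      rw [e]
      exact Submodule.zero_mem _
  | up _ _ ih => exact ih
  | @cre l x hx hk ih =>
    have hln := hx.le_max h.le
    simp only [ContinuousLinearMap.coe_coe]
    rcases Nat.eq_or_lt_of_le hln with rfl | hl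
    · have e := congrArg (fun f => f x) (hz.star_last_mul_last le_rfl)
      simp only [mul_apply_eq_comp] at e
      rw [e, h.lastProj_apply hz hx]
      exact hx.mem_fockSpan
    · have e := congrArg (fun f => f x) (hz.star_last_mul_last_of_ne le_rfl hln hl.ne')
      simp only [mul_apply_eq_comp] at e
      rw [e]
      exact Submodule.zero_mem _

theorem IsVacuum.star_last_mem (h : IsVacuum n k z X) (hz : IsCrystalArray n z) {x : H}
    (hx : x ∈ arrayFockSpan n k z X n) : star (z n n) x ∈ arrayFockSpan n k z X n := by
  have : arrayFockSpan n k z X n ≤ (arrayFockSpan n k z X n).comap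
      (star (z n n) : H →L[ℂ] H).toLinearMap := Submodule.span_le.2 fun y hy =>
    h.star_last_mem_of_fockVector hz hy
  exact this hx

theorem star_rangeProd_apply_mem {V : Submodule ℂ H} {m : ℕ} {f : ℕ → H →L[ℂ] H}
    (h : ∀ k < m, ∀ x ∈ V, star (f k) x ∈ V) {x : H} (hx : x ∈ V) :
    star (rangeProd m f) x ∈ V := by
  induction m with
  | zero => simpa using hx
  | succ m ih =>
    rw [rangeProd_succ, star_mul, mul_apply_eq_comp]
    exact h m (Nat.lt_succ_self m) _ (ih fun k hk => h k (by omega))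

/-- The lower entries of a crystal array generate it as a self-adjoint family. -/
theorem IsCrystalArray.apply_mem_of_lower (hz : IsCrystalArray n z) {V : Submodule ℂ H}
    (h : ∀ i j x, i ≤ n → j ≤ i → x ∈ V → z i j x ∈ V)
    (h' : ∀ i j x, i ≤ n → j ≤ i → x ∈ V → star (z i j) x ∈ V) {i j : ℕ} (hi : i ≤ n) (hj : j ≤ n)
    {x : H} (hx : x ∈ V) : z i j x ∈ V := by
  rcases le_total j i with hji | hij
  · exact h i j x hi hji hx
  · rw [hz.eq_star_rangeProd hi hj]
    exact star_rangeProd_apply_mem (fun k hk y hy => h' _ _ y (skip_le i hk) (skip_le_skip hij k) hy)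
      hx

/-- Irreducibility of an array of operators. -/
def IsIrreducibleArray (n : ℕ) (z : ℕ → ℕ → H →L[ℂ] H) : Prop :=
  Nontrivial H ∧ ∀ V : Submodule ℂ H, IsClosed (V : Set H) →
    (∀ i j, i ≤ n → j ≤ n → ∀ v ∈ V, z i j v ∈ V) → V = ⊥ ∨ V = ⊤

/-- In an irreducible array the Fock vectors over a nonzero space of vacuum vectors span a dense
subspace. -/
theorem IsVacuum.dense (h : IsVacuum n k z X) (hz : IsCrystalArray n z)
    (hirr : IsIrreducibleArray n z) (hX : X ≠ ⊥) :
    (arrayFockSpan n k z X n).topologicalClosure = ⊤ := by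
  have hF := h.isFockSystem hz
  have hclos : ∀ (A : H →L[ℂ] H), (∀ x ∈ arrayFockSpan n k z X n, A x ∈ arrayFockSpan n k z X n) →
      ∀ x ∈ (arrayFockSpan n k z X n).topologicalClosure,
        A x ∈ (arrayFockSpan n k z X n).topologicalClosure := by
    intro A hA x hx
    exact (Set.MapsTo.closure (s := (arrayFockSpan n k z X n : Set H)) (f := A)
      (t := (arrayFockSpan n k z X n : Set H)) (fun x hx => hA x hx) A.continuous) hx
  refine (hirr.2 _ (Submodule.isClosed_topologicalClosure _) fun i j hi hj v hv =>
    hz.apply_mem_of_lower ?_ ?_ hi hj hv).resolve_left fun h0 => hX ?_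
  · intro i j x hi hji
    refine hclos _ (fun x hx => ?_) x
    rcases Nat.lt_or_ge j n with hj | hj
    · exact hF.apply_mem h.le hi hji hj hx
    · obtain ⟨rfl, rfl⟩ : i = n ∧ j = n := by omega
      exact hF.last_mem h.le hx
  · intro i j x hi hji
    refine hclos _ (fun x hx => ?_) x
    rcases Nat.lt_or_ge j n with hj | hj
    · exact h.star_apply_mem hz hi hji hj hx
    · obtain ⟨rfl, rfl⟩ : i = n ∧ j = n := by omega
      exact h.star_last_mem hz hx
  · rw [eq_bot_iff, ← h0]
    exact fun x hx => Submodule.le_topologicalClosure _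
      (FockVector.mono (.vac hx) h.le le_rfl).mem_fockSpan

end FockArray

/-! ### Vacuum embeddings and uniqueness -/

section VacuumEmbedding

variable {H H' X : Type*} [NormedAddCommGroup H] [InnerProductSpace ℂ H] [CompleteSpace H]
  [NormedAddCommGroup H'] [InnerProductSpace ℂ H'] [CompleteSpace H']
  [NormedAddCommGroup X] [InnerProductSpace ℂ X] {n k : ℕ}
  {z : ℕ → ℕ → H →L[ℂ] H} {z' : ℕ → ℕ → H' →L[ℂ] H'} {y : ℕ → ℕ → X →L[ℂ] X}
  {ι : X →ₗᵢ[ℂ] H} {ι' : X →ₗᵢ[ℂ] H'}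

/-- The isometry `ι` identifies `X` with the range of the first nonzero entry of the last column of
`z`, which is a projection in row `k`. -/
structure IsVacuumIsometry (n k : ℕ) (z : ℕ → ℕ → H →L[ℂ] H) (ι : X →ₗᵢ[ℂ] H) : Prop where
  le : k ≤ n
  zero : ∀ i, i < k → z i n = 0
  fix : ∀ x, z k n (ι x) = ι x
  range : ∀ v, ∃ x, z k n v = ι x

/-- Deleting row `k` and the last column, the lower entries of `z` restrict on the range of `ι` to
those of the array `y`. -/
structure IsVacuumEmbedding (n k : ℕ) (z : ℕ → ℕ → H →L[ℂ] H) (y : ℕ → ℕ → X →L[ℂ] X)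
    (ι : X →ₗᵢ[ℂ] H) : Prop extends IsVacuumIsometry n k z ι where
  below : ∀ i j x, j ≤ i → i < k → z i j (ι x) = ι (y i j x)
  above : ∀ i j x, j ≤ i → k ≤ i → i < n → z (i + 1) j (ι x) = ι (y i j x)

namespace IsVacuumIsometry

theorem lastProj_eq (h : IsVacuumIsometry n k z ι) (hz : IsCrystalArray n z) :
    lastProj n z k = z k n := by
  have h1 : z k n * z k n = z k n := by
    ext v
    obtain ⟨x, hx⟩ := h.range v
    rw [mul_apply_eq_comp, hx, h.fix]
  have h2 := hz.star_last_mul_last h.le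
  have h3 := hz.last_mul_star_mul_last h.le
  rw [h2, lastProj_eq_of_zero h.zero, ← mul_assoc, h1] at h3
  rw [lastProj_eq_of_zero h.zero, h3]

theorem star_eq (h : IsVacuumIsometry n k z ι) (hz : IsCrystalArray n z) :
    star (z k n) = z k n := by
  rw [← h.lastProj_eq hz, lastProj_eq_of_zero h.zero, star_mul, star_star]

theorem lastProj_apply (h : IsVacuumIsometry n k z ι) (hz : IsCrystalArray n z) (x : X) :
    lastProj n z k (ι x) = ι x := by rw [h.lastProj_eq hz, h.fix]

/-- The entries of row `k` before the last column annihilate the vacuum vectors. -/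
theorem row_apply (h : IsVacuumIsometry n k z ι) (hz : IsCrystalArray n z) {j : ℕ} (hj : j < n)
    (x : X) : z k j (ι x) = 0 := by
  rw [← h.fix]
  exact congrArg (fun f => f (ι x)) (hz.mul_last_self h.le hj)

/-- The diagonal entries from row `k` on annihilate the vacuum vectors. -/
theorem diag_apply (h : IsVacuumIsometry n k z ι) (hz : IsCrystalArray n z) {i : ℕ} (hk : k ≤ i)
    (hi : i < n) (x : X) : z i i (ι x) = 0 := by
  rw [← h.fix]
  exact congrArg (fun f => f (ι x)) (hz.diag_mul_last hi hk)

theorem commute (h : IsVacuumIsometry n k z ι) (hz : IsCrystalArray n z) {i j : ℕ} (hji : j ≤ i)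
    (hi : i ≤ n) (hj : j < n) (hik : i ≠ k) : z i j * z k n = z k n * z i j :=
  hz.mul_last_of_zero h.zero h.le hji hi hj hik

variable [CompleteSpace X]

theorem star_apply (h : IsVacuumIsometry n k z ι) (hz : IsCrystalArray n z) {i j : ℕ}
    (hji : j ≤ i) (hi : i ≤ n) (hj : j < n) (hik : i ≠ k) {B : X →L[ℂ] X}
    (hB : ∀ x, z i j (ι x) = ι (B x)) (x : X) : star (z i j) (ι x) = ι (star B x) := by
  have e : star (z i j) * z k n = z k n * star (z i j) := by
    have := congrArg star (h.commute hz hji hi hj hik)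
    rw [star_mul, star_mul, h.star_eq hz] at this
    exact this.symm
  have e' := congrArg (fun f => f (ι x)) e
  simp only [mul_apply_eq_comp, h.fix] at e'
  obtain ⟨w, hw⟩ := h.range (star (z i j) (ι x))
  rw [hw] at e'
  rw [e']
  congr 1
  refine ext_inner_right ℂ fun v => ?_
  rw [ContinuousLinearMap.star_eq_adjoint, ContinuousLinearMap.adjoint_inner_left,
    ← ι.inner_map_map, ← e', ContinuousLinearMap.star_eq_adjoint,
    ContinuousLinearMap.adjoint_inner_left, hB, ι.inner_map_map]

end IsVacuumIsometry

namespace IsVacuumEmbedding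

variable [CompleteSpace X]

theorem star_below (h : IsVacuumEmbedding n k z y ι) (hz : IsCrystalArray n z) {i j : ℕ} (x : X)
    (hji : j ≤ i) (hi : i < k) : star (z i j) (ι x) = ι (star (y i j) x) := by
  have := h.le
  exact h.star_apply hz hji (by omega) (by omega) (by omega) (fun x => h.below i j x hji hi) x

theorem star_above (h : IsVacuumEmbedding n k z y ι) (hz : IsCrystalArray n z) {i j : ℕ} (x : X)
    (hji : j ≤ i) (hk : k ≤ i) (hi : i < n) :
    star (z (i + 1) j) (ι x) = ι (star (y i j) x) :=
  h.star_apply hz (by omega) (by omega) (by omega) (by omega) (fun x => h.above i j x hji hk hi) x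

/-- The image of a reducing subspace of the small array is a space of vacuum vectors. -/
theorem isVacuum_map (h : IsVacuumEmbedding n k z y ι) (hz : IsCrystalArray n z) {W : Submodule ℂ X}
    (hW : ∀ i j, j ≤ i → i < n → ∀ x ∈ W, y i j x ∈ W)
    (hW' : ∀ i j, j ≤ i → i < n → ∀ x ∈ W, star (y i j) x ∈ W) :
    IsVacuum n k z (W.map ι.toLinearMap) where
  le := h.le
  zero := h.zero
  mem := by
    rintro i j _ hji hi hj hik ⟨x, hx, rfl⟩
    have := h.le
    rcases Nat.lt_or_ge i k with h1 | h1
    · exact ⟨_, hW i j hji (by omega) x hx, (h.below i j x hji h1).symm⟩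
    obtain ⟨p, rfl⟩ : ∃ p, i = p + 1 := ⟨i - 1, by omega⟩
    rcases Nat.eq_or_lt_of_le hji with rfl | h2
    · exact ⟨0, W.zero_mem, by simpa using (h.diag_apply hz h1 hj x).symm⟩
    · exact ⟨_, hW p j (by omega) (by omega) x hx,
        (h.above p j x (by omega) (by omega) (by omega)).symm⟩
  star_mem := by
    rintro i j _ hji hi hj hik ⟨x, hx, rfl⟩
    have := h.le
    rcases Nat.lt_or_ge i k with h1 | h1
    · exact ⟨_, hW' i j hji (by omega) x hx, (h.star_below hz x hji h1).symm⟩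
    obtain ⟨p, rfl⟩ : ∃ p, i = p + 1 := ⟨i - 1, by omega⟩
    rcases Nat.eq_or_lt_of_le hji with rfl | h2
    · refine ⟨0, W.zero_mem, ?_⟩
      have := h.star_apply hz le_rfl hi hj hik (B := 0) (fun x => by
        simpa using h.diag_apply hz h1 hj x) x
      rw [star_zero, zero_apply] at this
      exact this.symm
    · exact ⟨_, hW' p j (by omega) (by omega) x hx,
        (h.star_above hz x (by omega) (by omega) (by omega)).symm⟩
  cre_mem := by
    rintro _ ⟨x, hx, rfl⟩
    exact ⟨x, hx, (h.fix x).symm⟩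
  star_cre_mem := by
    rintro _ ⟨x, hx, rfl⟩
    rw [h.star_eq hz]
    exact ⟨x, hx, (h.fix x).symm⟩
  mul_star := by
    rintro _ ⟨x, hx, rfl⟩
    rw [h.star_eq hz]
    exact (congrArg _ (h.fix x)).trans (h.fix x)

theorem isVacuum (h : IsVacuumEmbedding n k z y ι) (hz : IsCrystalArray n z) :
    IsVacuum n k z (LinearMap.range ι.toLinearMap) := by
  rw [← Submodule.map_top]
  exact h.isVacuum_map hz (fun _ _ _ _ _ _ => trivial) fun _ _ _ _ _ _ => trivial

/-- Density of the Fock vectors over the range of `ι`. -/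
def IsCyclic (n k : ℕ) (z : ℕ → ℕ → H →L[ℂ] H) (ι : X →ₗᵢ[ℂ] H) : Prop :=
  ∀ V : Submodule ℂ H, IsClosed (V : Set H) → (∀ x, ι x ∈ V) →
    (∀ l, k < l → l ≤ n → ∀ v ∈ V, z l n v ∈ V) → V = ⊤

theorem dense_of_isCyclic (h : IsVacuumEmbedding n k z y ι) (hz : IsCrystalArray n z)
    (hc : IsCyclic n k z ι) :
    (arrayFockSpan n k z (LinearMap.range ι.toLinearMap) n).topologicalClosure = ⊤ := by
  refine hc _ (Submodule.isClosed_topologicalClosure _) (fun x => ?_) fun l hkl hl v hv => ?_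
  · have hx : ArrayFockVector n k z (LinearMap.range ι.toLinearMap) k (ι x) := .vac ⟨x, rfl⟩
    exact Submodule.le_topologicalClosure _ (hx.mono h.le le_rfl).mem_fockSpan
  · exact (Set.MapsTo.closure (f := z l n) (fun x hx =>
      ((h.isVacuum hz).isFockSystem hz).cre_mem_fockSpan_top h.le hkl hl hx) (z l n).continuous) hv

/-- The Fock system of two arrays over the same space of vacuum vectors. -/
theorem isFockSystem_prod (h : IsVacuumEmbedding n k z y ι) (hz : IsCrystalArray n z)
    (h' : IsVacuumEmbedding n k z' y ι') (hz' : IsCrystalArray n z') :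
    IsFockSystem n k (fun i j => (z i j : H →ₗ[ℂ] H).prodMap (z' i j : H' →ₗ[ℂ] H'))
      (fun l => (z l n : H →ₗ[ℂ] H).prodMap (z' l n : H' →ₗ[ℂ] H'))
      (LinearMap.range (ι.toLinearMap.prod ι'.toLinearMap)) := by
  have f := (h.isVacuum hz).isFockSystem hz
  have f' := (h'.isVacuum hz').isFockSystem hz'
  refine
    { far := fun i j l x h1 h2 h3 h4 => Prod.ext (f.far i j l _ h1 h2 h3 h4) (f'.far i j l _ h1 h2 h3 h4)
      below := fun i j l x h1 h2 h3 => Prod.ext (f.below i j l _ h1 h2 h3) (f'.below i j l _ h1 h2 h3)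
      succ := fun i j x h1 h2 h3 => Prod.ext (f.succ i j _ h1 h2 h3) (f'.succ i j _ h1 h2 h3)
      self := fun i j x h1 h2 => Prod.ext (f.self i j _ h1 h2) (f'.self i j _ h1 h2)
      cre_cre := fun i l x h1 h2 => Prod.ext (f.cre_cre i l _ h1 h2) (f'.cre_cre i l _ h1 h2)
      zero := fun i x h1 => Prod.ext (f.zero i _ h1) (f'.zero i _ h1)
      mem := ?_
      cre_mem := ?_ }
  · rintro i j _ hji hi hj ⟨x, rfl⟩
    have := h.le
    rcases lt_trichotomy i k with h1 | h1 | h1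
    · exact ⟨y i j x, Prod.ext (h.below i j x hji h1).symm (h'.below i j x hji h1).symm⟩
    · subst h1
      exact ⟨0, Prod.ext (by simpa using (h.row_apply hz hj x).symm)
        (by simpa using (h'.row_apply hz' hj x).symm)⟩
    obtain ⟨p, rfl⟩ : ∃ p, i = p + 1 := ⟨i - 1, by omega⟩
    rcases Nat.eq_or_lt_of_le hji with rfl | h2
    · exact ⟨0, Prod.ext (by simpa using (h.diag_apply hz h1.le hj x).symm)
        (by simpa using (h'.diag_apply hz' h1.le hj x).symm)⟩
    · exact ⟨y p j x, Prod.ext (h.above p j x (by omega) (by omega) (by omega)).symm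
        (h'.above p j x (by omega) (by omega) (by omega)).symm⟩
  · rintro _ ⟨x, rfl⟩
    exact ⟨x, Prod.ext (h.fix x).symm (h'.fix x).symm⟩

end IsVacuumEmbedding

theorem FockVector.map {M N : Type*} [AddCommGroup M] [Module ℂ M] [AddCommGroup N] [Module ℂ N]
    {R : ℕ → M →ₗ[ℂ] M} {R' : ℕ → N →ₗ[ℂ] N} {Y : Submodule ℂ M} {Y' : Submodule ℂ N}
    (φ : M →ₗ[ℂ] N) (hφ : ∀ l x, φ (R l x) = R' l (φ x)) (hY : ∀ x ∈ Y, φ x ∈ Y') {l : ℕ} {x : M}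
    (hx : FockVector n k R Y l x) : FockVector n k R' Y' l (φ x) := by
  induction hx with
  | vac hx => exact .vac (hY _ hx)
  | up _ hl ih => exact ih.up hl
  | cre _ hk ih => rw [hφ]; exact ih.cre hk

/-- Every Fock vector over the projection of `Y` is the projection of a Fock vector over `Y`. -/
theorem FockVector.exists_lift {M N : Type*} [AddCommGroup M] [Module ℂ M] [AddCommGroup N]
    [Module ℂ N] {R : ℕ → M →ₗ[ℂ] M} {R' : ℕ → N →ₗ[ℂ] N} {Y : Submodule ℂ M} {Y' : Submodule ℂ N}
    (φ : M →ₗ[ℂ] N) (hφ : ∀ l x, φ (R l x) = R' l (φ x)) (hY : ∀ x' ∈ Y', ∃ x ∈ Y, φ x = x') {l : ℕ}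
    {x' : N} (hx : FockVector n k R' Y' l x') : ∃ x, FockVector n k R Y l x ∧ φ x = x' := by
  induction hx with
  | vac hx => obtain ⟨x, hx', rfl⟩ := hY _ hx; exact ⟨x, .vac hx', rfl⟩
  | up _ hl ih => obtain ⟨x, hx, rfl⟩ := ih; exact ⟨x, hx.up hl, rfl⟩
  | cre _ hk ih => obtain ⟨x, hx, rfl⟩ := ih; exact ⟨_, hx.cre hk, hφ _ _⟩

theorem inner_last_last (hz : IsCrystalArray n z) {l m : ℕ} (hl : l ≤ n) (hm : m ≤ n) (h : l ≠ m)
    (u v : H) : inner ℂ (z l n u) (z m n v) = 0 := by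
  rw [← ContinuousLinearMap.adjoint_inner_right, ← ContinuousLinearMap.star_eq_adjoint,
    ← mul_apply_eq_comp, hz.star_last_mul_last_of_ne hl hm h, zero_apply, inner_zero_right]

theorem inner_last_last_self (hz : IsCrystalArray n z) {l : ℕ} (hl : l ≤ n) (u v : H) :
    inner ℂ (z l n u) (z l n v) = inner ℂ u (lastProj n z l v) := by
  rw [← ContinuousLinearMap.adjoint_inner_right, ← ContinuousLinearMap.star_eq_adjoint,
    ← mul_apply_eq_comp, hz.star_last_mul_last hl]

/-- A crystal array is determined up to equivalence by its action on the vacuum vectors, provided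
that the Fock vectors are dense: the inner products of Fock vectors and the action of the lower
entries on them are computed by the relations. -/
theorem IsVacuumEmbedding.arrayEquiv [CompleteSpace X] (h : IsVacuumEmbedding n k z y ι) (hz : IsCrystalArray n z)
    (h' : IsVacuumEmbedding n k z' y ι') (hz' : IsCrystalArray n z')
    (hd : (arrayFockSpan n k z (LinearMap.range ι.toLinearMap) n).topologicalClosure = ⊤)
    (hd' : (arrayFockSpan n k z' (LinearMap.range ι'.toLinearMap) n).topologicalClosure = ⊤) :
    ArrayEquiv n z z' := by
  set R : ℕ → (H × H') →ₗ[ℂ] (H × H') :=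
    fun l => (z l n : H →ₗ[ℂ] H).prodMap (z' l n : H' →ₗ[ℂ] H') with hR
  set Y : Submodule ℂ (H × H') := LinearMap.range (ι.toLinearMap.prod ι'.toLinearMap) with hY
  have hs := h.isFockSystem_prod hz h' hz'
  have hfst : ∀ {l p}, FockVector n k R Y l p →
      ArrayFockVector n k z (LinearMap.range ι.toLinearMap) l p.1 := fun hp =>
    hp.map (LinearMap.fst ℂ H H') (fun _ _ => rfl) (by rintro _ ⟨x, rfl⟩; exact ⟨x, rfl⟩)
  have hsnd : ∀ {l p}, FockVector n k R Y l p →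
      ArrayFockVector n k z' (LinearMap.range ι'.toLinearMap) l p.2 := fun hp =>
    hp.map (LinearMap.snd ℂ H H') (fun _ _ => rfl) (by rintro _ ⟨x, rfl⟩; exact ⟨x, rfl⟩)
  have hE : ∀ {l p}, FockVector n k R Y l p → lastProj n z l p.1 = p.1 := fun hp =>
    hz.lastProj_apply_of_fockVector h.le (by rintro _ ⟨x, rfl⟩; exact h.lastProj_apply hz x) (hfst hp)
  have hE' : ∀ {l p}, FockVector n k R Y l p → lastProj n z' l p.2 = p.2 := fun hp =>
    hz'.lastProj_apply_of_fockVector h'.le (by rintro _ ⟨x, rfl⟩; exact h'.lastProj_apply hz' x)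
      (hsnd hp)
  have hgram : ∀ {l p}, FockVector n k R Y l p → ∀ {l' q}, FockVector n k R Y l' q →
      inner ℂ p.1 q.1 = inner ℂ p.2 q.2 := by
    intro l p hp
    induction hp with
    | @vac p hp =>
      obtain ⟨x, rfl⟩ := hp
      intro l' q hq
      induction hq with
      | @vac q hq =>
        obtain ⟨x', rfl⟩ := hq
        exact (ι.inner_map_map x x').trans (ι'.inner_map_map x x').symm
      | up _ _ ih => exact ih
      | @cre m q hq hk ih =>
        have hm := hq.le_max h.le
        change inner ℂ (ι x) (z m n q.1) = inner ℂ (ι' x) (z' m n q.2)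
        rw [← h.fix x, ← h'.fix x, inner_last_last hz h.le hm hk.ne,
          inner_last_last hz' h.le hm hk.ne]
    | up _ _ ih => exact ih
    | @cre l p hp hk ih =>
      have hl := hp.le_max h.le
      intro l' q hq
      induction hq with
      | @vac q hq =>
        obtain ⟨x, rfl⟩ := hq
        change inner ℂ (z l n p.1) (ι x) = inner ℂ (z' l n p.2) (ι' x)
        rw [← h.fix x, ← h'.fix x, inner_last_last hz hl h.le hk.ne',
          inner_last_last hz' hl h.le hk.ne']
      | up _ _ ih' => exact ih'
      | @cre m q hq hk' ih' =>
        have hm := hq.le_max h.le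
        change inner ℂ (z l n p.1) (z m n q.1) = inner ℂ (z' l n p.2) (z' m n q.2)
        by_cases hlm : l = m
        · subst hlm
          rw [inner_last_last_self hz hl, inner_last_last_self hz' hl, hE hq, hE' hq]
          exact ih hq
        · rw [inner_last_last hz hl hm hlm, inner_last_last hz' hl hm hlm]
  refine ArrayEquiv.of_inner_eq hz hz' (ι := {p : H × H' // FockVector n k R Y n p})
    (f := fun p => p.1.1) (g := fun p => p.1.2) ?_ ?_ (fun p q => hgram p.2 q.2) ?_
  · intro V hV hm
    rw [eq_top_iff, ← hd]
    refine Submodule.topologicalClosure_minimal _ (Submodule.span_le.2 fun v hv => ?_) hV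
    obtain ⟨p, hp, rfl⟩ := FockVector.exists_lift (R := R) (Y := Y) (LinearMap.fst ℂ H H')
      (fun _ _ => rfl) (by rintro _ ⟨x, rfl⟩; exact ⟨_, ⟨x, rfl⟩, rfl⟩) hv
    exact hm ⟨p, hp⟩
  · intro V hV hm
    rw [eq_top_iff, ← hd']
    refine Submodule.topologicalClosure_minimal _ (Submodule.span_le.2 fun v hv => ?_) hV
    obtain ⟨p, hp, rfl⟩ := FockVector.exists_lift (R := R) (Y := Y) (LinearMap.snd ℂ H H')
      (fun _ _ => rfl) (by rintro _ ⟨x, rfl⟩; exact ⟨_, ⟨x, rfl⟩, rfl⟩) hv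
    exact hm ⟨p, hp⟩
  · rintro U hU i j hi hji ⟨p, hp⟩
    have hspan : ∀ q ∈ fockSpan n k R Y n, U q.1 = q.2 := by
      have : fockSpan n k R Y n ≤ LinearMap.eqLocus
          (U.toLinearEquiv.toLinearMap ∘ₗ LinearMap.fst ℂ H H') (LinearMap.snd ℂ H H') :=
        Submodule.span_le.2 fun q hq => hU ⟨q, hq⟩
      exact fun q hq => this hq
    rcases Nat.lt_or_ge j n with hj | hj
    · exact hspan _ (hs.apply_mem h.le hi hji hj hp.mem_fockSpan)
    · obtain ⟨rfl, rfl⟩ : i = n ∧ j = n := by omega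
      exact hspan _ (hs.last_mem h.le hp.mem_fockSpan)

end VacuumEmbedding

open OperatorArray

/-! ### The normal words -/

section Model

/-- The array is the identity in row and column `n`. -/
def IsTrivialAt (n : ℕ) {H : Type*} [NormedAddCommGroup H] [InnerProductSpace ℂ H]
    (z : ℕ → ℕ → H →L[ℂ] H) : Prop :=
  z n n = 1 ∧ ∀ i < n, z i n = 0 ∧ z n i = 0

section Shift

variable {K H X : Type*} [NormedAddCommGroup K] [InnerProductSpace ℂ K]
  [NormedAddCommGroup H] [InnerProductSpace ℂ H] [NormedAddCommGroup X] [InnerProductSpace ℂ X]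
  {n r : ℕ} {y : ℕ → ℕ → K →L[ℂ] K} {z : ℕ → ℕ → H →L[ℂ] H} {e : ℕ → K →ₗᵢ[ℂ] H}

theorem IsShift.eq_of_apply (hs : IsShift r y z e) {A B : H →L[ℂ] H}
    (h : ∀ m x, A (e m x) = B (e m x)) : A = B :=
  (hs.isTotal isTotal_id).ext fun p => h p.1 p.2

theorem IsShift.isTrivialAt (hs : IsShift r y z e) (hy : IsTrivialAt n y) (hr : r + 1 < n) :
    IsTrivialAt n z := by
  refine ⟨hs.eq_of_apply fun m x => ?_, fun i hi =>
    ⟨hs.eq_of_apply fun m x => ?_, hs.eq_of_apply fun m x => ?_⟩⟩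
  · rw [hs.other n (by omega) (by omega), hy.1]; rfl
  · by_cases h3 : i = r
    · subst h3
      rcases m with _ | m
      · rw [hs.left_zero, if_pos hi, (hy.2 (i + 1) hr).1]; simp
      · rw [hs.left_succ, (hy.2 i hi).1]; simp
    by_cases h4 : i = r + 1
    · subst h4
      rcases m with _ | m
      · rw [hs.right_zero, if_neg (by omega), (hy.2 (r + 1) hr).1]; simp
      · rw [hs.right_succ, (hy.2 (r + 1) hr).1]; simp
    · rw [hs.other i h3 h4, (hy.2 i hi).1]; simp
  · rw [hs.other n (by omega) (by omega), (hy.2 i hi).2]; simp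

/-- Convolution with the elementary representation of `(r, r + 1)` moves the first nonzero row of the
last column from `r + 1` to `r`, and `e_0 ⊗ ι x` are the new vacuum vectors. -/
theorem IsShift.isVacuumEmbedding [CompleteSpace K] [CompleteSpace X] {w : ℕ → ℕ → X →L[ℂ] X}
    {ι : X →ₗᵢ[ℂ] K} (hs : IsShift r y z e) (h : IsVacuumEmbedding n (r + 1) y w ι)
    (hy : IsCrystalArray n y) (hc : IsVacuumEmbedding.IsCyclic n (r + 1) y ι) :
    IsVacuumEmbedding n r z w ((e 0).comp ι) ∧
      IsVacuumEmbedding.IsCyclic n r z ((e 0).comp ι) := by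
  have hle := h.le
  have hleft : ∀ m v, z r n (e m v) = if m = 0 then e 0 (y (r + 1) n v) else 0 := by
    intro m v
    rcases m with _ | m
    · rw [if_pos rfl, hs.left_zero, if_pos (by omega)]
    · rw [if_neg (by omega), hs.left_succ, h.zero r (Nat.lt_succ_self r)]; simp
  have hright : ∀ m v, z (r + 1) n (e m v) = e (m + 1) (y (r + 1) n v) := by
    intro m v
    rcases m with _ | m
    · rw [hs.right_zero, if_neg (by omega)]; simp
    · exact hs.right_succ n m v
  refine ⟨⟨⟨by omega, fun i hi => hs.eq_of_apply fun m x => ?_, fun x => ?_, fun v => ?_⟩,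
    fun i j x hji hi => ?_, fun i j x hji hki hi => ?_⟩, fun V hV hι hR => ?_⟩
  · rw [hs.other i (by omega) (by omega), h.zero i (by omega)]; simp
  · change z r n (e 0 (ι x)) = e 0 (ι x)
    rw [hleft, if_pos rfl, h.fix]
  · have hcl : IsClosed (LinearMap.range ((e 0).comp ι).toLinearMap : Set H) := by
      rw [LinearMap.coe_range]
      exact ((e 0).comp ι).isometry.isClosedEmbedding.isClosed_range
    have := hs.total ((LinearMap.range ((e 0).comp ι).toLinearMap).comap (z r n).toLinearMap)
      (hcl.preimage (z r n).continuous) fun m v => by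
        change z r n (e m v) ∈ LinearMap.range ((e 0).comp ι).toLinearMap
        rw [hleft]
        split_ifs
        · obtain ⟨x, hx⟩ := h.range v
          exact ⟨x, by rw [hx]; rfl⟩
        · exact Submodule.zero_mem _
    have hv : v ∈ (LinearMap.range ((e 0).comp ι).toLinearMap).comap (z r n).toLinearMap := by
      rw [this]; trivial
    obtain ⟨x, hx⟩ := hv
    exact ⟨x, hx.symm⟩
  · change z i j (e 0 (ι x)) = e 0 (ι (w i j x))
    rw [hs.other i (by omega) (by omega), h.below i j x hji (by omega)]
  · change z (i + 1) j (e 0 (ι x)) = e 0 (ι (w i j x))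
    rcases Nat.eq_or_lt_of_le hki with rfl | hki
    · rw [hs.right_zero, if_pos hji, h.below r j x hji (Nat.lt_succ_self r),
        h.row_apply hy (by omega) x, map_zero, zero_add]
    · rw [hs.other (i + 1) (by omega) (by omega), h.above i j x hji hki hi]
  · have hfock : ∀ m x, e m (ι x) ∈ V := by
      intro m x
      induction m with
      | zero => exact hι x
      | succ m ih =>
        have := hR (r + 1) (by omega) hle _ ih
        rwa [hright, h.fix] at this
    refine hs.total V hV fun m v => ?_
    have := hc (V.comap (e m).toLinearMap) (hV.preimage (e m).continuous) (hfock m)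
      fun l hl hl' w hw => by
        have := hR l (by omega) hl' _ hw
        rw [LinearIsometry.coe_toLinearMap, hs.other l (by omega) (by omega)] at this
        exact this
    have hv : v ∈ V.comap (e m).toLinearMap := by rw [this]; trivial
    exact hv

end Shift

theorem isTrivialAt_ofWord {n : ℕ} {a : List ℕ} (ha : ∀ r ∈ a, r + 1 < n) :
    IsTrivialAt n (ofWord a).op := by
  induction a with
  | nil => exact ⟨if_pos rfl, fun i hi => ⟨if_neg hi.ne, if_neg hi.ne'⟩⟩
  | cons r a ih =>
    exact (isShift_shift r (ofWord a)).isTrivialAt (ih fun s hs => ha s (by simp [hs]))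
      (ha r (by simp))

variable {n : ℕ}

/-- Prepending the coset representative `s_k ⋯ s_{n-1}` to an array of smaller size produces an array
with vacuum vectors `e_0 ⊗ ⋯ ⊗ e_0 ⊗ x`, over which the Fock vectors are dense. -/
theorem exists_isVacuumEmbedding {Y : OperatorArray} (hY : IsCrystalArray n Y.op)
    (ht : IsTrivialAt n Y.op) (m k : ℕ) (hk : k + m = n) :
    ∃ ι : Y.space →ₗᵢ[ℂ] (prepend (List.range' k m) Y).space,
      IsVacuumEmbedding n k (prepend (List.range' k m) Y).op Y.op ι ∧
        IsVacuumEmbedding.IsCyclic n k (prepend (List.range' k m) Y).op ι := by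
  induction m generalizing k with
  | zero =>
    obtain rfl : k = n := hk
    refine ⟨LinearIsometry.id, ⟨⟨le_rfl, fun i hi => (ht.2 i hi).1, fun x => ?_, fun v => ⟨v, ?_⟩⟩,
      fun _ _ _ _ _ => rfl, fun i j x _ h h' => by omega⟩, fun V _ hV _ => ?_⟩
    · exact congrArg (fun f => f x) ht.1
    · exact congrArg (fun f => f v) ht.1
    · rw [eq_top_iff]; exact fun x _ => hV x
  | succ m ih =>
    obtain ⟨ι, h, hc⟩ := ih (k + 1) (by omega)
    exact ⟨_, (isShift_shift k _).isVacuumEmbedding h (isCrystalArray_prepend (fun r hr => by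
      rw [List.mem_range'_1] at hr; omega) hY) hc⟩

theorem ofWord_append (a b : List ℕ) : ofWord (a ++ b) = prepend a (ofWord b) :=
  prepend_append a b _

theorem IsNormalWord.exists_isVacuumEmbedding {a : List ℕ} (ha : IsNormalWord n a) {k : ℕ}
    (hk : k ≤ n + 1) :
    ∃ ι : (ofWord a).space →ₗᵢ[ℂ] (ofWord (List.range' k (n + 1 - k) ++ a)).space,
      IsVacuumEmbedding (n + 1) k (ofWord (List.range' k (n + 1 - k) ++ a)).op (ofWord a).op ι ∧
        IsVacuumEmbedding.IsCyclic (n + 1) k (ofWord (List.range' k (n + 1 - k) ++ a)).op ι := by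
  rw [ofWord_append]
  exact CrystalSU.exists_isVacuumEmbedding
    (isCrystalArray_ofWord fun r hr => (ha.lt r hr).trans (Nat.lt_succ_self n))
    (isTrivialAt_ofWord fun r hr => Nat.succ_lt_succ (ha.lt r hr)) (n + 1 - k) k (by omega)

end Model

/-! ### Irreducibility -/

section Irreducible

variable {H X : Type*} [NormedAddCommGroup H] [InnerProductSpace ℂ H] [CompleteSpace H]
  [NormedAddCommGroup X] [InnerProductSpace ℂ X] [CompleteSpace X] {n k : ℕ}
  {z : ℕ → ℕ → H →L[ℂ] H} {y : ℕ → ℕ → X →L[ℂ] X} {ι : X →ₗᵢ[ℂ] H}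

omit [CompleteSpace H] in
theorem rangeProd_apply_mem {V : Submodule ℂ H} {m : ℕ} {f : ℕ → H →L[ℂ] H}
    (h : ∀ k < m, ∀ x ∈ V, f k x ∈ V) {x : H} (hx : x ∈ V) : rangeProd m f x ∈ V := by
  induction m generalizing x with
  | zero => simpa using hx
  | succ m ih =>
    rw [rangeProd_succ, mul_apply_eq_comp]
    exact ih (fun k hk => h k (by omega)) (h m (Nat.lt_succ_self m) _ hx)

/-- A subspace invariant under a crystal array is invariant under the adjoints. -/
theorem IsCrystalArray.star_apply_mem (hz : IsCrystalArray n z) {V : Submodule ℂ H}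
    (h : ∀ i j, i ≤ n → j ≤ n → ∀ v ∈ V, z i j v ∈ V) {i j : ℕ} (hi : i ≤ n) (hj : j ≤ n) {v : H}
    (hv : v ∈ V) : star (z i j) v ∈ V := by
  rw [hz.star_eq i j hi hj]
  exact rangeProd_apply_mem (fun k hk => h _ _ (skip_le i hk) (skip_le j hk)) hv

/-- The orthogonal complement of an invariant subspace is invariant. -/
theorem IsCrystalArray.orthogonal_mem (hz : IsCrystalArray n z) {V : Submodule ℂ H}
    (h : ∀ i j, i ≤ n → j ≤ n → ∀ v ∈ V, z i j v ∈ V) {i j : ℕ} (hi : i ≤ n) (hj : j ≤ n) {v : H}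
    (hv : v ∈ Vᗮ) : z i j v ∈ Vᗮ := by
  rw [Submodule.mem_orthogonal] at hv ⊢
  intro u hu
  rw [← ContinuousLinearMap.adjoint_inner_left, ← ContinuousLinearMap.star_eq_adjoint]
  exact hv _ (hz.star_apply_mem h hi hj hu)

/-- An invariant subspace meets the vacuum vectors in an invariant subspace of the small array. If
this is zero, the orthogonal complement contains all vacuum vectors, and otherwise the subspace
itself does. -/
theorem IsVacuumEmbedding.isIrreducibleArray (h : IsVacuumEmbedding (n + 1) k z y ι)
    (hz : IsCrystalArray (n + 1) z) (hc : IsVacuumEmbedding.IsCyclic (n + 1) k z ι)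
    (hy : IsCrystalArray n y) (hirr : IsIrreducibleArray n y) : IsIrreducibleArray (n + 1) z := by
  have hle := h.le
  -- an invariant subspace containing all vacuum vectors is everything
  have htop : ∀ V : Submodule ℂ H, IsClosed (V : Set H) →
      (∀ i j, i ≤ n + 1 → j ≤ n + 1 → ∀ v ∈ V, z i j v ∈ V) → (∀ x, ι x ∈ V) → V = ⊤ :=
    fun V hV hm hι => hc V hV hι fun l _ hl v hv => hm l (n + 1) hl le_rfl v hv
  refine ⟨?_, fun V hV hm => ?_⟩
  · have := hirr.1
    obtain ⟨x, hx⟩ := exists_ne (0 : X)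
    exact ⟨ι x, 0, fun h0 => hx (ι.injective (h0.trans ι.map_zero.symm))⟩
  have hinv : ∀ i j, i ≤ n → j ≤ n → ∀ v ∈ V.comap ι.toLinearMap, y i j v ∈ V.comap ι.toLinearMap := by
    intro i j hi hj v hv
    refine hy.apply_mem_of_lower (V := V.comap ι.toLinearMap) ?_ ?_ hi hj hv
    · intro i j x hi hji hx
      change ι (y i j x) ∈ V
      rcases Nat.lt_or_ge i k with hik | hik
      · rw [← h.below i j x hji hik]
        exact hm _ _ (by omega) (by omega) _ hx
      · rw [← h.above i j x hji hik (by omega)]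
        exact hm _ _ (by omega) (by omega) _ hx
    · intro i j x hi hji hx
      change ι (star (y i j) x) ∈ V
      rcases Nat.lt_or_ge i k with hik | hik
      · rw [← h.star_below hz x hji hik]
        exact hz.star_apply_mem hm (by omega) (by omega) hx
      · rw [← h.star_above hz x hji hik (by omega)]
        exact hz.star_apply_mem hm (by omega) (by omega) hx
  rcases hirr.2 (V.comap ι.toLinearMap) (hV.preimage ι.continuous) hinv with h0 | h1
  · left
    have h2 : ∀ v ∈ V, z k (n + 1) v = 0 := by
      intro v hv
      obtain ⟨x, hx⟩ := h.range v
      have : x ∈ V.comap ι.toLinearMap := by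
        change ι x ∈ V
        rw [← hx]
        exact hm k (n + 1) h.le le_rfl v hv
      rw [h0, Submodule.mem_bot] at this
      rw [hx, this, map_zero]
    have h3 : Vᗮ = ⊤ := by
      refine htop _ (Submodule.isClosed_orthogonal V)
        (fun i j hi hj v hv => hz.orthogonal_mem hm hi hj hv) fun x => ?_
      rw [Submodule.mem_orthogonal]
      intro u hu
      rw [← h.fix x, ← h.star_eq hz, ContinuousLinearMap.star_eq_adjoint,
        ContinuousLinearMap.adjoint_inner_right, h2 u hu, inner_zero_left]
    have := hV.completeSpace_coe
    rw [← Submodule.orthogonal_orthogonal V, h3, Submodule.top_orthogonal_eq_bot]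
  · right
    refine htop V hV hm fun x => ?_
    have : x ∈ V.comap ι.toLinearMap := by rw [h1]; trivial
    exact this

omit [CompleteSpace H] in
theorem IsIrreducibleArray.scaleRows (hz : IsIrreducibleArray n z) (τ : ℕ → Circle) :
    IsIrreducibleArray n (scaleRows τ z) := by
  refine ⟨hz.1, fun V hV hm => hz.2 V hV fun i j hi hj v hv => ?_⟩
  have := V.smul_mem ((τ i : ℂ)⁻¹) (hm i j hi hj v hv)
  simpa [CrystalSU.scaleRows, smul_smul] using this

omit [CompleteSpace H] [CompleteSpace X] in
theorem ArrayEquiv.isIrreducibleArray {z' : ℕ → ℕ → X →L[ℂ] X} (h : ArrayEquiv n z z')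
    (hz : IsIrreducibleArray n z) : IsIrreducibleArray n z' := by
  obtain ⟨U, hU⟩ := h
  refine ⟨?_, fun V hV hm => ?_⟩
  · have := hz.1
    exact U.symm.toEquiv.nontrivial
  · rcases hz.2 (V.comap U.toLinearEquiv.toLinearMap) (hV.preimage U.continuous)
      (fun i j hi hj v hv => by
        change U (z i j v) ∈ V
        rw [hU i j hi hj]
        exact hm i j hi hj _ hv) with h0 | h0
    · left
      rw [eq_bot_iff]
      intro v hv
      have : U.symm v ∈ V.comap U.toLinearEquiv.toLinearMap := by
        change U (U.symm v) ∈ V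
        rwa [U.apply_symm_apply]
      rw [h0, Submodule.mem_bot] at this
      rw [Submodule.mem_bot, ← U.apply_symm_apply v, this, map_zero]
    · right
      rw [eq_top_iff]
      intro v _
      have : U.symm v ∈ V.comap U.toLinearEquiv.toLinearMap := by rw [h0]; trivial
      change U (U.symm v) ∈ V at this
      rwa [U.apply_symm_apply] at this

/-- The array of a normal word is irreducible. -/
theorem IsNormalWord.isIrreducibleArray {n : ℕ} {a : List ℕ} (ha : IsNormalWord n a) :
    IsIrreducibleArray n (ofWord a).op := by
  induction ha with
  | nil =>
    refine ⟨inferInstanceAs (Nontrivial ℂ), fun V _ _ => ?_⟩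
    exact IsSimpleOrder.eq_bot_or_eq_top (α := Submodule ℂ ℂ) V
  | @cons n k a hb hk ih =>
    obtain ⟨ι, h, hc⟩ := hb.exists_isVacuumEmbedding hk
    exact h.isIrreducibleArray (isCrystalArray_ofWord (hb.cons hk).lt) hc
      (isCrystalArray_ofWord hb.lt) ih

end Irreducible

open OperatorArray

/-! ### Recovering the normal word and the phases -/

section Recover

variable {H H' X X' : Type*} [NormedAddCommGroup H] [InnerProductSpace ℂ H] [CompleteSpace H]
  [NormedAddCommGroup H'] [InnerProductSpace ℂ H'] [CompleteSpace H']
  [NormedAddCommGroup X] [InnerProductSpace ℂ X] [CompleteSpace X]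
  [NormedAddCommGroup X'] [InnerProductSpace ℂ X'] [CompleteSpace X'] {n k k' : ℕ}
  {z : ℕ → ℕ → H →L[ℂ] H} {z' : ℕ → ℕ → H' →L[ℂ] H'} {y : ℕ → ℕ → X →L[ℂ] X}
  {y' : ℕ → ℕ → X' →L[ℂ] X'} {ι : X →ₗᵢ[ℂ] H} {ι' : X' →ₗᵢ[ℂ] H'} {τ τ' : ℕ → Circle}

omit [CompleteSpace H] [CompleteSpace H'] [CompleteSpace X] [CompleteSpace X'] in
/-- The first nonzero row of the last column is an invariant of the equivalence class. -/
theorem IsVacuumEmbedding.le_of_arrayEquiv [Nontrivial X'] (h : IsVacuumEmbedding n k z y ι)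
    (h' : IsVacuumEmbedding n k' z' y' ι') (he : ArrayEquiv n (scaleRows τ z) (scaleRows τ' z')) :
    k ≤ k' := by
  by_contra! hlt
  obtain ⟨U, hU⟩ := he
  obtain ⟨x, hx⟩ := exists_ne (0 : X')
  have := hU k' n h'.le le_rfl (U.symm (ι' x))
  simp only [scaleRows, smul_apply, h.zero k' hlt, zero_apply, smul_zero, map_zero,
    U.apply_symm_apply, h'.fix] at this
  exact hx (ι'.injective (by
    rw [map_zero]; exact (smul_eq_zero.1 this.symm).resolve_left (τ' k').coe_ne_zero))

omit [CompleteSpace H] [CompleteSpace H'] [CompleteSpace X] [CompleteSpace X'] in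
/-- The vacuum vectors form the eigenspace of the first nonzero entry of the last column for a
nonzero eigenvalue, which is the phase of its row; an equivalence preserves both. -/
theorem IsVacuumEmbedding.map_vacuum [Nontrivial X] (h : IsVacuumEmbedding n k z y ι)
    (h' : IsVacuumEmbedding n k z' y' ι') {U : H ≃ₗᵢ[ℂ] H'}
    (hU : ∀ i j, i ≤ n → j ≤ n → ∀ v, U (scaleRows τ z i j v) = scaleRows τ' z' i j (U v)) :
    τ k = τ' k ∧ ∀ x, ∃ x', U (ι x) = ι' x' := by
  have hfix : ∀ x, (τ k : ℂ) • U (ι x) = (τ' k : ℂ) • z' k n (U (ι x)) := fun x => by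
    have := hU k n h.le le_rfl (ι x)
    simpa only [scaleRows, smul_apply, h.fix, map_smul] using this
  have hmem : ∀ x, ∃ x', U (ι x) = ι' x' := fun x => by
    obtain ⟨x', hx'⟩ := h'.range (U (ι x))
    refine ⟨((τ k : ℂ)⁻¹ * (τ' k : ℂ)) • x', ?_⟩
    rw [map_smul, ← hx', mul_smul, ← hfix, smul_smul, inv_mul_cancel₀ (τ k).coe_ne_zero, one_smul]
  refine ⟨?_, hmem⟩
  obtain ⟨x, hx⟩ := exists_ne (0 : X)
  obtain ⟨x', hx'⟩ := hmem x
  have h1 := hfix x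
  rw [hx', h'.fix, ← hx'] at h1
  have h2 : U (ι x) ≠ 0 := fun h0 => hx (ι.injective (U.injective (by rw [h0, map_zero, map_zero])))
  exact Circle.ext (smul_left_injective ℂ h2 h1)

omit [CompleteSpace H] [CompleteSpace H'] in
/-- An equivalence between two arrays with vacuum embeddings restricts to the vacuum vectors. -/
theorem IsVacuumEmbedding.exists_restrict [Nontrivial X] [Nontrivial X']
    (h : IsVacuumEmbedding (n + 1) k z y ι)
    (h' : IsVacuumEmbedding (n + 1) k' z' y' ι')
    (he : ArrayEquiv (n + 1) (scaleRows τ z) (scaleRows τ' z')) :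
    k = k' ∧ τ k = τ' k ∧ ∃ U : X ≃ₗᵢ[ℂ] X', ∀ i j, i ≤ n → j ≤ i → ∀ x,
      U ((τ (skip k i) : ℂ) • y i j x) = (τ' (skip k i) : ℂ) • y' i j (U x) := by
  have hle := h.le
  obtain rfl : k = k' := le_antisymm (h.le_of_arrayEquiv h' he) (h'.le_of_arrayEquiv h he.symm)
  obtain ⟨U, hU⟩ := he
  obtain ⟨h1, h2⟩ := h.map_vacuum h' hU
  obtain ⟨-, h3⟩ := h'.map_vacuum h (U := U.symm) (τ := τ') (τ' := τ)
    fun i j hi hj v => U.injective (by simp [hU i j hi hj])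
  choose φ hφ using h2
  have hsurj : Function.Surjective φ := fun x' => by
    obtain ⟨x, hx⟩ := h3 x'
    exact ⟨x, ι'.injective (by rw [← hφ, ← hx, U.apply_symm_apply])⟩
  obtain ⟨W, hW⟩ := exists_unitary_of_inner_eq (f := fun x : X => x) (g := φ) isTotal_id
    (fun V _ hV => by
      rw [eq_top_iff]
      intro x' _
      obtain ⟨x, rfl⟩ := hsurj x'
      exact hV x)
    fun x x' => by
      rw [← ι'.inner_map_map, ← hφ, ← hφ, U.inner_map_map, ι.inner_map_map]
  refine ⟨rfl, h1, W, fun i j hi hji x => ?_⟩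
  have hWφ : ∀ x, ι' (W x) = U (ι x) := fun x => by rw [hW, hφ]
  refine ι'.injective ?_
  rw [hWφ]
  simp only [map_smul]
  unfold skip
  split_ifs with hik
  · have := hU i j (by omega) (by omega) (ι x)
    simp only [scaleRows, smul_apply, map_smul] at this
    rw [h.below i j x hji hik] at this
    rw [this, ← hWφ, h'.below i j _ hji hik]
  · have := hU (i + 1) j (by omega) (by omega) (ι x)
    simp only [scaleRows, smul_apply, map_smul] at this
    rw [h.above i j x hji (by omega) (by omega)] at this
    rw [this, ← hWφ, h'.above i j _ hji (by omega) (by omega)]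

/-- The phases that remain when row `k` is deleted: the phase of row `k` is absorbed in the first of
the remaining rows, so that the product of all phases is unchanged. -/
def deletePhase (k : ℕ) (τ : ℕ → Circle) (i : ℕ) : Circle :=
  if i = 0 then τ k * τ (skip k i) else τ (skip k i)

theorem prod_deletePhase (τ : ℕ → Circle) (hk : k ≤ n + 1) :
    ∏ i ∈ Finset.range (n + 1), deletePhase k τ i = ∏ i ∈ Finset.range (n + 2), τ i := by
  rw [← prod_range_skip τ hk, Finset.prod_range_succ', Finset.prod_range_succ' (fun i => τ (skip k i))]
  simp only [deletePhase, if_true, if_neg (Nat.succ_ne_zero _)]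
  rw [mul_left_comm]

/-- The array determines the normal word and the phases: the row `k` of its first coset
representative and the phase of this row are visible in the last column, and the vacuum vectors carry
the array of the remaining word. -/
theorem IsNormalWord.eq_of_arrayEquiv {n : ℕ} {a a' : List ℕ} (ha : IsNormalWord n a)
    (ha' : IsNormalWord n a') {τ τ' : ℕ → Circle} (hτ : ∏ i ∈ Finset.range (n + 1), τ i = 1)
    (hτ' : ∏ i ∈ Finset.range (n + 1), τ' i = 1)
    (he : ArrayEquiv n (scaleRows τ (ofWord a).op) (scaleRows τ' (ofWord a').op)) :
    a = a' ∧ ∀ i ≤ n, τ i = τ' i := by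
  induction ha generalizing a' τ τ' with
  | nil =>
    cases ha'
    refine ⟨rfl, fun i hi => ?_⟩
    obtain rfl : i = 0 := by omega
    rw [Finset.prod_range_one] at hτ hτ'
    rw [hτ, hτ']
  | @cons n k b hb hk ih =>
    obtain @⟨_⟩ | @⟨_, k', b', hb', hk'⟩ := ha'
    obtain ⟨ι, h, -⟩ := hb.exists_isVacuumEmbedding hk
    obtain ⟨ι', h', -⟩ := hb'.exists_isVacuumEmbedding hk'
    have := hb.isIrreducibleArray.1
    have := hb'.isIrreducibleArray.1
    obtain ⟨rfl, h1, U, hU⟩ := h.exists_restrict h' he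
    have hσ := (prod_deletePhase τ hk).trans hτ
    have hσ' := (prod_deletePhase τ' hk).trans hτ'
    obtain ⟨rfl, h2⟩ := ih hb' hσ hσ' (ArrayEquiv.of_lower
      ((isCrystalArray_ofWord hb.lt).scaleRows hσ) ((isCrystalArray_ofWord hb'.lt).scaleRows hσ') U
      fun i j hi hji x => by
        have := hU i j hi hji x
        simp only [scaleRows, smul_apply, deletePhase]
        split_ifs
        · rw [Circle.coe_mul, Circle.coe_mul, mul_smul, mul_smul, map_smul, this, h1]
        · exact this)
    refine ⟨rfl, fun i hi => ?_⟩
    have h3 : ∀ j ≤ n, τ (skip k j) = τ' (skip k j) := fun j hj => by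
      have := h2 j hj
      unfold deletePhase at this
      split_ifs at this
      · rw [h1] at this
        exact mul_left_cancel this
      · exact this
    rcases lt_trichotomy i k with hik | rfl | hik
    · have := h3 i (by omega)
      rwa [skip, if_pos hik] at this
    · exact h1
    · obtain ⟨j, rfl⟩ : ∃ j, i = j + 1 := ⟨i - 1, by omega⟩
      have := h3 j (by omega)
      rwa [skip, if_neg (by omega)] at this

end Recover

/-! ### The first entry of the last column of an irreducible array -/

section Scalar

/-- A normal partial isometry whose continuous functions have no zero divisors on its support is a
multiple of its support projection. -/
theorem exists_circle_smul_of_no_zero_divisors {A : Type*} [CStarAlgebra A] {u : A} (hu : u ≠ 0)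
    (hn : IsStarNormal u) (hp : u * (star u * u) = u)
    (h : ∀ f g : ℂ → ℂ, Continuous f → Continuous g → (∀ x, f x * g x = 0) →
      cfc f u * u = 0 ∨ cfc g u * u = 0) : ∃ c : Circle, u = (c : ℂ) • (star u * u) := by
  have hzero : ∀ f : ℂ → ℂ, Continuous f → cfc f u * u = 0 → ∀ x ∈ spectrum ℂ u, f x * x = 0 := by
    intro f hf h0 x hx
    have e : cfc (fun x => f x * x) u = cfc (fun _ => (0 : ℂ)) u := by
      rw [cfc_mul f (fun x => x) u, cfc_id' ℂ u, h0, cfc_const_zero ℂ u]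
    exact eqOn_of_cfc_eq_cfc e (by fun_prop) (by fun_prop) hn hx
  -- bump functions around two different nonzero spectral values would be zero divisors
  have huniq : ∀ x ∈ spectrum ℂ u, ∀ y ∈ spectrum ℂ u, x ≠ 0 → y ≠ 0 → x = y := by
    intro x hx y hy hx0 hy0
    by_contra hxy
    have hr : 0 < ‖x - y‖ / 2 := half_pos (norm_pos_iff.2 (sub_ne_zero.2 hxy))
    set r := ‖x - y‖ / 2 with hr'
    have hbump : ∀ y : ℂ, Continuous fun w : ℂ => ((max 0 (r - ‖w - y‖) : ℝ) : ℂ) := fun y => by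
      fun_prop
    have hne : ∀ y : ℂ, ((max 0 (r - ‖y - y‖) : ℝ) : ℂ) ≠ 0 := fun y => by
      rw [sub_self, norm_zero, sub_zero, max_eq_right hr.le]
      exact_mod_cast hr.ne'
    have hdisj : ∀ w : ℂ, ((max 0 (r - ‖w - x‖) : ℝ) : ℂ) * ((max 0 (r - ‖w - y‖) : ℝ) : ℂ) = 0 := by
      intro w
      have htri : ‖x - y‖ ≤ ‖w - x‖ + ‖w - y‖ := by
        rw [norm_sub_rev w x]; exact norm_sub_le_norm_sub_add_norm_sub x w y
      rcases le_total r ‖w - x‖ with h1 | h1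
      · rw [max_eq_left (by linarith)]; simp
      · rw [max_eq_left (by linarith : r - ‖w - y‖ ≤ 0)]; simp
    rcases h _ _ (hbump x) (hbump y) hdisj with h0 | h0
    · exact (mul_ne_zero (hne x) hx0) (hzero _ (hbump x) h0 x hx)
    · exact (mul_ne_zero (hne y) hy0) (hzero _ (hbump y) h0 y hy)
  -- the nonzero spectral values of a partial isometry that is normal have modulus one
  have hnorm : ∀ x ∈ spectrum ℂ u, x * (star x * x) = x := by
    intro x hx
    have e : cfc (fun x : ℂ => x * (star x * x)) u = cfc (fun x : ℂ => x) u := by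
      rw [cfc_mul (fun x => x) (fun x : ℂ => star x * x) u, cfc_mul (fun x : ℂ => star x) (fun x => x) u,
        cfc_star_id u, cfc_id' ℂ u, hp]
    exact eqOn_of_cfc_eq_cfc e (by fun_prop) (by fun_prop) hn hx
  obtain ⟨c, hc, hc0⟩ : ∃ c ∈ spectrum ℂ u, c ≠ 0 := by
    by_contra! hall
    refine hu ?_
    rw [← cfc_id' ℂ u, ← cfc_const_zero ℂ u]
    exact cfc_congr hall
  have hc1 : ‖c‖ = 1 := by
    have h1 := hnorm c hc
    have h2 : star c * c = 1 := mul_left_cancel₀ hc0 (by rw [h1, mul_one])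
    have h3 : ‖c‖ * ‖c‖ = 1 := by
      have := congrArg norm h2
      rwa [norm_mul, norm_star, norm_one] at this
    nlinarith [norm_nonneg c]
  refine ⟨⟨c, mem_sphere_zero_iff_norm.2 hc1⟩, ?_⟩
  change u = c • (star u * u)
  have e : cfc (fun x : ℂ => x) u = cfc (fun x : ℂ => c * (star x * x)) u := by
    refine cfc_congr fun x hx => ?_
    by_cases hx0 : x = 0
    · simp [hx0]
    · rw [← huniq x hx c hc hx0 hc0]
      exact (hnorm x hx).symm
  rwa [cfc_const_mul c (fun x : ℂ => star x * x) u, cfc_mul (fun x : ℂ => star x) (fun x => x) u,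
    cfc_star_id u, cfc_id' ℂ u] at e

variable {B : Type*} [Ring B] [StarRing B] {n k : ℕ} {z : ℕ → ℕ → B}

/-- The last column of the array `z` has its first nonzero entry in row `k`. -/
structure IsFirstRow (n k : ℕ) (z : ℕ → ℕ → B) : Prop where
  le : k ≤ n
  ne_zero : z k n ≠ 0
  zero : ∀ i < k, z i n = 0

theorem IsCrystalArray.exists_isFirstRow [Nontrivial B] (hz : IsCrystalArray n z) :
    ∃ k, IsFirstRow n k z := by
  have hex : ∃ k, k ≤ n ∧ z k n ≠ 0 := by
    by_contra! hall
    have h := hz.lastProj_last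
    rw [lastProj, Finset.sum_eq_zero fun m hm => by
      rw [Finset.mem_range] at hm; rw [hall m (by omega), zero_mul]] at h
    exact zero_ne_one h
  classical
  refine ⟨Nat.find hex, (Nat.find_spec hex).1, (Nat.find_spec hex).2, fun i hi => ?_⟩
  have h1 := (Nat.find_spec hex).1
  have h2 := Nat.find_min hex hi
  by_contra h0
  exact h2 ⟨by omega, h0⟩

namespace IsFirstRow

theorem lastProj_eq (h : IsFirstRow n k z) : lastProj n z k = z k n * star (z k n) :=
  lastProj_eq_of_zero h.zero

/-- The first nonzero entry is normal: its initial projection is the sum of the range projections of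
the rows up to `k`, of which only its own is nonzero. -/
theorem star_mul_self (h : IsFirstRow n k z) (hz : IsCrystalArray n z) :
    star (z k n) * z k n = z k n * star (z k n) := by
  rw [hz.star_last_mul_last h.le, h.lastProj_eq]

theorem mul_star_mul (h : IsFirstRow n k z) (hz : IsCrystalArray n z) :
    z k n * (star (z k n) * z k n) = z k n := hz.last_mul_star_mul_last h.le

theorem commute (h : IsFirstRow n k z) (hz : IsCrystalArray n z) {i j : ℕ} (hji : j ≤ i)
    (hi : i ≤ n) (hj : j < n) (hik : i ≠ k) : Commute (z k n) (z i j) :=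
  (hz.mul_last_of_zero h.zero h.le hji hi hj hik).symm

/-- Together with `IsFirstRow.commute` this makes the functions of `z k n` commute with all lower
entries outside row `k`. -/
theorem star_commute (h : IsFirstRow n k z) (hz : IsCrystalArray n z) {i j : ℕ} (hji : j ≤ i)
    (hi : i ≤ n) (hj : j < n) (hik : i ≠ k) : Commute (star (z k n)) (z i j) := by
  have hc := h.commute hz hji hi hj hik
  have hs := hz.star_mul_last_of_ne hji hj hi h.le (Ne.symm hik)
  have h1 := h.star_mul_self hz
  have h2 := h.mul_star_mul hz
  rw [h.lastProj_eq] at hs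
  set u := z k n
  set w := z i j
  -- the adjoint of `hs`, multiplied by `u` from the left and by `star u` from the right
  have h3 : u * star u * u = u := by rw [mul_assoc, h2]
  have h4 : star u * (u * star u) = star u := by
    have := congrArg star h3
    simpa only [star_mul, star_star] using this
  have e1 : star u * w = u * star u * w * star u := by
    have := congrArg star hs
    simpa only [star_mul, star_star] using this
  have h5 : u * (star u * star u) = star u := by rw [← mul_assoc, ← h1, mul_assoc, h4]
  have e2 : w * star u = u * star u * w * star u := by
    calc w * star u = w * u * (star u * star u) := by rw [mul_assoc, h5]
      _ = u * star u * u * w * (star u * star u) := by rw [← hc.eq, h3]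
      _ = u * star u * w * star u := by
        rw [mul_assoc (u * star u) u w, hc.eq, ← mul_assoc (u * star u) w u,
          mul_assoc (u * star u * w) u, h5]
  exact e1.trans e2.symm

end IsFirstRow

end Scalar

section ScalarOperator

variable {H : Type*} [NormedAddCommGroup H] [InnerProductSpace ℂ H] [CompleteSpace H] {n k : ℕ}
  {z : ℕ → ℕ → H →L[ℂ] H}

/-- The range of a function of the first nonzero entry of the last column is a space of vacuum
vectors. -/
theorem IsFirstRow.isVacuum_range (h : IsFirstRow n k z) (hz : IsCrystalArray n z) {F : H →L[ℂ] H}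
    (hF : ∀ w, Commute (z k n) w → Commute (star (z k n)) w → Commute F w) :
    IsVacuum n k z (LinearMap.range (F * z k n : H →L[ℂ] H).toLinearMap) := by
  have hn : Commute (z k n) (star (z k n)) := (h.star_mul_self hz).symm
  have hFu : Commute F (z k n) := hF _ (Commute.refl _) hn.symm
  have hFs : Commute F (star (z k n)) := hF _ hn (Commute.refl _)
  have hmem : ∀ {w : H →L[ℂ] H}, Commute (F * z k n) w → ∀ x ∈
      LinearMap.range (F * z k n : H →L[ℂ] H).toLinearMap,
        w x ∈ LinearMap.range (F * z k n : H →L[ℂ] H).toLinearMap := by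
    rintro w hw _ ⟨x, rfl⟩
    exact ⟨w x, congrArg (fun f => f x) hw.eq⟩
  have hw : ∀ i j, j ≤ i → i ≤ n → j < n → i ≠ k → Commute (z k n) (z i j) ∧
      Commute (star (z k n)) (z i j) := fun i j hji hi hj hik =>
    ⟨h.commute hz hji hi hj hik, h.star_commute hz hji hi hj hik⟩
  refine ⟨h.le, h.zero, fun i j x hji hi hj hik => ?_, fun i j x hji hi hj hik => ?_, hmem ?_, hmem ?_,
    ?_⟩
  · obtain ⟨h1, h2⟩ := hw i j hji hi hj hik
    exact hmem ((hF _ h1 h2).mul_left h1) x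
  · obtain ⟨h1, h2⟩ := hw i j hji hi hj hik
    have h3 : Commute (z k n) (star (z i j)) := by simpa using h2.star_star
    exact hmem ((hF _ h3 h1.star_star).mul_left h3) x
  · exact hFu.mul_left (Commute.refl _)
  · exact hFs.mul_left hn
  · rintro _ ⟨x, rfl⟩
    have e : z k n * star (z k n) * (F * z k n) = F * z k n := by
      rw [hFu.eq, ← mul_assoc, mul_assoc (z k n) (star (z k n)), h.mul_star_mul hz]
    exact congrArg (fun f => f x) e

/-- In an irreducible array the first nonzero entry of the last column is a multiple of a
projection. -/
theorem IsFirstRow.exists_circle_smul (h : IsFirstRow n k z) (hz : IsCrystalArray n z)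
    (hirr : IsIrreducibleArray n z) : ∃ c : Circle, z k n = (c : ℂ) • (star (z k n) * z k n) := by
  have hn : IsStarNormal (z k n) := ⟨h.star_mul_self hz⟩
  refine exists_circle_smul_of_no_zero_divisors h.ne_zero hn (h.mul_star_mul hz)
    fun f g hf hg hfg => or_iff_not_imp_left.2 fun h0 => ?_
  have hv := h.isVacuum_range hz (F := cfc f (z k n)) fun w h1 h2 => h1.cfc h2 f
  have hd := hv.dense hz hirr fun hbot => h0 (by
    ext x
    have : (cfc f (z k n) * z k n) x ∈ LinearMap.range
      (cfc f (z k n) * z k n : H →L[ℂ] H).toLinearMap := ⟨x, rfl⟩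
    rw [hbot] at this
    exact this)
  have e : cfc g (z k n) * z k n * (cfc f (z k n) * z k n) = 0 := by
    have h1 : Commute (z k n) (cfc f (z k n)) := ((Commute.refl (z k n)).cfc hn.star_comm_self f).symm
    have h2 : cfc g (z k n) * cfc f (z k n) = 0 := by
      rw [← cfc_mul g f (z k n) hg.continuousOn hf.continuousOn, ← cfc_const_zero ℂ (z k n)]
      exact congrArg (fun φ => cfc φ (z k n)) (funext fun x => by rw [mul_comm, hfg])
    rw [mul_assoc, ← mul_assoc (z k n), h1.eq, mul_assoc, ← mul_assoc, h2, zero_mul]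
  -- the kernel of the second operator contains the Fock vectors over the range of the first one
  have hker : arrayFockSpan n k z (LinearMap.range
      (cfc f (z k n) * z k n : H →L[ℂ] H).toLinearMap) n ≤
      LinearMap.ker (cfc g (z k n) * z k n : H →L[ℂ] H).toLinearMap := by
    have key : ∀ l v, ArrayFockVector n k z (LinearMap.range
        (cfc f (z k n) * z k n : H →L[ℂ] H).toLinearMap) l v →
        v ∈ LinearMap.ker (cfc g (z k n) * z k n : H →L[ℂ] H).toLinearMap := by
      intro l v hx
      induction hx with
      | vac hx =>
        obtain ⟨x, rfl⟩ := hx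
        exact congrArg (fun f => f x) e
      | up _ _ ih => exact ih
      | @cre l x hx hk _ =>
        have e2 := hz.last_mul_last (hx.le_max h.le) hk
        have e3 : cfc g (z k n) * z k n * z l n = 0 := by rw [mul_assoc, e2, mul_zero]
        exact congrArg (fun f => f x) e3
    exact Submodule.span_le.2 (key n)
  have htop : (⊤ : Submodule ℂ H) ≤ LinearMap.ker (cfc g (z k n) * z k n : H →L[ℂ] H).toLinearMap := by
    rw [← hd]
    exact Submodule.topologicalClosure_minimal _ hker
      (ContinuousLinearMap.isClosed_ker (cfc g (z k n) * z k n : H →L[ℂ] H))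
  ext x
  exact htop (Submodule.mem_top (x := x))

end ScalarOperator

/-! ### Symbols of operators on Fock vectors -/

section RowShiftPower

variable {B : Type*} [Ring B] [StarRing B] {n i j : ℕ} {z : ℕ → ℕ → B}

/-- Moving `z i j` past powers of `z (i + 1) n` and `z i n` lowers the first exponent, raises the
second, and turns `z i j` into `z (i + 1) j`. -/
theorem IsCrystalArray.mul_pow_mul_pow (hz : IsCrystalArray n z) (hji : j ≤ i) (hi : i < n) (p q : ℕ) :
    z i j * (z (i + 1) n ^ (p + 1) * z i n ^ (q + 1))
      = z (i + 1) n ^ p * z i n ^ (q + 2) * z (i + 1) j := by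
  have hq : ∀ q, z (i + 1) j * z i n ^ q = z i n ^ q * z (i + 1) j := fun q =>
    ((show Commute (z (i + 1) j) (z i n) from
      hz.mul_last_below (by omega) (by omega) (Nat.lt_succ_self i)).pow_right q).eq
  have h0 : z i j * z i n ^ (q + 1) = 0 := by
    rw [pow_succ', ← mul_assoc, hz.mul_last_self hi.le (by omega), zero_mul]
  induction p with
  | zero =>
    rw [zero_add, pow_one, pow_zero, one_mul, ← mul_assoc, hz.mul_last_succ hji (by omega) hi, add_mul,
      mul_assoc, h0, mul_zero, zero_add, mul_assoc, hq, ← mul_assoc, ← pow_succ']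
  | succ p ih =>
    rw [pow_succ' _ (p + 1), mul_assoc, ← mul_assoc (z i j), hz.mul_last_succ hji (by omega) hi,
      add_mul, mul_assoc, ih, pow_succ' _ p, mul_assoc (z i n), ← mul_assoc (z (i + 1) j),
      ← mul_assoc (z (i + 1) j), hz.mul_last_self hi (by omega)]
    simp only [zero_mul, mul_zero, add_zero, ← mul_assoc, ← pow_succ']

end RowShiftPower

section Monomial

variable {H : Type*} [NormedAddCommGroup H] [InnerProductSpace ℂ H] [CompleteSpace H]
  {n l m s : ℕ} {z : ℕ → ℕ → H →L[ℂ] H} {α β : ℕ → ℤ} {v : H}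

/-- The monomial in the entries of the last column in the `m` rows from `s` on, with exponents
`α` and row indices decreasing from left to right. Exponents are integers so that they can be shifted
freely; negative ones count as zero. -/
def colMonomial (n : ℕ) (z : ℕ → ℕ → H →L[ℂ] H) (s : ℕ) : ℕ → (ℕ → ℤ) → H →L[ℂ] H
  | 0, _ => 1
  | m + 1, α => z (s + m) n ^ (α (s + m)).toNat * colMonomial n z s m α

omit [CompleteSpace H] in
theorem colMonomial_add (m p : ℕ) : colMonomial n z s (m + p) α
    = colMonomial n z (s + m) p α * colMonomial n z s m α := by
  induction p with
  | zero => simp [colMonomial]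
  | succ p ih => rw [← add_assoc, colMonomial, ih, colMonomial, mul_assoc, add_assoc]

omit [CompleteSpace H] in
theorem colMonomial_congr (h : ∀ l, s ≤ l → l < s + m → α l = β l) :
    colMonomial n z s m α = colMonomial n z s m β := by
  induction m with
  | zero => rfl
  | succ m ih =>
    rw [colMonomial, colMonomial, ih fun l h1 h2 => h l h1 (by omega), h (s + m) (by omega) (by omega)]

theorem lastProj_apply_mono (hz : IsCrystalArray n z) {l' : ℕ} (hv : lastProj n z l v = v) (hl : l ≤ l')
    (hl' : l' ≤ n) : lastProj n z l' v = v := by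
  have := congrArg (fun f => f v) (hz.lastProj_mul_lastProj hl hl')
  simp only [mul_apply_eq_comp, hv] at this
  exact this

theorem lastProj_pow_apply (hz : IsCrystalArray n z) (hl : l ≤ n) {r : ℕ} (hr : r ≤ l)
    (hv : lastProj n z l v = v) (p : ℕ) : lastProj n z l ((z r n ^ p) v) = (z r n ^ p) v := by
  induction p with
  | zero => simpa using hv
  | succ p _ =>
    rw [pow_succ', mul_apply_eq_comp]
    exact congrArg (fun f => f ((z r n ^ p) v)) (hz.lastProj_mul_last hr hl)

theorem lastProj_colMonomial_apply (hz : IsCrystalArray n z) (hl : l ≤ n) (hm : s + m ≤ l + 1)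
    (hv : lastProj n z l v = v) :
    lastProj n z l (colMonomial n z s m α v) = colMonomial n z s m α v := by
  induction m with
  | zero => simpa [colMonomial] using hv
  | succ m ih =>
    rw [colMonomial, mul_apply_eq_comp]
    exact lastProj_pow_apply hz hl (by omega) (ih (by omega)) _

/-- An operator that commutes with `z l n` on the support of `z l n` commutes with its powers
there. -/
theorem apply_pow_apply (hz : IsCrystalArray n z) (hl : l ≤ n) {A : H →L[ℂ] H}
    (hA : ∀ v, lastProj n z l v = v → A (z l n v) = z l n (A v)) (hv : lastProj n z l v = v) (p : ℕ) :
    A ((z l n ^ p) v) = (z l n ^ p) (A v) := by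
  induction p with
  | zero => simp
  | succ p ih =>
    rw [pow_succ', mul_apply_eq_comp, hA _ (lastProj_pow_apply hz hl le_rfl hv p), ih,
      mul_apply_eq_comp]

theorem apply_colMonomial_apply (hz : IsCrystalArray n z) (hm : s + m ≤ n + 1) {A : H →L[ℂ] H}
    (hA : ∀ l, s ≤ l → l < s + m → ∀ v, lastProj n z l v = v → A (z l n v) = z l n (A v)) {r : ℕ}
    (hr : r ≤ s) (hv : lastProj n z r v = v) :
    A (colMonomial n z s m α v) = colMonomial n z s m α (A v) := by
  induction m with
  | zero => simp [colMonomial]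
  | succ m ih =>
    rw [colMonomial, mul_apply_eq_comp, apply_pow_apply hz (by omega) (hA (s + m) (by omega) (by omega))
      (lastProj_colMonomial_apply hz (by omega) (by omega)
        (lastProj_apply_mono hz hv (by omega) (by omega))), ih (by omega) (fun l h1 h2 => hA l h1 (by omega)),
      mul_apply_eq_comp]

theorem eq_zero_of_pow_apply (hz : IsCrystalArray n z) (hl : l ≤ n) (hv : lastProj n z l v = v) {p : ℕ}
    (h : (z l n ^ p) v = 0) : v = 0 := by
  induction p with
  | zero => simpa using h
  | succ p ih =>
    rw [pow_succ', mul_apply_eq_comp] at h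
    refine ih ?_
    have := congrArg (fun f => f ((z l n ^ p) v)) (hz.star_last_mul_last hl)
    simp only [mul_apply_eq_comp, h, map_zero, lastProj_pow_apply hz hl le_rfl hv] at this
    exact this.symm

theorem eq_zero_of_colMonomial_apply (hz : IsCrystalArray n z) (hm : s + m ≤ n + 1) {r : ℕ}
    (hr : r ≤ s) (hv : lastProj n z r v = v) (h : colMonomial n z s m α v = 0) : v = 0 := by
  induction m with
  | zero => simpa [colMonomial] using h
  | succ m ih =>
    rw [colMonomial, mul_apply_eq_comp] at h
    exact ih (by omega) (eq_zero_of_pow_apply hz (by omega) (lastProj_colMonomial_apply hz (by omega)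
      (by omega) (lastProj_apply_mono hz hv (by omega) (by omega))) h)

/-- The adjoint of `IsCrystalArray.mul_pow_mul_pow`, on the support of `z i n`. -/
theorem star_mul_pow_mul_pow_apply (hz : IsCrystalArray n z) {i j : ℕ} (hji : j ≤ i) (hi : i < n)
    (hv : lastProj n z i v = v) (p q : ℕ) :
    star (z i j) ((z (i + 1) n ^ p) ((z i n ^ (q + 1)) v))
      = (z (i + 1) n ^ (p + 1)) ((z i n ^ q) (star (z (i + 1) j) v)) := by
  have hv' := lastProj_pow_apply hz hi.le le_rfl hv
  rw [apply_pow_apply hz (l := i + 1) hi (fun w hw => ?_)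
    (lastProj_apply_mono hz (hv' (q + 1)) (Nat.le_succ i) hi), pow_succ' _ q, mul_apply_eq_comp,
    pow_succ, mul_apply_eq_comp]
  · congr 1
    have e := congrArg (fun f => f ((z i n ^ q) v)) (hz.star_mul_last_self hji (by omega) hi)
    simp only [mul_apply_eq_comp, hv'] at e
    rw [e, apply_pow_apply hz hi.le (fun w hw => ?_) hv]
    have e := congrArg (fun f => f w)
      (hz.star_mul_last_of_ne (i := i + 1) (j := j) (l := i) (by omega) (by omega) hi hi.le (by omega))
    simp only [mul_apply_eq_comp, hw] at e
    exact e
  · have e := congrArg (fun f => f w)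
      (hz.star_mul_last_of_ne (l := i + 1) hji (by omega) hi.le hi (by omega))
    simp only [mul_apply_eq_comp, hw] at e
    exact e

end Monomial

section Symbol

variable {H X : Type*} [NormedAddCommGroup H] [InnerProductSpace ℂ H] [CompleteSpace H]
  [NormedAddCommGroup X] [InnerProductSpace ℂ X] {n k : ℕ}
  {z : ℕ → ℕ → H →L[ℂ] H} {ι : X →ₗᵢ[ℂ] H} {A A' : H →L[ℂ] H} {a a' : X →L[ℂ] X} {δ δ' : ℕ → ℤ}

/-- The Fock vector with exponents `α` over the vacuum vector `ι x`. -/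
def fockMonomial (n k : ℕ) (z : ℕ → ℕ → H →L[ℂ] H) (ι : X →ₗᵢ[ℂ] H) (α : ℕ → ℤ) (x : X) : H :=
  colMonomial n z k (n + 1 - k) α (ι x)

omit [CompleteSpace H] in
theorem fockMonomial_zero (α : ℕ → ℤ) : fockMonomial n k z ι α 0 = 0 := by
  rw [fockMonomial, map_zero, map_zero]

omit [CompleteSpace H] in
theorem fockMonomial_sub (α : ℕ → ℤ) (x y : X) :
    fockMonomial n k z ι α (x - y) = fockMonomial n k z ι α x - fockMonomial n k z ι α y := by
  simp only [fockMonomial, map_sub]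

namespace IsVacuumIsometry

omit [CompleteSpace H] in
theorem pow_apply (h : IsVacuumIsometry n k z ι) (p : ℕ) (x : X) : (z k n ^ p) (ι x) = ι x := by
  induction p with
  | zero => simp
  | succ p ih => rw [pow_succ, mul_apply_eq_comp, h.fix, ih]

omit [CompleteSpace H] in
theorem fockMonomial_congr (h : IsVacuumIsometry n k z ι) {α β : ℕ → ℤ}
    (hα : ∀ l, k < l → l ≤ n → α l = β l) (x : X) :
    fockMonomial n k z ι α x = fockMonomial n k z ι β x := by
  have hk := h.le
  have e : n + 1 - k = 1 + (n - k) := by omega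
  have e1 : ∀ α : ℕ → ℤ, colMonomial n z k 1 α (ι x) = ι x := fun α => by
    simpa [colMonomial] using h.pow_apply _ x
  rw [fockMonomial, fockMonomial, e, colMonomial_add, colMonomial_add, mul_apply_eq_comp,
    mul_apply_eq_comp, e1, e1, colMonomial_congr fun l h1 h2 => hα l (by omega) (by omega)]

theorem eq_zero_of_fockMonomial (h : IsVacuumIsometry n k z ι) (hz : IsCrystalArray n z) {α : ℕ → ℤ}
    {x : X} (hx : fockMonomial n k z ι α x = 0) : x = 0 := by
  have hk := h.le
  have := eq_zero_of_colMonomial_apply hz (by omega) le_rfl (h.lastProj_apply hz x) hx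
  exact ι.injective (by rw [this, map_zero])

end IsVacuumIsometry

/-- The operator `A` acts on the Fock vectors with large exponents as `a` on the vacuum vectors,
up to a shift of the exponents by `δ`. The shift is bounded, so that large exponents remain large and
symbols can be multiplied. -/
def HasSymbol (n k : ℕ) (z : ℕ → ℕ → H →L[ℂ] H) (ι : X →ₗᵢ[ℂ] H) (A : H →L[ℂ] H) (δ : ℕ → ℤ)
    (a : X →L[ℂ] X) : Prop :=
  (∃ D : ℤ, ∀ l, |δ l| ≤ D) ∧ ∃ M : ℤ, ∀ α : ℕ → ℤ, (∀ l, M ≤ α l) → ∀ x,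
    A (fockMonomial n k z ι α x) = fockMonomial n k z ι (α + δ) (a x)

namespace HasSymbol

omit [CompleteSpace H]

theorem one : HasSymbol n k z ι 1 0 1 :=
  ⟨⟨0, fun l => by simp⟩, 0, fun α _ x => by simp⟩

theorem zero (hδ : ∃ D : ℤ, ∀ l, |δ l| ≤ D) : HasSymbol n k z ι 0 δ 0 :=
  ⟨hδ, 0, fun α _ x => by simp [fockMonomial_zero]⟩

theorem mul (h : HasSymbol n k z ι A δ a) (h' : HasSymbol n k z ι A' δ' a') :
    HasSymbol n k z ι (A * A') (δ + δ') (a * a') := by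
  obtain ⟨⟨D, hD⟩, M, hM⟩ := h
  obtain ⟨⟨D', hD'⟩, M', hM'⟩ := h'
  refine ⟨⟨D + D', fun l => (abs_add_le _ _).trans (add_le_add (hD l) (hD' l))⟩, max M' (M + D'),
    fun α hα x => ?_⟩
  rw [mul_apply_eq_comp, hM' α (fun l => (le_max_left _ _).trans (hα l)), hM (α + δ') (fun l => ?_),
    mul_apply_eq_comp, add_assoc, add_comm δ']
  have h1 := (le_max_right _ _).trans (hα l)
  have h2 := (abs_le.1 (hD' l)).1
  simp only [Pi.add_apply]
  linarith

theorem sub (h : HasSymbol n k z ι A δ a) (h' : HasSymbol n k z ι A' δ a') :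
    HasSymbol n k z ι (A - A') δ (a - a') := by
  obtain ⟨hD, M, hM⟩ := h
  obtain ⟨-, M', hM'⟩ := h'
  refine ⟨hD, max M M', fun α hα x => ?_⟩
  rw [sub_apply, hM α (fun l => (le_max_left _ _).trans (hα l)),
    hM' α (fun l => (le_max_right _ _).trans (hα l)), sub_apply, fockMonomial_sub]

theorem congr (h : HasSymbol n k z ι A δ a) (hv : IsVacuumIsometry n k z ι)
    (hδ' : ∃ D : ℤ, ∀ l, |δ' l| ≤ D) (he : ∀ l, k < l → l ≤ n → δ l = δ' l) :
    HasSymbol n k z ι A δ' a := by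
  obtain ⟨-, M, hM⟩ := h
  refine ⟨hδ', M, fun α hα x => ?_⟩
  rw [hM α hα, hv.fockMonomial_congr fun l h1 h2 => ?_]
  simp only [Pi.add_apply, he l h1 h2]

end HasSymbol

/-- The symbol is determined by the operator, because a Fock vector over a nonzero vacuum vector
does not vanish. -/
theorem HasSymbol.unique (h : HasSymbol n k z ι A δ a) (h' : HasSymbol n k z ι A δ' a')
    (hv : IsVacuumIsometry n k z ι) (hz : IsCrystalArray n z)
    (he : ∀ l, k < l → l ≤ n → δ l = δ' l) : a = a' := by
  obtain ⟨-, M, hM⟩ := (h.congr hv h'.1 he).sub h'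
  ext x
  have := hM (fun _ => M) (fun _ => le_rfl) x
  rw [sub_self, zero_apply] at this
  exact sub_eq_zero.1 (hv.eq_zero_of_fockMonomial hz this.symm)

variable [CompleteSpace X]

/-- `A` and its adjoint have the symbols `a` and `star a`. -/
def IsSymbol (n k : ℕ) (z : ℕ → ℕ → H →L[ℂ] H) (ι : X →ₗᵢ[ℂ] H) (A : H →L[ℂ] H) (δ : ℕ → ℤ)
    (a : X →L[ℂ] X) : Prop :=
  HasSymbol n k z ι A δ a ∧ HasSymbol n k z ι (star A) (-δ) (star a)

namespace IsSymbol

theorem star (h : IsSymbol n k z ι A δ a) : IsSymbol n k z ι (star A) (-δ) (star a) :=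
  ⟨h.2, by rw [star_star, star_star, neg_neg]; exact h.1⟩

theorem mul (h : IsSymbol n k z ι A δ a) (h' : IsSymbol n k z ι A' δ' a') :
    IsSymbol n k z ι (A * A') (δ + δ') (a * a') :=
  ⟨h.1.mul h'.1, by
    rw [star_mul, star_mul, show -(δ + δ') = -δ' + -δ by abel]; exact h'.2.mul h.2⟩

theorem one : IsSymbol n k z ι 1 0 1 :=
  ⟨.one, by rw [star_one, star_one, neg_zero]; exact .one⟩

theorem rangeProd {m : ℕ} {f : ℕ → H →L[ℂ] H} {δ : ℕ → ℕ → ℤ} {g : ℕ → X →L[ℂ] X}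
    (h : ∀ i < m, IsSymbol n k z ι (f i) (δ i) (g i)) :
    IsSymbol n k z ι (rangeProd m f) (∑ i ∈ Finset.range m, δ i) (rangeProd m g) := by
  induction m with
  | zero => exact .one
  | succ m ih =>
    rw [rangeProd_succ, rangeProd_succ, Finset.sum_range_succ]
    exact (ih fun i hi => h i (by omega)).mul (h m (Nat.lt_succ_self m))

theorem congr (h : IsSymbol n k z ι A δ a) (hv : IsVacuumIsometry n k z ι)
    (hδ' : ∃ D : ℤ, ∀ l, |δ' l| ≤ D) (he : ∀ l, k < l → l ≤ n → δ l = δ' l) :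
    IsSymbol n k z ι A δ' a :=
  ⟨h.1.congr hv hδ' he, h.2.congr hv (by simpa using hδ') fun l h1 h2 => by simp [he l h1 h2]⟩

end IsSymbol

/-- The shift of the exponents of Fock vectors by the entries of row `i`: the exponent of row `i`
increases and that of row `i + 1` decreases. -/
def rowShift (i l : ℕ) : ℤ := (if l = i then 1 else 0) - if l = i + 1 then 1 else 0

theorem abs_rowShift_le (i l : ℕ) : |rowShift i l| ≤ 1 := by
  unfold rowShift; split_ifs <;> simp

theorem sum_rowShift {l : ℕ} (h0 : 0 < l) (hl : l ≤ n) : ∑ i ∈ Finset.range (n + 1), rowShift i l = 0 := by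
  have key : ∀ m, ∑ i ∈ Finset.range m, rowShift i l
      = (if l < m then 1 else 0) - if l ≤ m then 1 else 0 := by
    intro m
    induction m with
    | zero => simp; omega
    | succ m ih =>
      rw [Finset.sum_range_succ, ih, rowShift]
      split_ifs <;> omega
  rw [key, if_pos (by omega), if_pos (by omega), sub_self]

theorem sum_rowShift_skip {i l : ℕ} (hi : i ≤ n) (h0 : 0 < l) (hl : l ≤ n) :
    ∑ m ∈ Finset.range n, rowShift (skip i m) l = -rowShift i l := by
  have := sum_range_skip (fun i => rowShift i l) hi
  rw [sum_rowShift h0 hl] at this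
  linarith

end Symbol

/-! ### The array on the vacuum vectors -/

section VacuumArray

variable {H X : Type*} [NormedAddCommGroup H] [InnerProductSpace ℂ H] [CompleteSpace H]
  [NormedAddCommGroup X] [InnerProductSpace ℂ X] [CompleteSpace X] {n k i j : ℕ}
  {z : ℕ → ℕ → H →L[ℂ] H} {ι : X →ₗᵢ[ℂ] H} {B : X →L[ℂ] X}

/-- The compression of an operator to the range of an isometry. -/
def compress (ι : X →ₗᵢ[ℂ] H) (A : H →L[ℂ] H) : X →L[ℂ] X :=
  ι.toContinuousLinearMap.adjoint ∘L A ∘L ι.toContinuousLinearMap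

theorem compress_apply_of_eq {A : H →L[ℂ] H} {x x' : X} (h : A (ι x) = ι x') :
    compress ι A x = x' := by
  refine ext_inner_right ℂ fun v => ?_
  change inner ℂ (ι.toContinuousLinearMap.adjoint (A (ι x))) v = _
  rw [ContinuousLinearMap.adjoint_inner_left, h]
  exact ι.inner_map_map x' v

namespace IsVacuumIsometry

theorem apply_eq_compress (h : IsVacuumIsometry n k z ι) (hz : IsCrystalArray n z) (hji : j ≤ i)
    (hi : i ≤ n) (hj : j < n) (hik : i ≠ k) (x : X) : z i j (ι x) = ι (compress ι (z i j) x) := by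
  obtain ⟨x', hx'⟩ := h.range (z i j (ι x))
  have e := congrArg (fun f => f (ι x)) (h.commute hz hji hi hj hik)
  simp only [mul_apply_eq_comp, h.fix, hx'] at e
  rw [compress_apply_of_eq e, e]

/-- The lower entries above row `k` commute with all entries of the last column that occur in Fock
vectors. -/
theorem isSymbol_of_lt (h : IsVacuumIsometry n k z ι) (hz : IsCrystalArray n z) (hji : j ≤ i)
    (hi : i < k) (hB : ∀ x, z i j (ι x) = ι (B x)) : IsSymbol n k z ι (z i j) (rowShift i) B := by
  have hk := h.le
  have hcongr : ∀ {α β : ℕ → ℤ} {x : X}, (∀ l, k < l → β l = α l) →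
      fockMonomial n k z ι α x = fockMonomial n k z ι β x := fun hl =>
    h.fockMonomial_congr (fun l h1 _ => (hl l h1).symm) _
  have h0 : ∀ l, k < l → rowShift i l = 0 := fun l hl => by
    rw [rowShift, if_neg (by omega), if_neg (by omega), sub_self]
  refine ⟨⟨⟨1, abs_rowShift_le i⟩, 0, fun α _ x => ?_⟩,
    ⟨⟨1, fun l => by simpa using abs_rowShift_le i l⟩, 0, fun α _ x => ?_⟩⟩
  · rw [fockMonomial, apply_colMonomial_apply hz (by omega) (fun l h1 h2 v _ => ?_) le_rfl
      (h.lastProj_apply hz x), hB]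
    · exact hcongr fun l hl => by simp [h0 l hl]
    · have e := congrArg (fun f => f v) (show z i j * z l n = z l n * z i j from ?_)
      · exact e
      rcases Nat.eq_or_lt_of_le (show i + 1 ≤ l by omega) with rfl | h3
      · rw [hz.mul_last_succ hji (by omega) (by omega), h.zero i hi, zero_mul, add_zero]
      · exact hz.mul_last_far hji (by omega) h3 (by omega)
  · rw [fockMonomial, apply_colMonomial_apply hz (by omega) (fun l h1 h2 v hv => ?_) le_rfl
      (h.lastProj_apply hz x), h.star_apply hz hji (by omega) (by omega) (by omega) hB]
    · exact hcongr fun l hl => by simp [h0 l hl]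
    · have e := congrArg (fun f => f v)
        (hz.star_mul_last_of_ne (l := l) hji (by omega) (by omega) (by omega) (by omega))
      simp only [mul_apply_eq_comp, hv] at e
      exact e

omit [CompleteSpace X] [CompleteSpace H] in
theorem fockMonomial_split (hki : k ≤ i) (hi : i < n) (α : ℕ → ℤ) (x : X) :
    fockMonomial n k z ι α x = colMonomial n z (i + 2) (n - 1 - i) α ((z (i + 1) n ^ (α (i + 1)).toNat)
      ((z i n ^ (α i).toNat) (colMonomial n z k (i - k) α (ι x)))) := by
  have e : n + 1 - k = (i - k + 1 + 1) + (n - 1 - i) := by omega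
  have e1 : k + (i - k) = i := by omega
  have e2 : k + (i - k + 1) = i + 1 := by omega
  have e3 : k + (i - k + 1 + 1) = i + 2 := by omega
  rw [fockMonomial, e, colMonomial_add, e3, colMonomial, e2, colMonomial, e1]
  rfl

/-- From row `k` on, the lower entries of row `i` act on the vacuum vectors like row `i + 1`, at the
price of an exchange of a factor `z (i + 1) n` for a factor `z i n`. -/
theorem isSymbol_of_ge (h : IsVacuumIsometry n k z ι) (hz : IsCrystalArray n z) (hji : j ≤ i)
    (hki : k ≤ i) (hi : i < n) (hB : ∀ x, z (i + 1) j (ι x) = ι (B x)) :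
    IsSymbol n k z ι (z i j) (rowShift i) B := by
  have hs1 : rowShift i (i + 1) = -1 := by simp [rowShift]
  have hs2 : rowShift i i = 1 := by simp [rowShift]
  have hs3 : ∀ l, l < i ∨ i + 1 < l → rowShift i l = 0 := fun l hl => by
    rw [rowShift, if_neg (by omega), if_neg (by omega), sub_self]
  have hlev : ∀ (α : ℕ → ℤ) x, lastProj n z i (colMonomial n z k (i - k) α (ι x))
      = colMonomial n z k (i - k) α (ι x) := fun α x =>
    lastProj_colMonomial_apply hz hi.le (by omega)
      (lastProj_apply_mono hz (h.lastProj_apply hz x) hki hi.le)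
  have hlev' : ∀ (α : ℕ → ℤ) p q x, lastProj n z (i + 1) ((z (i + 1) n ^ p) ((z i n ^ q)
      (colMonomial n z k (i - k) α (ι x)))) = (z (i + 1) n ^ p) ((z i n ^ q)
      (colMonomial n z k (i - k) α (ι x))) := fun α p q x =>
    lastProj_pow_apply hz hi le_rfl (lastProj_apply_mono hz
      (lastProj_pow_apply hz hi.le le_rfl (hlev α x) q) (Nat.le_succ i) hi) p
  refine ⟨⟨⟨1, abs_rowShift_le i⟩, 1, fun α hα x => ?_⟩,
    ⟨⟨1, fun l => by simpa using abs_rowShift_le i l⟩, 1, fun α hα x => ?_⟩⟩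
  · obtain ⟨p, hp⟩ : ∃ p, (α (i + 1)).toNat = p + 1 := ⟨(α (i + 1)).toNat - 1, by
      have := hα (i + 1); omega⟩
    obtain ⟨q, hq⟩ : ∃ q, (α i).toNat = q + 1 := ⟨(α i).toNat - 1, by have := hα i; omega⟩
    have hp' : ((α + rowShift i) (i + 1)).toNat = p := by
      rw [Pi.add_apply, hs1]; omega
    have hq' : ((α + rowShift i) i).toNat = q + 2 := by
      rw [Pi.add_apply, hs2]; omega
    rw [fockMonomial_split hki hi, fockMonomial_split hki hi, hp, hq, hp', hq',
      apply_colMonomial_apply hz (by omega) (fun l h1 h2 v _ => ?_) (Nat.le_succ (i + 1))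
        (hlev' α _ _ x)]
    · have e := congrArg (fun f => f (colMonomial n z k (i - k) α (ι x))) (hz.mul_pow_mul_pow hji hi p q)
      simp only [mul_apply_eq_comp] at e
      rw [e, apply_colMonomial_apply hz (by omega) (fun l h1 h2 v _ => ?_) le_rfl
        (h.lastProj_apply hz x), hB]
      · rw [colMonomial_congr (β := α + rowShift i) fun l h1 h2 => ?_,
          colMonomial_congr (s := k) (β := α + rowShift i) fun l h1 h2 => ?_]
        · rw [Pi.add_apply, hs3 l (by omega), add_zero]
        · rw [Pi.add_apply, hs3 l (by omega), add_zero]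
      · exact congrArg (fun f => f v)
          (hz.mul_last_below (i := i + 1) (j := j) (l := l) hi (by omega) (by omega))
    · exact congrArg (fun f => f v) (hz.mul_last_far (l := l) hji (by omega) (by omega) (by omega))
  · obtain ⟨q, hq⟩ : ∃ q, (α i).toNat = q + 1 := ⟨(α i).toNat - 1, by have := hα i; omega⟩
    have hp' : ((α + -rowShift i) (i + 1)).toNat = (α (i + 1)).toNat + 1 := by
      have := hα (i + 1)
      rw [Pi.add_apply, Pi.neg_apply, hs1]; omega
    have hq' : ((α + -rowShift i) i).toNat = q := by
      rw [Pi.add_apply, Pi.neg_apply, hs2]; omega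
    rw [fockMonomial_split hki hi, fockMonomial_split hki hi, hq, hp', hq',
      apply_colMonomial_apply hz (by omega) (fun l h1 h2 v hv => ?_) (Nat.le_succ (i + 1))
        (hlev' α _ _ x), star_mul_pow_mul_pow_apply hz hji hi (hlev α x),
      apply_colMonomial_apply hz (by omega) (fun l h1 h2 v hv => ?_) le_rfl (h.lastProj_apply hz x),
      h.star_apply hz (by omega) hi (by omega) (by omega) hB]
    · rw [colMonomial_congr (β := α + -rowShift i) fun l h1 h2 => ?_,
          colMonomial_congr (s := k) (β := α + -rowShift i) fun l h1 h2 => ?_]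
      · rw [Pi.add_apply, Pi.neg_apply, hs3 l (by omega), neg_zero, add_zero]
      · rw [Pi.add_apply, Pi.neg_apply, hs3 l (by omega), neg_zero, add_zero]
    · have e := congrArg (fun f => f v)
        (hz.star_mul_last_of_ne (i := i + 1) (l := l) (by omega : j ≤ i + 1) (by omega) hi (by omega)
          (by omega))
      simp only [mul_apply_eq_comp, hv] at e
      exact e
    · have e := congrArg (fun f => f v)
        (hz.star_mul_last_of_ne (l := l) hji (by omega) hi.le (by omega) (by omega))
      simp only [mul_apply_eq_comp, hv] at e
      exact e

omit [CompleteSpace X] [CompleteSpace H] in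
theorem fockMonomial_split_last (hk : k ≤ n) (α : ℕ → ℤ) (x : X) :
    fockMonomial n k z ι α x = (z n n ^ (α n).toNat) (colMonomial n z k (n - k) α (ι x)) := by
  have e : n + 1 - k = n - k + 1 := by omega
  have e1 : k + (n - k) = n := by omega
  rw [fockMonomial, e, colMonomial, e1]
  rfl

/-- In Fock vectors with large exponents the last creation operator occurs, and its range is
annihilated by the other entries of row `n` and by their adjoints. -/
theorem isSymbol_last_row (h : IsVacuumIsometry n k z ι) (hz : IsCrystalArray n z) (hj : j < n) :
    IsSymbol n k z ι (z n j) (rowShift n) 0 := by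
  refine ⟨⟨⟨1, abs_rowShift_le n⟩, 1, fun α hα x => ?_⟩,
    ⟨⟨1, fun l => by simpa using abs_rowShift_le n l⟩, 1, fun α hα x => ?_⟩⟩
  all_goals
    obtain ⟨q, hq⟩ : ∃ q, (α n).toNat = q + 1 := ⟨(α n).toNat - 1, by have := hα n; omega⟩
    rw [fockMonomial_split_last h.le, hq, pow_succ', mul_apply_eq_comp]
    simp only [star_zero, zero_apply, fockMonomial_zero]
  · exact congrArg (fun f => f ((z n n ^ q) (colMonomial n z k (n - k) α (ι x)))) (hz.mul_last_self le_rfl hj)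
  · exact congrArg (fun f => f ((z n n ^ q) (colMonomial n z k (n - k) α (ι x)))) (hz.star_mul_last_last hj)

/-- The last entry is an isometry and raises the last exponent. -/
theorem isSymbol_last (h : IsVacuumIsometry n k z ι) (hz : IsCrystalArray n z) :
    IsSymbol n k z ι (z n n) (rowShift n) 1 := by
  have hs1 : rowShift n n = 1 := by simp [rowShift]
  have hs3 : ∀ l, l < n → rowShift n l = 0 := fun l hl => by
    rw [rowShift, if_neg (by omega), if_neg (by omega), sub_self]
  have hk := h.le
  refine ⟨⟨⟨1, abs_rowShift_le n⟩, 1, fun α hα x => ?_⟩,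
    ⟨⟨1, fun l => by simpa using abs_rowShift_le n l⟩, 1, fun α hα x => ?_⟩⟩
  · have hq : ((α + rowShift n) n).toNat = (α n).toNat + 1 := by
      have := hα n
      rw [Pi.add_apply, hs1]; omega
    rw [fockMonomial_split_last hk, fockMonomial_split_last hk, hq, pow_succ', mul_apply_eq_comp,
      colMonomial_congr (β := α + rowShift n) fun l h1 h2 => ?_]
    · rfl
    · rw [Pi.add_apply, hs3 l (by omega), add_zero]
  · have hq : (α n).toNat = ((α + -rowShift n) n).toNat + 1 := by
      have := hα n
      rw [Pi.add_apply, Pi.neg_apply, hs1]; omega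
    rw [fockMonomial_split_last hk, fockMonomial_split_last hk, hq, pow_succ', mul_apply_eq_comp,
      ← mul_apply_eq_comp, hz.star_last_mul_last le_rfl, hz.lastProj_last,
      colMonomial_congr (β := α + -rowShift n) fun l h1 h2 => ?_]
    · rw [star_one]; rfl
    · rw [Pi.add_apply, Pi.neg_apply, hs3 l (by omega), neg_zero, add_zero]

end IsVacuumIsometry

/-- The lower entries of the array on the vacuum vectors. -/
def lowerVacuumArray (n k : ℕ) (z : ℕ → ℕ → H →L[ℂ] H) (ι : X →ₗᵢ[ℂ] H) (i j : ℕ) : X →L[ℂ] X :=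
  if i < n then compress ι (z (skip k i) j) else if j < n then 0 else 1

/-- The array on the vacuum vectors: the lower entries of `z` restricted, with row `k` and the last
column deleted, bordered by an identity, and completed by the adjoint relation. -/
def vacuumArray (n k : ℕ) (z : ℕ → ℕ → H →L[ℂ] H) (ι : X →ₗᵢ[ℂ] H) (i j : ℕ) : X →L[ℂ] X :=
  if j ≤ i then lowerVacuumArray n k z ι i j
  else star (rangeProd n fun m => lowerVacuumArray n k z ι (skip i m) (skip j m))

namespace IsVacuumIsometry

theorem isSymbol_lower (h : IsVacuumIsometry n k z ι) (hz : IsCrystalArray n z) (hji : j ≤ i)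
    (hi : i ≤ n) : IsSymbol n k z ι (z i j) (rowShift i) (lowerVacuumArray n k z ι i j) := by
  have hk := h.le
  unfold lowerVacuumArray
  split_ifs with h1 h2
  · unfold skip
    split_ifs with h3
    · exact h.isSymbol_of_lt hz hji h3 fun x =>
        h.apply_eq_compress hz hji hi (by omega) (by omega) x
    · exact h.isSymbol_of_ge hz hji (by omega) h1 fun x =>
        h.apply_eq_compress hz (by omega) h1 (by omega) (by omega) x
  · obtain rfl : i = n := by omega
    exact h.isSymbol_last_row hz h2
  · obtain ⟨rfl, rfl⟩ : i = n ∧ j = n := by omega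
    exact h.isSymbol_last hz

theorem isSymbol (h : IsVacuumIsometry n k z ι) (hz : IsCrystalArray n z) (hi : i ≤ n) (hj : j ≤ n) :
    IsSymbol n k z ι (z i j) (rowShift i) (vacuumArray n k z ι i j) := by
  unfold vacuumArray
  split_ifs with hji
  · exact h.isSymbol_lower hz hji hi
  · rw [hz.eq_star_rangeProd hi hj]
    refine (IsSymbol.rangeProd fun m hm => h.isSymbol_lower hz
      (skip_le_skip (by omega) m) (skip_le i hm)).star.congr h ⟨1, abs_rowShift_le i⟩ fun l h1 h2 => ?_
    rw [Pi.neg_apply, Finset.sum_apply, sum_rowShift_skip hi (by omega) h2, neg_neg]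

/-- The operators on the vacuum vectors form a crystal array, because the symbols satisfy all
relations that the operators satisfy. -/
theorem isCrystalArray (h : IsVacuumIsometry n k z ι) (hz : IsCrystalArray n z) :
    IsCrystalArray n (vacuumArray n k z ι) := by
  have hs : ∀ {i j}, i ≤ n → j ≤ n →
      IsSymbol n k z ι (z i j) (rowShift i) (vacuumArray n k z ι i j) := fun hi hj => h.isSymbol hz hi hj
  have hb : ∀ i k : ℕ, ∃ D : ℤ, ∀ l, |(rowShift i + rowShift k) l| ≤ D := fun i k =>
    ⟨1 + 1, fun l => (abs_add_le _ _).trans (add_le_add (abs_rowShift_le i l) (abs_rowShift_le k l))⟩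
  have hzero : ∀ {i j k' l}, i ≤ n → j ≤ n → k' ≤ n → l ≤ n → z i j * z k' l = 0 →
      vacuumArray n k z ι i j * vacuumArray n k z ι k' l = 0 := fun hi hj hk hl e => by
    have := (hs hi hj).mul (hs hk hl)
    rw [e] at this
    exact this.1.unique (.zero (hb _ _)) h hz fun _ _ _ => rfl
  have hcomm : ∀ {i j k' l}, i ≤ n → j ≤ n → k' ≤ n → l ≤ n →
      HasSymbol n k z ι (z k' l * z i j) (rowShift i + rowShift k')
        (vacuumArray n k z ι k' l * vacuumArray n k z ι i j) := fun hi hj hk hl => by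
    rw [add_comm]
    exact ((hs hk hl).mul (hs hi hj)).1
  refine ⟨fun i j l h1 h2 h3 => hzero h1 (by omega) h1 h2 (hz.row i j l h1 h2 h3),
    fun i k' j h1 h2 h3 => hzero (by omega) h2 h1 h2 (hz.col i k' j h1 h2 h3),
    fun i k' j l h1 h2 h3 h4 => ?_,
    fun i k' j l h1 h2 h3 h4 h5 => hzero (by omega) h2 h1 (by omega) (hz.anti_zero i k' j l h1 h2 h3 h4 h5),
    fun i k' j l h1 h2 h3 h4 h5 => ?_, fun i k' j l h1 h2 h3 h4 h5 => ?_, ?_, fun r s hr hs' => ?_⟩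
  · have e := hz.anti_comm i k' j l h1 h2 h3 h4
    have h6 := ((hs (show i ≤ n by omega) h2).mul (hs h1 (show j ≤ n by omega))).1
    rw [e] at h6
    exact h6.unique (hcomm (by omega) h2 h1 (by omega)) h hz fun _ _ _ => rfl
  · have e := hz.diag_adjacent i k' j l h1 h2 h3 h4 h5
    have h6 := ((hs (show i ≤ n by omega) (show j ≤ n by omega)).mul (hs h1 h2)).1.sub
      (hcomm (show i ≤ n by omega) (show j ≤ n by omega) h1 h2)
    rw [e] at h6
    exact h6.unique ((hs (show i ≤ n by omega) h2).mul (hs h1 (show j ≤ n by omega))).1 h hz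
      fun _ _ _ => rfl
  · have e := hz.diag_far i k' j l h1 h2 h3 h4 h5
    have h6 := ((hs (show i ≤ n by omega) (show j ≤ n by omega)).mul (hs h1 h2)).1
    rw [e] at h6
    exact h6.unique (hcomm (by omega) (by omega) h1 h2) h hz fun _ _ _ => rfl
  · have h6 := (IsSymbol.rangeProd (k := k) (z := z) (ι := ι) (m := n + 1) (f := fun i => z i i)
      (δ := rowShift) (g := fun i => vacuumArray n k z ι i i)
      fun i hi => hs (by omega) (by omega)).1
    rw [hz.det_one] at h6
    exact h6.unique .one h hz fun l h1 h2 => by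
      rw [Finset.sum_apply, sum_rowShift (by omega) h2]; rfl
  · have h6 := (IsSymbol.rangeProd (k := k) (z := z) (ι := ι) (m := n)
      (f := fun m => z (skip r m) (skip s m)) (δ := fun m => rowShift (skip r m))
      (g := fun m => vacuumArray n k z ι (skip r m) (skip s m))
      fun i hi => hs (skip_le r hi) (skip_le s hi)).1
    rw [← hz.star_eq r s hr hs'] at h6
    refine (hs hr hs').2.unique h6 h hz fun l h1 h2 => ?_
    rw [Pi.neg_apply, Finset.sum_apply, sum_rowShift_skip hr (by omega) h2]

theorem isTrivialAt (h : IsVacuumIsometry n k z ι) (hz : IsCrystalArray n z) :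
    IsTrivialAt n (vacuumArray n k z ι) := by
  have h1 : vacuumArray n k z ι n n = 1 := by
    simp [vacuumArray, lowerVacuumArray]
  refine ⟨h1, fun i hi => ⟨?_, ?_⟩⟩
  · have := (h.isCrystalArray hz).col i n n le_rfl le_rfl hi
    rwa [h1, mul_one] at this
  · simp [vacuumArray, lowerVacuumArray, hi, hi.le]

theorem isVacuumEmbedding (h : IsVacuumIsometry n k z ι) (hz : IsCrystalArray n z) :
    IsVacuumEmbedding n k z (vacuumArray n k z ι) ι := by
  have hk := h.le
  refine ⟨h, fun i j x hji hi => ?_, fun i j x hji hki hi => ?_⟩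
  · rw [vacuumArray, if_pos hji, lowerVacuumArray, if_pos (by omega), skip, if_pos hi]
    exact h.apply_eq_compress hz hji (by omega) (by omega) (by omega) x
  · rw [vacuumArray, if_pos hji, lowerVacuumArray, if_pos hi, skip, if_neg (by omega)]
    exact h.apply_eq_compress hz (by omega) hi (by omega) (by omega) x

end IsVacuumIsometry

end VacuumArray

open OperatorArray

/-! ### Classification of the irreducible arrays -/

section Classification

section Step

variable {H X X' : Type*} [NormedAddCommGroup H] [InnerProductSpace ℂ H] [CompleteSpace H]
  [NormedAddCommGroup X] [InnerProductSpace ℂ X] [CompleteSpace X]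
  [NormedAddCommGroup X'] [InnerProductSpace ℂ X'] [CompleteSpace X'] {n k : ℕ}
  {z : ℕ → ℕ → H →L[ℂ] H} {y : ℕ → ℕ → X →L[ℂ] X} {y' : ℕ → ℕ → X' →L[ℂ] X'} {ι : X →ₗᵢ[ℂ] H}

/-- The array on the vacuum vectors of an irreducible array is irreducible. -/
theorem IsVacuumEmbedding.isIrreducibleArray_vacuum (h : IsVacuumEmbedding (n + 1) k z y ι)
    (hz : IsCrystalArray (n + 1) z) (hirr : IsIrreducibleArray (n + 1) z) (hy : IsCrystalArray n y)
    (hX : Nontrivial X) : IsIrreducibleArray n y := by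
  refine ⟨hX, fun W hW hm => or_iff_not_imp_left.2 fun hne => ?_⟩
  have hv := h.isVacuum_map hz (W := W)
    (fun i j hji hi x hx => hm i j (by omega) (by omega) x hx)
    fun i j hji hi x hx => hy.star_apply_mem hm (by omega) (by omega) hx
  have hd := hv.dense hz hirr fun h0 => hne (Submodule.map_injective_of_injective ι.injective (by
    rw [h0, Submodule.map_bot]))
  have hcl : IsClosed (W.map ι.toLinearMap : Set H) := by
    rw [Submodule.map_coe]
    exact ι.isometry.isClosedEmbedding.isClosedMap _ hW
  -- the projection onto the vacuum vectors annihilates all other Fock vectors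
  have hproj : arrayFockSpan (n + 1) k z (W.map ι.toLinearMap) (n + 1) ≤
      (W.map ι.toLinearMap).comap (z k (n + 1)).toLinearMap := by
    have key : ∀ l v, ArrayFockVector (n + 1) k z (W.map ι.toLinearMap) l v →
        v ∈ (W.map ι.toLinearMap).comap (z k (n + 1)).toLinearMap := by
      intro l v hx
      induction hx with
      | vac hx => exact hv.cre_mem _ hx
      | up _ _ ih => exact ih
      | @cre l x hx hk _ =>
        have e := congrArg (fun f => f x) (hz.last_mul_last (hx.le_max h.le) hk)
        simp only [mul_apply_eq_comp, zero_apply] at e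
        rw [Submodule.mem_comap]
        simp only [ContinuousLinearMap.coe_coe]
        rw [e]
        exact Submodule.zero_mem _
    exact Submodule.span_le.2 (key _)
  have htop := Submodule.topologicalClosure_minimal _ hproj (hcl.preimage (z k (n + 1)).continuous)
  rw [hd] at htop
  rw [eq_top_iff]
  intro x _
  have : z k (n + 1) (ι x) ∈ W.map ι.toLinearMap := htop (Submodule.mem_top (x := ι x))
  rw [h.fix] at this
  obtain ⟨w, hw, hwx⟩ := this
  rwa [← ι.injective hwx]

omit [CompleteSpace H] [CompleteSpace X] [CompleteSpace X'] in
theorem IsVacuumEmbedding.comp_equiv (h : IsVacuumEmbedding (n + 1) k z y ι) {U : X' ≃ₗᵢ[ℂ] X}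
    (hU : ∀ i j, i ≤ n → j ≤ n → ∀ v, U (y' i j v) = y i j (U v)) :
    IsVacuumEmbedding (n + 1) k z y' (ι.comp U.toLinearIsometry) := by
  have hk := h.le
  refine ⟨⟨h.le, h.zero, fun x => h.fix (U x), fun v => ?_⟩, fun i j x hji hi => ?_,
    fun i j x hji hki hi => ?_⟩
  · obtain ⟨x, hx⟩ := h.range v
    exact ⟨U.symm x, by rw [hx]; exact congrArg ι (U.apply_symm_apply x).symm⟩
  · change z i j (ι (U x)) = ι (U (y' i j x))
    rw [h.below i j _ hji hi, hU i j (by omega) (by omega)]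
  · change z (i + 1) j (ι (U x)) = ι (U (y' i j x))
    rw [h.above i j _ hji hki hi, hU i j (by omega) (by omega)]

omit [CompleteSpace H] [CompleteSpace X] [CompleteSpace X'] in
theorem IsVacuumEmbedding.IsCyclic.comp_equiv (h : IsVacuumEmbedding.IsCyclic n k z ι)
    (U : X' ≃ₗᵢ[ℂ] X) : IsVacuumEmbedding.IsCyclic n k z (ι.comp U.toLinearIsometry) :=
  fun V hV hι hR => h V hV (fun x => by
    have := hι (U.symm x)
    change ι (U (U.symm x)) ∈ V at this
    rwa [U.apply_symm_apply] at this) hR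

/-- An irreducible array of size one acts on a line. -/
theorem IsIrreducibleArray.arrayEquiv_unit (hz : IsCrystalArray 0 z) (hirr : IsIrreducibleArray 0 z) :
    ArrayEquiv 0 z (ofWord []).op := by
  have h1 : z 0 0 = 1 := by
    have := hz.det_one
    rwa [rangeProd_succ, rangeProd_zero, one_mul] at this
  have := hirr.1
  obtain ⟨v, hv⟩ := exists_norm_eq H (zero_le_one : (0 : ℝ) ≤ 1)
  have hv0 : v ≠ 0 := fun h0 => by simp [h0] at hv
  obtain ⟨U, -⟩ := exists_unitary_of_inner_eq (ι := Unit) (f := fun _ => v) (g := fun _ => (1 : ℂ))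
    (fun V hV hm => (hirr.2 V hV fun i j hi hj w hw => by
      obtain ⟨rfl, rfl⟩ : i = 0 ∧ j = 0 := by omega
      rw [h1]; exact hw).resolve_left fun h0 => hv0 (by
        have := hm ()
        rwa [h0] at this))
    (fun V _ hm => (IsSimpleOrder.eq_bot_or_eq_top V).resolve_left fun h0 => by
      have := hm ()
      rw [h0, Submodule.mem_bot] at this
      exact one_ne_zero this)
    fun _ _ => by
      rw [inner_self_eq_norm_sq_to_K, hv]; simp
  refine ⟨U, fun i j hi hj w => ?_⟩
  obtain ⟨rfl, rfl⟩ : i = 0 ∧ j = 0 := by omega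
  rw [h1]
  rfl

/-- The phases may be chosen such that the first nonzero entry of the last column becomes a
projection. -/
theorem exists_prod_eq_one_and_eq (hk : k ≤ n + 1) (c : Circle) :
    ∃ σ : ℕ → Circle, ∏ i ∈ Finset.range (n + 2), σ i = 1 ∧ σ k = c := by
  refine ⟨fun i => if i = k then c else if i = skip k 0 then c⁻¹ else 1, ?_, if_pos rfl⟩
  have hs : ∀ i, skip k i ≠ k := fun i => by unfold skip; split_ifs <;> omega
  have hs' : ∀ i, skip k (i + 1) ≠ skip k 0 := fun i => by unfold skip; split_ifs <;> omega
  rw [← prod_range_skip _ hk, if_pos rfl, Finset.prod_range_succ', if_neg (hs 0), if_pos rfl,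
    Finset.prod_eq_one fun i _ => by rw [if_neg (hs (i + 1)), if_neg (hs' i)], one_mul,
    mul_inv_cancel]

/-- The induction step: an irreducible array whose vacuum array is a multiple of the array of a word
is a multiple of the array of the word extended by a coset representative. -/
theorem IsVacuumEmbedding.exists_arrayEquiv (h : IsVacuumEmbedding (n + 1) k z y ι)
    (hz : IsCrystalArray (n + 1) z) (hirr : IsIrreducibleArray (n + 1) z) (hX : Nontrivial X)
    {τ : ℕ → Circle} (hτ : ∏ i ∈ Finset.range (n + 1), τ i = 1) {a : List ℕ} (ha : IsNormalWord n a)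
    (he : ArrayEquiv n y (scaleRows τ (ofWord a).op)) :
    ∃ τ' : ℕ → Circle, ∏ i ∈ Finset.range (n + 2), τ' i = 1 ∧
      ArrayEquiv (n + 1) z (scaleRows τ' (ofWord (List.range' k (n + 1 - k) ++ a)).op) := by
  have hk := h.le
  obtain ⟨τ₁, hτ₁, hτ₁'⟩ : ∃ τ₁ : ℕ → Circle, (∀ i ≤ n, τ₁ i = τ i) ∧ τ₁ (n + 1) = 1 :=
    ⟨fun i => if i ≤ n then τ i else 1, fun i hi => if_pos hi, if_neg (by omega)⟩
  have hprod : ∏ i ∈ Finset.range (n + 2), τ₁ i = 1 := by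
    rw [Finset.prod_range_succ, hτ₁', mul_one, ← hτ]
    exact Finset.prod_congr rfl fun i hi => hτ₁ i (by rw [Finset.mem_range] at hi; omega)
  have hword : IsCrystalArray (n + 1) (ofWord a).op :=
    isCrystalArray_ofWord fun r hr => (ha.lt r hr).trans (Nat.lt_succ_self n)
  have htriv := isTrivialAt_ofWord (n := n + 1) fun r hr => Nat.succ_lt_succ (ha.lt r hr)
  set Y : OperatorArray := { ofWord a with op := scaleRows τ₁ (ofWord a).op } with hY
  have hYc : IsCrystalArray (n + 1) Y.op := hword.scaleRows hprod
  have hYt : IsTrivialAt (n + 1) Y.op := by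
    refine ⟨?_, fun i hi => ⟨?_, ?_⟩⟩
    · change (τ₁ (n + 1) : ℂ) • (ofWord a).op (n + 1) (n + 1) = 1
      rw [htriv.1, hτ₁', Circle.coe_one, one_smul]
    · change (τ₁ i : ℂ) • (ofWord a).op i (n + 1) = 0
      rw [(htriv.2 i hi).1, smul_zero]
    · change (τ₁ (n + 1) : ℂ) • (ofWord a).op (n + 1) i = 0
      rw [(htriv.2 i hi).2, smul_zero]
  have hc : ∀ r ∈ List.range' k (n + 1 - k), r < n + 1 := fun r hr => by
    rw [List.mem_range'_1] at hr; omega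
  obtain ⟨ι', h', hc'⟩ := exists_isVacuumEmbedding hYc hYt (n + 1 - k) k (by omega)
  obtain ⟨U, hU⟩ := he
  have hU' : ∀ i j, i ≤ n → j ≤ n → ∀ v, U (y i j v) = Y.op i j (U v) := fun i j hi hj v => by
    rw [hU i j hi hj v]
    change ((τ i : ℂ) • (ofWord a).op i j) (U v) = ((τ₁ i : ℂ) • (ofWord a).op i j) (U v)
    rw [hτ₁ i hi]
  have hmodel := isCrystalArray_prepend hc hYc
  have h'' := h'.comp_equiv (U := U) hU'
  have e1 : ArrayEquiv (n + 1) z (prepend (List.range' k (n + 1 - k)) Y).op :=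
    h.arrayEquiv hz h'' hmodel ((h.isVacuum hz).dense hz hirr fun h0 => by
      obtain ⟨x, hx⟩ := exists_ne (0 : X)
      have : ι x ∈ LinearMap.range ι.toLinearMap := ⟨x, rfl⟩
      rw [h0, Submodule.mem_bot] at this
      exact hx (ι.injective (this.trans ι.map_zero.symm)))
      (h''.dense_of_isCyclic hmodel (hc'.comp_equiv U))
  obtain ⟨h3, h4⟩ := prepend_scaleRows_equiv hc hword hprod
  exact ⟨_, h3, by rw [ofWord_append]; exact e1.trans h4⟩

end Step

/-- Every irreducible crystal array is, up to phases, the array of a normal word. -/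
theorem IsIrreducibleArray.exists_isNormalWord (n : ℕ) : ∀ {H : Type*} [NormedAddCommGroup H]
    [InnerProductSpace ℂ H] [CompleteSpace H] {z : ℕ → ℕ → H →L[ℂ] H}, IsCrystalArray n z →
    IsIrreducibleArray n z → ∃ (τ : ℕ → Circle) (a : List ℕ), ∏ i ∈ Finset.range (n + 1), τ i = 1 ∧
      IsNormalWord n a ∧ ArrayEquiv n z (CrystalSU.scaleRows τ (ofWord a).op) := by
  induction n with
  | zero =>
    intro H _ _ _ z hz hirr
    exact ⟨1, [], by simp, .nil, by rw [scaleRows_one]; exact hirr.arrayEquiv_unit hz⟩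
  | succ n ih =>
    intro H _ _ _ z hz hirr
    have := hirr.1
    obtain ⟨k, hk⟩ := hz.exists_isFirstRow
    obtain ⟨c, hc⟩ := hk.exists_circle_smul hz hirr
    obtain ⟨σ, hσ, hσk⟩ := exists_prod_eq_one_and_eq hk.le c⁻¹
    have hz' := hz.scaleRows hσ
    have hirr' := hirr.scaleRows σ
    set Q : H →L[ℂ] H := star (z k (n + 1)) * z k (n + 1) with hQ
    have hQz : CrystalSU.scaleRows σ z k (n + 1) = Q := by
      rw [CrystalSU.scaleRows, hσk, hc, smul_smul, ← Circle.coe_mul, inv_mul_cancel, Circle.coe_one, one_smul]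
    have hQQ : Q * Q = Q := by
      rw [hQ, mul_assoc, hk.mul_star_mul hz]
    have hcl : IsClosed (LinearMap.range Q.toLinearMap : Set H) := by
      have : LinearMap.range Q.toLinearMap = LinearMap.ker (1 - Q).toLinearMap := by
        ext v
        rw [LinearMap.mem_ker]
        simp only [ContinuousLinearMap.coe_coe, sub_apply, one_apply_eq_self, sub_eq_zero]
        constructor
        · rintro ⟨x, rfl⟩
          exact (congrArg (fun f => f x) hQQ).symm
        · exact fun h => ⟨v, h.symm⟩
      rw [this]
      exact ContinuousLinearMap.isClosed_ker (1 - Q)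
    have := hcl.completeSpace_coe
    have hι : IsVacuumIsometry (n + 1) k (CrystalSU.scaleRows σ z)
        (LinearMap.range Q.toLinearMap).subtypeₗᵢ := by
      refine ⟨hk.le, fun i hi => by rw [CrystalSU.scaleRows, hk.zero i hi, smul_zero], ?_, fun v => ?_⟩
      · rintro ⟨_, x, rfl⟩
        rw [hQz]
        exact congrArg (fun f => f x) hQQ
      · exact ⟨⟨Q v, v, rfl⟩, by rw [hQz]; rfl⟩
    have hX : Nontrivial (LinearMap.range Q.toLinearMap) := by
      rw [Submodule.nontrivial_iff_ne_bot]
      intro h0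
      refine hk.ne_zero ?_
      have hQ0 : Q = 0 := by
        ext v
        have : Q v ∈ LinearMap.range Q.toLinearMap := ⟨v, rfl⟩
        rw [h0] at this
        exact this
      rw [hc, hQ0, smul_zero]
    have hy := (hι.isCrystalArray hz').restrict (hι.isTrivialAt hz').1
    have hemb := hι.isVacuumEmbedding hz'
    obtain ⟨τ, a, hτ, ha, he⟩ := ih hy (hemb.isIrreducibleArray_vacuum hz' hirr' hy hX)
    obtain ⟨τ', hτ', he'⟩ := hemb.exists_arrayEquiv hz' hirr' hX hτ ha he
    refine ⟨σ⁻¹ * τ', _, ?_, ha.cons hk.le, ?_⟩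
    · simp only [Pi.mul_apply, Pi.inv_apply, Finset.prod_mul_distrib, Finset.prod_inv_distrib]
      rw [hσ, hτ', inv_one, one_mul]
    · have := he'.scaleRows σ⁻¹
      rwa [scaleRows_scaleRows, scaleRows_scaleRows, inv_mul_cancel, scaleRows_one] at this

end Classification

open OperatorArray

/-! ### Representations of the crystal algebra and arrays of operators -/

section Representation

variable {n : ℕ}

/-- The canonical generators, indexed by natural numbers. -/
def genArray (n i j : ℕ) : CrystalAlgebra n :=
  if h : i < n + 1 ∧ j < n + 1 then CrystalAlgebra.gen ⟨i, h.1⟩ ⟨j, h.2⟩ else 0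

theorem genArray_val (i j : Fin (n + 1)) : genArray n i j = CrystalAlgebra.gen i j :=
  dif_pos ⟨i.2, j.2⟩

theorem genArray_of_le {i j : ℕ} (hi : i ≤ n) (hj : j ≤ n) : genArray n i j
    = CrystalAlgebra.gen ⟨i, Nat.lt_succ_of_le hi⟩ ⟨j, Nat.lt_succ_of_le hj⟩ :=
  dif_pos ⟨Nat.lt_succ_of_le hi, Nat.lt_succ_of_le hj⟩

variable {H K : Type*} [NormedAddCommGroup H] [InnerProductSpace ℂ H] [CompleteSpace H]
  [NormedAddCommGroup K] [InnerProductSpace ℂ K] [CompleteSpace K]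

/-- The operators of a representation. -/
def repArray (σ : CrystalAlgebra n →⋆ₐ[ℂ] (H →L[ℂ] H)) (i j : ℕ) : H →L[ℂ] H := σ (genArray n i j)

theorem isCrystalArray_repArray (σ : CrystalAlgebra n →⋆ₐ[ℂ] (H →L[ℂ] H)) :
    IsCrystalArray n (repArray σ) :=
  ((isCrystalArray_iff genArray_val).2 CrystalAlgebra.isCrystalFamily_gen).map
    (σ : CrystalAlgebra n →+* (H →L[ℂ] H)) fun x => map_star σ x

theorem unitarilyEquivalent_iff {σ : CrystalAlgebra n →⋆ₐ[ℂ] (H →L[ℂ] H)}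
    {ρ : CrystalAlgebra n →⋆ₐ[ℂ] (K →L[ℂ] K)} :
    UnitarilyEquivalent σ ρ ↔ ArrayEquiv n (repArray σ) (repArray ρ) := by
  constructor
  · rintro ⟨U, hU⟩
    exact ⟨U, fun i j _ _ v => hU _ v⟩
  · rintro ⟨U, hU⟩
    have e : (U.conjStarAlgEquiv : (H →L[ℂ] H) →⋆ₐ[ℂ] (K →L[ℂ] K)).comp σ = ρ := by
      refine CrystalAlgebra.hom_ext fun i j => ?_
      ext v
      have := hU i j (by omega) (by omega) (U.symm v)
      rw [U.apply_symm_apply, repArray, repArray, genArray_val] at this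
      rw [← this]
      rfl
    refine ⟨U, fun a v => ?_⟩
    rw [← e]
    change _ = U (σ a (U.symm (U v)))
    rw [U.symm_apply_apply]

/-- Irreducibility can be tested on the generators: the projection onto a subspace that is invariant
under them commutes with them, because they form a self-adjoint family, and hence with the whole
representation. -/
theorem isIrreducible_iff {σ : CrystalAlgebra n →⋆ₐ[ℂ] (H →L[ℂ] H)} :
    IsIrreducible σ ↔ IsIrreducibleArray n (repArray σ) := by
  refine and_congr_right fun _ => forall_congr' fun V => forall_congr' fun hV =>
    imp_congr_left ⟨fun h i j _ _ => h _, fun h a v hv => ?_⟩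
  have := hV.completeSpace_coe
  have hred := isCrystalArray_repArray σ
  -- the reflection in `V` commutes with the generators, hence with the representation
  have e : (V.reflection.conjStarAlgEquiv : (H →L[ℂ] H) →⋆ₐ[ℂ] (H →L[ℂ] H)).comp σ = σ := by
    refine CrystalAlgebra.hom_ext fun i j => ?_
    have hcomm : ∀ v, V.reflection (σ (CrystalAlgebra.gen i j) v)
        = σ (CrystalAlgebra.gen i j) (V.reflection v) := by
      intro v
      obtain ⟨x, hx, y, hy, rfl⟩ := V.exists_add_mem_mem_orthogonal v
      have h1 := h i j (by omega) (by omega) x hx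
      have h2 := hred.orthogonal_mem h (i := i) (j := j) (by omega) (by omega) hy
      rw [repArray, genArray_val] at h1 h2
      rw [map_add, map_add, map_add, map_add, V.reflection_mem_subspace_eq_self h1,
        V.reflection_mem_subspace_eq_self hx, V.reflection_mem_subspace_orthogonalComplement_eq_neg h2,
        V.reflection_mem_subspace_orthogonalComplement_eq_neg hy, map_neg]
    ext v
    change V.reflection (σ (CrystalAlgebra.gen i j) (V.reflection.symm v)) = _
    rw [hcomm, V.reflection.apply_symm_apply]
  rw [← V.reflection_eq_self_iff]
  have e1 := congrArg (fun f => f v) (DFunLike.congr_fun e a)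
  change V.reflection (σ a (V.reflection.symm v)) = σ a v at e1
  rwa [V.reflection_symm, V.reflection_mem_subspace_eq_self hv] at e1

theorem OperatorFamily.exists_isRepresentation {X : OperatorFamily n} (hX : IsCrystalArray n X.natOp) :
    ∃ π : CrystalAlgebra n →⋆ₐ[ℂ] (X.space →L[ℂ] X.space), X.IsRepresentation π :=
  (CrystalAlgebra.existsUnique_lift ((isCrystalArray_iff X.natOp_val).1 hX)).exists

theorem OperatorFamily.IsRepresentation.arrayEquiv {X : OperatorFamily n}
    {π : CrystalAlgebra n →⋆ₐ[ℂ] (X.space →L[ℂ] X.space)} (h : X.IsRepresentation π) :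
    ArrayEquiv n (repArray π) X.natOp :=
  ArrayEquiv.of_eq fun i j hi hj => by
    rw [repArray, genArray_of_le hi hj, X.natOp_of_le hi hj, h]

end Representation

/-! ### The representations attached to reduced expressions -/

section ReducedExpression

variable {n : ℕ}

/-- The array of a reduced expression is that of the normal word of its permutation. -/
theorem IsReducedExpression.exists_arrayEquiv {w : Equiv.Perm (Fin (n + 1))} {a : List (Fin n)}
    (ha : IsReducedExpression w a) : ∃ c, IsNormalWord n c ∧
      natWordPerm c = natWordPerm (a.map Fin.val) ∧
      ArrayEquiv n (OperatorArray.ofWord (a.map Fin.val)).op (OperatorArray.ofWord c).op := by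
  obtain ⟨c, hc, h1, h2⟩ := ha.exists_isNormalWord
  exact ⟨c, hc, h1, h2.ofWord_equiv fun r hr => by
    obtain ⟨s, -, rfl⟩ := List.mem_map.1 hr
    exact s.2⟩

theorem isCrystalArray_natOp_ofWord (a : List (Fin n)) :
    IsCrystalArray n (OperatorFamily.ofWord a).natOp :=
  (natOp_ofWord_equiv a).symm.isCrystalArray (isCrystalArray_ofWord fun r hr => by
    obtain ⟨s, -, rfl⟩ := List.mem_map.1 hr
    exact s.2)

theorem isCrystalArray_natOp_ofTorusWord (t : Fin n → Circle) (a : List (Fin n)) :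
    IsCrystalArray n (OperatorFamily.ofTorusWord t a).natOp :=
  (natOp_ofTorusWord_equiv t a).symm.isCrystalArray ((isCrystalArray_ofWord fun r hr => by
    obtain ⟨s, -, rfl⟩ := List.mem_map.1 hr
    exact s.2).scaleRows (prod_torusPhase t))

theorem IsReducedExpression.natOp_ofTorusWord_equiv {w : Equiv.Perm (Fin (n + 1))} {a : List (Fin n)}
    (ha : IsReducedExpression w a) : ∃ c, IsNormalWord n c ∧
      natWordPerm c = natWordPerm (a.map Fin.val) ∧ ∀ t, ArrayEquiv n
        (OperatorFamily.ofTorusWord t a).natOp (scaleRows (torusPhase t) (OperatorArray.ofWord c).op) := by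
  obtain ⟨c, hc, h1, h2⟩ := ha.exists_arrayEquiv
  exact ⟨c, hc, h1, fun t => (CrystalSU.natOp_ofTorusWord_equiv t a).trans (h2.scaleRows _)⟩

/-- The representations of two reduced expressions of a permutation are equivalent. -/
theorem IsReducedExpression.natOp_ofWord_equiv {w : Equiv.Perm (Fin (n + 1))} {a b : List (Fin n)}
    (ha : IsReducedExpression w a) (hb : IsReducedExpression w b) :
    ArrayEquiv n (OperatorFamily.ofWord a).natOp (OperatorFamily.ofWord b).natOp := by
  obtain ⟨c, hc, h1, h2⟩ := ha.exists_arrayEquiv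
  obtain ⟨c', hc', h1', h2'⟩ := hb.exists_arrayEquiv
  obtain rfl : c = c' := hc.eq_of_natWordPerm_eq hc' (by
    rw [h1, h1', natWordPerm_map_val_eq_iff, ha.1, hb.1])
  exact (((CrystalSU.natOp_ofWord_equiv a).trans h2).trans h2'.symm).trans
    (CrystalSU.natOp_ofWord_equiv b).symm

/-- The array of a torus point and a reduced expression determines the torus point and the
permutation. -/
theorem IsReducedExpression.natOp_ofTorusWord_equiv_iff {t t' : Fin n → Circle}
    {w w' : Equiv.Perm (Fin (n + 1))} {a a' : List (Fin n)} (ha : IsReducedExpression w a)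
    (ha' : IsReducedExpression w' a') :
    ArrayEquiv n (OperatorFamily.ofTorusWord t a).natOp (OperatorFamily.ofTorusWord t' a').natOp ↔
      t = t' ∧ w = w' := by
  obtain ⟨c, hc, h1, h2⟩ := ha.natOp_ofTorusWord_equiv
  obtain ⟨c', hc', h1', h2'⟩ := ha'.natOp_ofTorusWord_equiv
  constructor
  · intro h
    obtain ⟨rfl, h3⟩ := hc.eq_of_arrayEquiv hc' (prod_torusPhase t) (prod_torusPhase t')
      (((h2 t).symm.trans h).trans (h2' t'))
    refine ⟨torusPhase_injective h3, ?_⟩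
    rw [← ha.1, ← ha'.1, ← natWordPerm_map_val_eq_iff, ← h1, ← h1']
  · rintro ⟨rfl, rfl⟩
    obtain rfl : c = c' := hc.eq_of_natWordPerm_eq hc' (by
      rw [h1, h1', natWordPerm_map_val_eq_iff, ha.1, ha'.1])
    exact (h2 t).trans (h2' t).symm

/-- Every irreducible crystal array comes from a torus point and a reduced expression. -/
theorem IsIrreducibleArray.exists_ofTorusWord {H : Type*} [NormedAddCommGroup H]
    [InnerProductSpace ℂ H] [CompleteSpace H] {z : ℕ → ℕ → H →L[ℂ] H} (hz : IsCrystalArray n z)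
    (hirr : IsIrreducibleArray n z) : ∃ (t : Fin n → Circle) (w : Equiv.Perm (Fin (n + 1)))
      (a : List (Fin n)), IsReducedExpression w a ∧
        ArrayEquiv n z (OperatorFamily.ofTorusWord t a).natOp := by
  obtain ⟨τ, c, hτ, hc, h⟩ := hirr.exists_isNormalWord n hz
  obtain ⟨t, ht⟩ := exists_torusPhase_eq hτ
  obtain ⟨b, hb⟩ := exists_map_val_eq hc.lt
  obtain ⟨a, ha⟩ := exists_isReducedExpression b
  obtain ⟨c', hc', h1, h2⟩ := ha.natOp_ofTorusWord_equiv
  obtain rfl : c = c' := hc.eq_of_natWordPerm_eq hc' (by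
    rw [h1, ← hb, natWordPerm_map_val_eq_iff, ha.1])
  refine ⟨t, _, a, ha, (h.trans (ArrayEquiv.of_eq fun i j hi _ => ?_)).trans (h2 t).symm⟩
  rw [CrystalSU.scaleRows, CrystalSU.scaleRows, ht i hi]

end ReducedExpression

end

end CrystalSU

theorem mainTheorem6 (n : ℕ) (hn : 1 ≤ n) :
    -- the representations attached to two reduced expressions of a permutation are equivalent
    (∀ (w : Equiv.Perm (Fin (n + 1))) (a b : List (Fin n)),
      CrystalSU.IsReducedExpression w a → CrystalSU.IsReducedExpression w b →
        ∃ (π : CrystalSU.CrystalAlgebra n →⋆ₐ[ℂ]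
              ((CrystalSU.OperatorFamily.ofWord a).space →L[ℂ]
                (CrystalSU.OperatorFamily.ofWord a).space))
          (ρ : CrystalSU.CrystalAlgebra n →⋆ₐ[ℂ]
              ((CrystalSU.OperatorFamily.ofWord b).space →L[ℂ]
                (CrystalSU.OperatorFamily.ofWord b).space)),
          (CrystalSU.OperatorFamily.ofWord a).IsRepresentation π ∧
            (CrystalSU.OperatorFamily.ofWord b).IsRepresentation ρ ∧
            CrystalSU.UnitarilyEquivalent π ρ) ∧
    -- each `π_{t,a}`, for a reduced expression `a`, is an irreducible representation
    (∀ (t : Fin n → Circle) (w : Equiv.Perm (Fin (n + 1))) (a : List (Fin n)),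
      CrystalSU.IsReducedExpression w a →
        ∃ π : CrystalSU.CrystalAlgebra n →⋆ₐ[ℂ]
            ((CrystalSU.OperatorFamily.ofTorusWord t a).space →L[ℂ]
              (CrystalSU.OperatorFamily.ofTorusWord t a).space),
          (CrystalSU.OperatorFamily.ofTorusWord t a).IsRepresentation π ∧
            CrystalSU.IsIrreducible π) ∧
    -- its equivalence class depends exactly on the pair `(t, w)`
    (∀ (t t' : Fin n → Circle) (w w' : Equiv.Perm (Fin (n + 1))) (a a' : List (Fin n)),
      CrystalSU.IsReducedExpression w a → CrystalSU.IsReducedExpression w' a' →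
        ∀ (π : CrystalSU.CrystalAlgebra n →⋆ₐ[ℂ]
              ((CrystalSU.OperatorFamily.ofTorusWord t a).space →L[ℂ]
                (CrystalSU.OperatorFamily.ofTorusWord t a).space))
          (π' : CrystalSU.CrystalAlgebra n →⋆ₐ[ℂ]
              ((CrystalSU.OperatorFamily.ofTorusWord t' a').space →L[ℂ]
                (CrystalSU.OperatorFamily.ofTorusWord t' a').space)),
          (CrystalSU.OperatorFamily.ofTorusWord t a).IsRepresentation π →
            (CrystalSU.OperatorFamily.ofTorusWord t' a').IsRepresentation π' →
              (CrystalSU.UnitarilyEquivalent π π' ↔ t = t' ∧ w = w')) ∧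
    -- every irreducible representation belongs to exactly one pair `(t, w)`
    (∀ {H : Type*} [NormedAddCommGroup H] [InnerProductSpace ℂ H] [CompleteSpace H]
      (σ : CrystalSU.CrystalAlgebra n →⋆ₐ[ℂ] (H →L[ℂ] H)), CrystalSU.IsIrreducible σ →
        ∃! p : (Fin n → Circle) × Equiv.Perm (Fin (n + 1)),
          ∃ (a : List (Fin n))
            (π : CrystalSU.CrystalAlgebra n →⋆ₐ[ℂ]
              ((CrystalSU.OperatorFamily.ofTorusWord p.1 a).space →L[ℂ]
                (CrystalSU.OperatorFamily.ofTorusWord p.1 a).space)),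
            CrystalSU.IsReducedExpression p.2 a ∧
              (CrystalSU.OperatorFamily.ofTorusWord p.1 a).IsRepresentation π ∧
              CrystalSU.UnitarilyEquivalent σ π) := by
  refine ⟨fun w a b ha hb => ?_, fun t w a ha => ?_, fun t t' w w' a a' ha ha' π π' hπ hπ' => ?_,
    fun σ hσ => ?_⟩
  · obtain ⟨π, hπ⟩ := CrystalSU.OperatorFamily.exists_isRepresentation
      (CrystalSU.isCrystalArray_natOp_ofWord a)
    obtain ⟨ρ, hρ⟩ := CrystalSU.OperatorFamily.exists_isRepresentation
      (CrystalSU.isCrystalArray_natOp_ofWord b)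
    exact ⟨π, ρ, hπ, hρ, CrystalSU.unitarilyEquivalent_iff.2
      ((hπ.arrayEquiv.trans (ha.natOp_ofWord_equiv hb)).trans hρ.arrayEquiv.symm)⟩
  · obtain ⟨π, hπ⟩ := CrystalSU.OperatorFamily.exists_isRepresentation
      (CrystalSU.isCrystalArray_natOp_ofTorusWord t a)
    obtain ⟨c, hc, -, h⟩ := ha.natOp_ofTorusWord_equiv
    exact ⟨π, hπ, CrystalSU.isIrreducible_iff.2 ((hπ.arrayEquiv.trans (h t)).symm.isIrreducibleArray
      (hc.isIrreducibleArray.scaleRows _))⟩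
  · rw [CrystalSU.unitarilyEquivalent_iff, ← ha.natOp_ofTorusWord_equiv_iff ha']
    exact ⟨fun h => (hπ.arrayEquiv.symm.trans h).trans hπ'.arrayEquiv,
      fun h => (hπ.arrayEquiv.trans h).trans hπ'.arrayEquiv.symm⟩
  · obtain ⟨t, w, a, ha, h⟩ := (CrystalSU.isIrreducible_iff.1 hσ).exists_ofTorusWord
      (CrystalSU.isCrystalArray_repArray σ)
    obtain ⟨π, hπ⟩ := CrystalSU.OperatorFamily.exists_isRepresentation
      (CrystalSU.isCrystalArray_natOp_ofTorusWord t a)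
    refine ⟨(t, w), ⟨a, π, ha, hπ, CrystalSU.unitarilyEquivalent_iff.2
      (h.trans hπ.arrayEquiv.symm)⟩, ?_⟩
    rintro ⟨t', w'⟩ ⟨a', π', ha', hπ', h'⟩
    obtain ⟨h1, h2⟩ := (ha'.natOp_ofTorusWord_equiv_iff ha).1 ((hπ'.arrayEquiv.symm.trans
      (CrystalSU.unitarilyEquivalent_iff.1 h').symm).trans h)
    exact Prod.ext h1 h2
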